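/- Let $m\ge 2$, $n=2m+1$, and let $(V,Q)$ be a non-degenerate quadratic space of dimension $n$ over $\mathbb F_3$. Let $I(V)$ be its isometry group, let $\Omega(V)=\Omega_{2m+1}(3)$ be the commutator subgroup of $I(V)$, and let $G$ be a group with $\Omega(V)\le G\le I(V)$. For a sign $\xi\in\{+,-\}$ let $\mathfrak E_\xi(V)$ be the set of points (one-dimensional subspaces) $\langle x\rangle$ of $V$ with $Q(x)\neq 0$ such that the $2m$-dimensional space $x^\perp$ has sign $\xi$, where the sign is $+$ if $x^\perp$ contains a totally singular subspace of dimension $m$ and $-$ otherwise. For $x\in\mathfrak E_\xi(V)$ let $\Delta(x)$ be the set of points of $\mathfrak E_\xi(V)$ lying in $x^\perp$, and let $\Gamma(x)=\mathfrak E_\xi(V)\setminus(\Delta(x)\cup\{x\})$. Let $\alpha$ be a prime and let $M\le G$ be of field-extension type $O_{n/\alpha}(3^\alpha)$. That is, let $\mathbb F_\sharp$ be the field with $3^\alpha$ elements, suppose that $V$ is the underlying $\mathbb F_3$-space of an $\mathbb F_\sharp$-vector space $V_\sharp$ (so $\alpha\mid n$), and that $Q=\mathrm{Tr}_{\mathbb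 F_\sharp/\mathbb F_3}\circ Q_\sharp$ for a quadratic form $Q_\sharp$ on $V_\sharp$; let $M$ be the group of all elements of $G$ that are $\mathbb F_\sharp$-semilinear. Then for each $\xi\in\{+,-\}$ the numbers $k=|\Delta(x)|$, $l=|\Gamma(x)|$, $\lambda=|\Delta(x)\cap\Delta(y)|$ for $y\in\Delta(x)$, and $\mu=|\Delta(x)\cap\Delta(y)|$ for $y\in\Gamma(x)$, do not depend on the choice of $x\in\mathfrak E_\xi(V)$ and $y$. Put $D=(\lambda-\mu)^2+4(k-\mu)$, $s=\tfrac12(\lambda-\mu+\sqrt D)$, $t=\tfrac12(\lambda-\mu-\sqrt D)$. For $x\in\mathfrak E_\xi(V)$ with $M$-orbit $xM$ put $d=|xM\cap\Delta(x)|$ and $c=|xM\cap\Gamma(x)|$, and for $r\in\{s,t\}$ consider the equation $$1+\frac{dr}{k}=\frac{(r+1)c}{l}.\qquad(1)$$ (a) If $\alpha\ne 3$, then there is an $M$-orbit $xM$ on $\mathfrak E_\xi(V)$ for which (1) holds neither for $r=s$ nor for $r=t$. (b) If $\alpha=3$, then $M$ has exactly three orbits on $\mathfrak E_\xi(V)$,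 and (1) holds for all of them with $r=s$ if $\xi=+$, and with $r=t$ if $\xi=-$. Moreover, if $P$ is the stabilizer in $G$ of a point of $\mathfrak E_\xi(V)$, then $1_P^G\not\le 1_M^G$, that is, the difference $1_M^G-1_P^G$ of the complex permutation characters of $G$ on the cosets of $M$ and of $P$ is not a character of $G$ (the zero function being counted as a character). -/

import Mathlib

open scoped LinearAlgebra.Projectivization

noncomputable section

namespace OrthRankThree

section Geometry

variable {F V : Type*} [Field F] [AddCommGroup V] [Module F V]

/-- The full isometry group `I(V)` of the quadratic space `(V, Q)`. -/
def isometryGroup (Q : QuadraticForm F V) : Subgroup (V ≃ₗ[F] V) where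
  carrier := {g | ∀ v, Q (g v) = Q v}
  mul_mem' {g h} hg hh v := (hg (h v)).trans (hh v)
  one_mem' _ := rfl
  inv_mem' {g} hg v := by
    have h := hg (g⁻¹ v)
    rw [← LinearEquiv.mul_apply, mul_inv_cancel] at h
    exact h.symm

/-- The group `Ω(V)`: the commutator subgroup of the full isometry group. For a nondegenerate
quadratic space of odd dimension at least three over a finite field of odd order, this is the
subgroup of index two in the special orthogonal group. -/
def Omega (Q : QuadraticForm F V) : Subgroup (V ≃ₗ[F] V) :=
  ⁅isometryGroup Q, isometryGroup Q⁆

/-- The subspace `x^⊥` of `V`, for a point `x` (a one-dimensional subspace) of `V`. -/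
def perp (Q : QuadraticForm F V) (x : ℙ F V) : Submodule F V :=
  LinearMap.BilinForm.orthogonal Q.polarBilin x.submodule

open Classical in
/-- The sign of (the restriction of `Q` to) a nondegenerate even-dimensional subspace `W`: it is
`+` if `W` has a totally singular subspace of half its dimension and `-` otherwise. -/
def sgn (Q : QuadraticForm F V) (W : Submodule F V) : ℤˣ :=
  if ∃ U : Submodule F V, U ≤ W ∧ (∀ u ∈ U, Q u = 0) ∧
    2 * Module.finrank F U = Module.finrank F W then 1 else -1

/-- The set `𝔈_ξ(V)` of non-singular points of type `ξ`, for `V` of odd dimension: the points `x`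
with `Q x ≠ 0` and `sgn (x^⊥) = ξ`. -/
def nonsingPoints (Q : QuadraticForm F V) (ξ : ℤˣ) : Set (ℙ F V) :=
  {x | Q x.rep ≠ 0 ∧ sgn Q (perp Q x) = ξ}

/-- `Δ(x)`: the points of `𝔈_ξ(V)` that lie in `x^⊥`. -/
def Delta (Q : QuadraticForm F V) (ξ : ℤˣ) (x : ℙ F V) : Set (ℙ F V) :=
  {y | y ∈ nonsingPoints Q ξ ∧ y.submodule ≤ perp Q x}

/-- `Γ(x)`: the points of `𝔈_ξ(V)` that are different from `x` and do not lie in `x^⊥`. -/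
def Gamma (Q : QuadraticForm F V) (ξ : ℤˣ) (x : ℙ F V) : Set (ℙ F V) :=
  {y | y ∈ nonsingPoints Q ξ ∧ y ≠ x ∧ ¬ y.submodule ≤ perp Q x}

/-- The subgroup of `G ≤ GL(V)` of those elements that are semilinear over the extension field `K`
of `F`, with respect to a given `K`-vector space structure on `V`. -/
def fieldExtSubgroup (K : Type*) [Field K] [Module K V] (G : Subgroup (V ≃ₗ[F] V)) :
    Subgroup G where
  carrier := {g | ∃ σ : K ≃+* K, ∀ (a : K) (v : V), g.1 (a • v) = σ a • g.1 v}
  mul_mem' := by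
    rintro g h ⟨σ, hσ⟩ ⟨τ, hτ⟩
    refine ⟨τ.trans σ, fun a v => ?_⟩
    change g.1 (h.1 (a • v)) = σ (τ a) • g.1 (h.1 v)
    rw [hτ, hσ]
  one_mem' := ⟨RingEquiv.refl K, fun _ _ => rfl⟩
  inv_mem' := by
    rintro g ⟨σ, hσ⟩
    refine ⟨σ.symm, fun a v => ?_⟩
    have key : ∀ w : V, g.1 ((g⁻¹).1 w) = w := fun w => by
      change (g.1 * g.1⁻¹) w = w
      rw [mul_inv_cancel]
      rfl
    apply g.1.injective
    rw [key, hσ, key, RingEquiv.apply_symm_apply]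

end Geometry

section RankThree

/-- Higman's parameters `k`, `l`, `λ`, `μ` of a set `E` with suborbits `Δ(x)` and `Γ(x)`. -/
structure IsHigmanParams {X : Type*} (E : Set X) (Δ Γ : X → Set X) (k l lam mu : ℕ) : Prop where
  card_Delta : ∀ x ∈ E, (Δ x).ncard = k
  card_Gamma : ∀ x ∈ E, (Γ x).ncard = l
  card_inter_of_mem_Delta : ∀ x ∈ E, ∀ y ∈ Δ x, (Δ x ∩ Δ y).ncard = lam
  card_inter_of_mem_Gamma : ∀ x ∈ E, ∀ y ∈ Γ x, (Δ x ∩ Δ y).ncard = mu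

/-- `D = (λ - μ)² + 4 (k - μ)`. -/
def discr (k lam mu : ℕ) : ℝ := ((lam : ℝ) - mu) ^ 2 + 4 * ((k : ℝ) - mu)

/-- The eigenvalue `s = (λ - μ + √D) / 2`. -/
def eigS (k lam mu : ℕ) : ℝ := ((lam : ℝ) - mu + √(discr k lam mu)) / 2

/-- The eigenvalue `t = (λ - μ - √D) / 2`. -/
def eigT (k lam mu : ℕ) : ℝ := ((lam : ℝ) - mu - √(discr k lam mu)) / 2

/-- The equation `1 + d r / k = (r + 1) c / l` for the `M`-orbit of `x`, where `d` and `c` are the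
numbers of points of that orbit in `Δ(x)` and in `Γ(x)`. -/
def OrbitEquation {X M : Type*} [Group M] [MulAction M X] (Δ Γ : X → Set X) (k l : ℕ) (r : ℝ)
    (x : X) : Prop :=
  1 + ((MulAction.orbit M x ∩ Δ x).ncard : ℝ) * r / k =
    (r + 1) * ((MulAction.orbit M x ∩ Γ x).ncard : ℝ) / l

end RankThree

section Characters

variable {G : Type*} [Group G]

/-- The permutation character `1_H^G` of `G` on the cosets of `H`, over `ℂ`. -/
def permChar (H : Subgroup G) : G → ℂ :=
  (Representation.ofMulAction ℂ G (G ⧸ H)).character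

/-- `χ ≤ ψ`: the difference `ψ - χ` is the character of a (finite-dimensional, possibly zero)
complex representation of `G`. -/
def CharLE (χ ψ : G → ℂ) : Prop :=
  ∃ (n : ℕ) (ρ : Representation ℂ G (Fin n → ℂ)), ψ - χ = ρ.character

end Characters

end OrthRankThree

end

/-! Write m = n + 1. Everything reduces to counting solutions of quadratic equations over F_3 and
over the extension field. For a nondegenerate form in dimension d over a field of order q, the
number N(c) of vectors of norm c satisfies q N(c) = q^d + T κ(c), where κ depends only on c and the
parity of d, and T is a signed power of q (`exists_hasCount`). Over F_3 the sign of T in even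
dimension is the sign of the space, so 𝔈_ξ(V) consists of the points of one fixed norm ε
(`exists_norm`). Counting in v^⊥ and in {v, w}^⊥ gives k, l and λ = μ with k - μ = 9^n, whence s, t
= ±3^n (`exists_isHigmanParams`). For r = ξ3^n equation (1) says that the orbit O of x satisfies |O|
= 3|O ∩ Δ(x)| + ξ3^(n+1).

Elements of M act on the norms Q_♯ through field automorphisms, and Ω of the large space lies in M,
so for dim V_♯ ≥ 3 the M-orbits are governed by norms. If α ≠ 3, the prime field has an element of
trace ε; it is fixed by all automorphisms, so the points having it as norm form one orbit, whose
size and intersection with Δ(x) are quadratic polynomials in T that violate (1)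
(`exists_not_orbitEquation_of_three_le`). If dim V_♯ = 1, an orbit has at most α points, which is
too few; only dimension 5 needs a carefully chosen point (`exists_ncard_orbit_Delta_le`).

If α = 3, the trace vanishes on F_3, and an element of F_27 of trace ε is determined up to conjugacy
by the trace of its square. This gives three orbits, and counting norms in {a, a^3, a^9} gives the
displayed identity for each of them (`ncard_orbit_cubic`).

For the characters, consider the r-eigenspace of the collinearity matrix of Δ with r = ξ3^n. The
identity says that the projection of the indicator of every M-orbit to this eigenspace is orthogonal
to that indicator, hence zero, so M fixes no nonzero vector there. The projection of the indicator
of a single point is a nonzero vector fixed by its stabilizer P. By Frobenius reciprocity the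
eigenspace pairs to zero with 1_M^G and positively with 1_P^G (`RankThreeRel.not_charLE`). -/

open scoped LinearAlgebra.Projectivization

noncomputable section

namespace OrthRankThree

/-! ### Splitting off a nonsingular vector -/

section Splitting

variable {F V : Type*} [Field F] [AddCommGroup V] [Module F V] (Q : QuadraticForm F V)

/-- The polar form of `Q` has trivial left radical. -/
def Nondeg : Prop := ∀ x, (∀ y, QuadraticMap.polar Q x y = 0) → x = 0

/-- The hyperplane of vectors orthogonal to the vector `x`. -/
def vperp (x : V) : Submodule F V := LinearMap.ker (Q.polarBilin x)

/-- The restriction of `Q` to a subspace. -/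
def restr (W : Submodule F V) : QuadraticForm F W := Q.comp W.subtype

/-- The number of vectors `v` with `Q v = c`. -/
def cnt (c : F) : ℕ := Nat.card {v : V // Q v = c}

variable {Q}

lemma mem_vperp {x y : V} : y ∈ vperp Q x ↔ QuadraticMap.polar Q x y = 0 := Iff.rfl

@[simp] lemma restr_apply (W : Submodule F V) (w : W) : restr Q W w = Q w := rfl

lemma polar_restr (W : Submodule F V) (v w : W) :
    QuadraticMap.polar (restr Q W) v w = QuadraticMap.polar Q (v : V) w := rfl

lemma polar_self' (x : V) : QuadraticMap.polar Q x x = 2 * Q x := by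
  rw [QuadraticMap.polar_self, two_smul, two_mul]

lemma map_add' (x y : V) : Q (x + y) = Q x + Q y + QuadraticMap.polar Q x y := by
  rw [QuadraticMap.polar]; ring

lemma map_smul_add (b : F) (x z : V) :
    Q (b • x + z) = b * b * Q x + Q z + b * QuadraticMap.polar Q x z := by
  rw [map_add', QuadraticMap.map_smul, QuadraticMap.polar_smul_left, smul_eq_mul, smul_eq_mul]

/-- The decomposition of `V` as the orthogonal sum of `⟨x⟩` and the complement of `x`. -/
def splitEquiv (h2 : (2 : F) ≠ 0) {x : V} (hx : Q x ≠ 0) : (F × vperp Q x) ≃ₗ[F] V where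
  toFun p := p.1 • x + p.2
  map_add' p p' := by simp only [Prod.fst_add, Prod.snd_add, Submodule.coe_add]; module
  map_smul' a p := by simp only [Prod.smul_fst, Prod.smul_snd, Submodule.coe_smul,
    RingHom.id_apply, smul_eq_mul]; module
  invFun v := ⟨QuadraticMap.polar Q x v / (2 * Q x),
    ⟨v - (QuadraticMap.polar Q x v / (2 * Q x)) • x, by
      rw [mem_vperp, QuadraticMap.polar_sub_right, QuadraticMap.polar_smul_right, polar_self',
        smul_eq_mul]
      field_simp
      ring⟩⟩
  left_inv p := by
    obtain ⟨b, z, hz⟩ := p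
    have h : QuadraticMap.polar Q x (b • x + z) / (2 * Q x) = b := by
      rw [QuadraticMap.polar_add_right, mem_vperp.1 hz, QuadraticMap.polar_smul_right, polar_self',
        smul_eq_mul]
      field_simp
      ring
    refine Prod.ext h (Subtype.ext ?_)
    change b • x + z - (QuadraticMap.polar Q x (b • x + z) / (2 * Q x)) • x = z
    rw [h, add_sub_cancel_left]
  right_inv v := by simp

lemma splitEquiv_apply (h2 : (2 : F) ≠ 0) {x : V} (hx : Q x ≠ 0) (p : F × vperp Q x) :
    splitEquiv h2 hx p = p.1 • x + p.2 := rfl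

lemma finrank_vperp [FiniteDimensional F V] (h2 : (2 : F) ≠ 0) {x : V} (hx : Q x ≠ 0) :
    Module.finrank F (vperp Q x) + 1 = Module.finrank F V := by
  rw [← (splitEquiv h2 hx).finrank_eq, Module.finrank_prod, Module.finrank_self, add_comm]

lemma Nondeg.vperp (h2 : (2 : F) ≠ 0) (hQ : Nondeg Q) {x : V} (hx : Q x ≠ 0) :
    Nondeg (restr Q (vperp Q x)) := by
  intro z hz
  apply Subtype.ext
  refine hQ _ fun v => ?_
  obtain ⟨⟨b, w⟩, rfl⟩ := (splitEquiv h2 hx).surjective v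
  have h1 := mem_vperp.1 z.2
  have h3 := hz w
  rw [polar_restr] at h3
  rw [splitEquiv_apply, QuadraticMap.polar_add_right, QuadraticMap.polar_smul_right, h3,
    QuadraticMap.polar_comm, h1, smul_zero, add_zero]

lemma Nondeg.exists_ne_zero (hQ : Nondeg Q) [Nontrivial V] :
    ∃ x, Q x ≠ 0 := by
  by_contra! h
  obtain ⟨x, hx⟩ := exists_ne (0 : V)
  exact hx (hQ x fun y => by simp [QuadraticMap.polar, h])

lemma card_split [Fintype F] [Finite V] (h2 : (2 : F) ≠ 0) {x : V} (hx : Q x ≠ 0) (c : F)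
    (p : F → Prop) [DecidablePred p] :
    Nat.card {v : V // Q v = c ∧ p (QuadraticMap.polar Q x v)} =
      ∑ b : F with p (2 * b * Q x), cnt (restr Q (vperp Q x)) (c - b * b * Q x) := by
  have e : {v : V // Q v = c ∧ p (QuadraticMap.polar Q x v)} ≃
      Σ b : {b : F // p (2 * b * Q x)}, {z : vperp Q x // restr Q (vperp Q x) z =
        c - b.1 * b.1 * Q x} :=
    { toFun := fun v => ⟨⟨((splitEquiv h2 hx).symm v.1).1, by
          obtain ⟨v, hv, hp⟩ := v
          obtain ⟨⟨b, z⟩, rfl⟩ := (splitEquiv h2 hx).surjective v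
          rw [splitEquiv_apply, QuadraticMap.polar_add_right, mem_vperp.1 z.2,
            QuadraticMap.polar_smul_right, polar_self', smul_eq_mul, add_zero] at hp
          simp only [LinearEquiv.symm_apply_apply]
          convert hp using 1
          ring⟩, ⟨((splitEquiv h2 hx).symm v.1).2, by
          obtain ⟨v, hv, hp⟩ := v
          obtain ⟨⟨b, z⟩, rfl⟩ := (splitEquiv h2 hx).surjective v
          rw [splitEquiv_apply, map_smul_add, mem_vperp.1 z.2] at hv
          simp only [LinearEquiv.symm_apply_apply, restr_apply]
          rw [← hv]; ring⟩⟩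
      invFun := fun y => ⟨splitEquiv h2 hx (y.1.1, y.2.1), by
          obtain ⟨⟨b, hb⟩, z, hz⟩ := y
          rw [restr_apply] at hz
          refine ⟨?_, ?_⟩
          · rw [splitEquiv_apply, map_smul_add, mem_vperp.1 z.2, hz]; ring
          · rw [splitEquiv_apply, QuadraticMap.polar_add_right, mem_vperp.1 z.2,
              QuadraticMap.polar_smul_right, polar_self', smul_eq_mul, add_zero]
            convert hb using 1
            ring⟩
      left_inv := fun v => by simp
      right_inv := fun y => by
        obtain ⟨⟨b, hb⟩, z, hz⟩ := y
        exact Sigma.subtype_ext (Subtype.ext (by simp)) (by simp) }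
  rw [Nat.card_congr e, Nat.card_sigma]
  simp only [cnt]
  rw [← Finset.sum_subtype_eq_sum_filter]
  refine Finset.sum_congr ?_ fun _ _ => rfl
  ext; simp

lemma cnt_split [Fintype F] [Finite V] (h2 : (2 : F) ≠ 0) {x : V} (hx : Q x ≠ 0) (c : F) :
    cnt Q c = ∑ b : F, cnt (restr Q (vperp Q x)) (c - b * b * Q x) := by
  have := card_split h2 hx c (fun _ => True)
  simpa [cnt] using this

end Splitting

/-! ### Quadratic character sums -/

section Jacobsthal

variable {F : Type*} [Field F] [Fintype F] [DecidableEq F]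

lemma sum_quadraticChar_linear (hF : ringChar F ≠ 2) {a : F} (ha : a ≠ 0) (c : F) :
    ∑ t : F, quadraticChar F (c - a * t) = 0 := by
  rw [← quadraticChar_sum_zero hF]
  refine Fintype.sum_equiv ((Equiv.mulLeft₀ a ha).trans (Equiv.subLeft c)) _ _ fun t => ?_
  simp

/-- An element t has χ(t) + 1 square roots, so sums over squares become character sums. -/
lemma sum_comp_sq (hF : ringChar F ≠ 2) (f : F → ℤ) :
    ∑ b : F, f (b * b) = ∑ t : F, f t * (quadraticChar F t + 1) := by
  rw [← Finset.sum_fiberwise_of_maps_to (g := fun b : F => b * b) (t := Finset.univ)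
    (fun _ _ => Finset.mem_univ _)]
  refine Finset.sum_congr rfl fun t _ => ?_
  rw [← quadraticChar_card_sqrts hF t, Finset.sum_congr rfl (g := fun _ => f t), Finset.sum_const,
    nsmul_eq_mul, mul_comm]
  · congr 2
    congr 1
    ext b; simp [pow_two]
  · intro b hb
    rw [(Finset.mem_filter.1 hb).2]

/-- The number of solutions of `c = a b²`. -/
lemma sum_even_kernel (hF : ringChar F ≠ 2) {a : F} (ha : a ≠ 0) (c : F) :
    ∑ b : F, (if c - b * b * a = 0 then (Fintype.card F : ℤ) - 1 else -1) =
      Fintype.card F * quadraticChar F a * quadraticChar F c := by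
  rw [sum_comp_sq hF (fun t => if c - t * a = 0 then (Fintype.card F : ℤ) - 1 else -1)]
  have h : ∀ t : F, (if c - t * a = 0 then (Fintype.card F : ℤ) - 1 else -1) *
      (quadraticChar F t + 1) = (if t = c / a then Fintype.card F * (quadraticChar F t + 1) else 0)
        - quadraticChar F t - 1 := by
    intro t
    have : c - t * a = 0 ↔ t = c / a := by
      rw [sub_eq_zero, eq_div_iff ha, eq_comm]
    simp only [this]
    split_ifs <;> ring
  simp only [h, Finset.sum_sub_distrib, quadraticChar_sum_zero hF, Finset.sum_ite_eq',
    Finset.mem_univ, if_true]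
  have h1 : quadraticChar F (c / a) = quadraticChar F a * quadraticChar F c := by
    have : quadraticChar F c = quadraticChar F (c / a) * quadraticChar F a := by
      rw [← map_mul, div_mul_cancel₀ _ ha]
    rw [this, mul_comm, mul_assoc, ← pow_two, quadraticChar_sq_one ha, mul_one]
  rw [h1]
  simp
  ring

lemma sum_odd_kernel (hF : ringChar F ≠ 2) {a : F} (ha : a ≠ 0) (c : F) :
    ∑ b : F, quadraticChar F (c - b * b * a) =
      quadraticChar F (-a) * (if c = 0 then (Fintype.card F : ℤ) - 1 else -1) := by
  split_ifs with hc
  · subst hc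
    have h : ∀ b : F, quadraticChar F (0 - b * b * a) =
        quadraticChar F (-a) - (if b = 0 then quadraticChar F (-a) else 0) := by
      intro b
      split_ifs with hb
      · simp [hb]
      · rw [show 0 - b * b * a = b ^ 2 * (-a) by ring, map_mul, quadraticChar_sq_one' hb]; ring
    simp only [h, Finset.sum_sub_distrib, Finset.sum_ite_eq', Finset.mem_univ, if_true,
      Finset.sum_const, Finset.card_univ, nsmul_eq_mul]
    ring
  · rw [sum_comp_sq hF (fun t => quadraticChar F (c - t * a))]
    have h0 := sum_quadraticChar_linear hF ha c
    have h1 := sum_quadraticChar_linear hF (neg_ne_zero.2 hc) (-a)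
    -- Dividing by t² and substituting t ↦ t⁻¹ makes the argument linear; the value at 0 is missing
    -- and is subtracted.
    have h3 : ∑ t : F, quadraticChar F (c - t * a) * quadraticChar F t =
        ∑ t : F, (quadraticChar F (-a - (-c) * t) - if t = 0 then quadraticChar F (-a) else 0) := by
      refine Fintype.sum_equiv (Equiv.inv F) _ _ fun t => ?_
      simp only [Equiv.inv_apply, inv_eq_zero]
      split_ifs with ht
      · simp [ht]
      · rw [sub_zero, ← map_mul, show (c - t * a) * t = t ^ 2 * (-a - -c * t⁻¹) by
          field_simp; ring, map_mul, quadraticChar_sq_one' ht, one_mul]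
    simp only [mul_add, mul_one, Finset.sum_add_distrib, h3, Finset.sum_sub_distrib, h1,
      Finset.sum_ite_eq', Finset.mem_univ, if_true]
    have h0' : ∑ t : F, quadraticChar F (c - t * a) = 0 := by
      rw [← h0]; exact Finset.sum_congr rfl fun t _ => by rw [mul_comm]
    rw [h0']
    ring

end Jacobsthal

/-! ### Number of vectors of a given norm -/

section HasCount

variable {F V : Type*} [Field F] [Fintype F] [DecidableEq F] [AddCommGroup V] [Module F V]

/-- The deviation of the number of solutions of `Q v = c` from its mean value, up to scaling. -/
def devKernel (F : Type*) [Field F] [Fintype F] [DecidableEq F] (d : ℕ) (c : F) : ℤ :=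
  if Even d then (if c = 0 then (Fintype.card F : ℤ) - 1 else -1) else quadraticChar F c

/-- The numbers of solutions of `Q v = c` are governed by the (signed) constant `T`. -/
structure HasCount (Q : QuadraticForm F V) (T : ℤ) : Prop where
  sq_eq : T ^ 2 = (Fintype.card F : ℤ) ^ (2 * ((Module.finrank F V + 1) / 2))
  card_mul : ∀ c, (Fintype.card F : ℤ) * cnt Q c =
    (Fintype.card F : ℤ) ^ Module.finrank F V + T * devKernel F (Module.finrank F V) c

variable {Q : QuadraticForm F V}

/-- Adding the line ⟨x⟩ convolves the deviation with the values b²Q(x). The sum `sum_even_kernel`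
turns the even kernel into the odd one and contributes q χ(Q x). -/
lemma HasCount.of_even [Finite V] (hF : ringChar F ≠ 2) {x : V} (hx : Q x ≠ 0) {T : ℤ}
    (hd : Even (Module.finrank F (vperp Q x))) (h : HasCount (restr Q (vperp Q x)) T) :
    HasCount Q (Fintype.card F * quadraticChar F (Q x) * T) := by
  have h2 := Ring.two_ne_zero hF
  have hfr := finrank_vperp h2 hx
  set d := Module.finrank F (vperp Q x) with hd'
  obtain ⟨j, hj⟩ := hd
  refine ⟨?_, fun c => ?_⟩
  · rw [mul_pow, mul_pow, quadraticChar_sq_one hx, h.sq_eq, ← hd', ← hfr]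
    rw [show (d + 1) / 2 = j by lia, show (d + 1 + 1) / 2 = j + 1 by lia]
    ring
  · rw [cnt_split h2 hx c]
    push_cast
    rw [Finset.mul_sum]
    simp only [h.card_mul, ← hd', Finset.sum_add_distrib, ← Finset.mul_sum]
    have e1 : Even d := ⟨j, hj⟩
    have e2 : ¬ Even (d + 1) := by simpa [Nat.even_add_one] using e1
    simp only [devKernel, if_pos e1, ← hfr, if_neg e2, sum_even_kernel hF hx, Finset.sum_const,
      Finset.card_univ, nsmul_eq_mul]
    ring

/-- Here `sum_odd_kernel` turns the character back into the even kernel. No factor q appears, in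
agreement with the exponent ⌈d/2⌉ in `sq_eq`. -/
lemma HasCount.of_odd [Finite V] (hF : ringChar F ≠ 2) {x : V} (hx : Q x ≠ 0) {T : ℤ}
    (hd : Odd (Module.finrank F (vperp Q x))) (h : HasCount (restr Q (vperp Q x)) T) :
    HasCount Q (quadraticChar F (-Q x) * T) := by
  have h2 := Ring.two_ne_zero hF
  have hfr := finrank_vperp h2 hx
  set d := Module.finrank F (vperp Q x) with hd'
  obtain ⟨j, hj⟩ := hd
  refine ⟨?_, fun c => ?_⟩
  · rw [mul_pow, quadraticChar_sq_one (neg_ne_zero.2 hx), h.sq_eq, ← hd', ← hfr]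
    rw [show (d + 1) / 2 = j + 1 by lia, show (d + 1 + 1) / 2 = j + 1 by lia]
    ring
  · rw [cnt_split h2 hx c]
    push_cast
    rw [Finset.mul_sum]
    simp only [h.card_mul, ← hd', Finset.sum_add_distrib, ← Finset.mul_sum]
    have e1 : ¬ Even d := by rw [Nat.not_even_iff_odd]; exact ⟨j, hj⟩
    have e2 : Even (d + 1) := by simpa [Nat.even_add_one] using e1
    simp only [devKernel, if_neg e1, ← hfr, if_pos e2, sum_odd_kernel hF hx, Finset.sum_const,
      Finset.card_univ, nsmul_eq_mul]
    ring

theorem exists_hasCount [Finite V] (hF : ringChar F ≠ 2) (hQ : Nondeg Q) :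
    ∃ T, HasCount Q T := by
  have h2 := Ring.two_ne_zero hF
  obtain ⟨d, hd⟩ : ∃ d, Module.finrank F V = d := ⟨_, rfl⟩
  induction d generalizing V with
  | zero =>
    have : Subsingleton V := Module.finrank_zero_iff.1 hd
    refine ⟨1, ?_, fun c => ?_⟩
    · simp [hd]
    · have hc : (cnt Q c : ℤ) = if c = 0 then 1 else 0 := by
        have h0 : ∀ v : V, Q v = 0 := fun v => by rw [Subsingleton.elim v 0]; simp
        split_ifs with h
        · subst h
          simp [cnt, h0]
        · have : IsEmpty {v : V // Q v = c} := ⟨fun v => h (by rw [← v.2, h0])⟩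
          simp [cnt]
      rw [hc]
      simp only [hd, devKernel, Even.zero, if_true]
      split_ifs <;> simp
  | succ d ih =>
    have : Nontrivial V := Module.nontrivial_of_finrank_pos (R := F) (by lia)
    obtain ⟨x, hx⟩ := hQ.exists_ne_zero
    have hfr := finrank_vperp h2 hx
    obtain ⟨T, hT⟩ := ih (hQ.vperp h2 hx) (by lia)
    rcases Nat.even_or_odd (Module.finrank F (vperp Q x)) with he | ho
    · exact ⟨_, hT.of_even hF hx he⟩
    · exact ⟨_, hT.of_odd hF hx ho⟩

/-- The kernel does not vanish at c = 1. Uniqueness is what allows the sign of a space to be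
compared with that of a hyperplane in it. -/
lemma HasCount.unique {T T' : ℤ} (h : HasCount Q T) (h' : HasCount Q T') : T = T' := by
  have e := (h.card_mul 1).symm.trans (h'.card_mul 1)
  have hk : devKernel F (Module.finrank F V) 1 ≠ 0 := by
    rw [devKernel]; split_ifs <;> simp_all
  exact mul_right_cancel₀ hk (add_left_cancel e)

end HasCount

/-! ### Counting in the perp of a totally singular subspace -/

section Fibres

variable {F V : Type*} [Field F] [AddCommGroup V] [Module F V]

lemma card_fibre_mul [Finite V] [Finite F] {f : V →ₗ[F] F} (hf : f ≠ 0) (t : F) :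
    Nat.card F * Nat.card {v : V // f v = t} = Nat.card V := by
  have := Fintype.ofFinite F
  have hs := LinearMap.surjective hf
  have key : ∀ s, Nat.card {v : V // f v = s} = Nat.card {v : V // f v = t} := by
    intro s
    obtain ⟨w, hw⟩ := hs (t - s)
    exact Nat.card_congr ((Equiv.addRight w).subtypeEquiv fun v => by
      simp only [Equiv.coe_addRight, map_add, hw]
      constructor
      · rintro rfl; ring
      · intro h; linear_combination h)
  rw [← Nat.card_congr (Equiv.sigmaFiberEquiv f), Nat.card_sigma]
  simp [key]

-- Average over the translates v + u with u in U, where Q(v + u) = Q(v) + B(u, v). If v is not in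
-- U^⊥ this takes each value equally often; if v is in U^⊥ it is constant. Multiplying by |U| and
-- summing over v gives the identity.
open Classical in
lemma card_isotropic [Finite V] [Finite F] (Q : QuadraticForm F V) (U : Submodule F V)
    (hU : ∀ u ∈ U, Q u = 0) (c : F) :
    Nat.card F * cnt Q c + Nat.card {v : V // ∀ u ∈ U, QuadraticMap.polar Q u v = 0} =
      Nat.card V + Nat.card F *
        Nat.card {v : V // (∀ u ∈ U, QuadraticMap.polar Q u v = 0) ∧ Q v = c} := by
  have := Fintype.ofFinite F
  have := Fintype.ofFinite V
  have hpos : 0 < Nat.card U := Nat.card_pos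
  apply Nat.eq_of_mul_eq_mul_left hpos
  have hc : ∀ (p : V → Prop) [DecidablePred p],
      Nat.card {v : V // p v} = ∑ v : V, if p v then 1 else 0 := by
    intro p _
    rw [Nat.card_eq_fintype_card, Fintype.card_subtype, Finset.card_filter]
  have h1 : Nat.card U * cnt Q c = ∑ v : V, Nat.card {u : U // Q (v + u) = c} := by
    have h2 : ∀ v, Nat.card {u : U // Q (v + u) = c} = ∑ u : U, if Q (v + u) = c then 1 else 0 := by
      intro v
      rw [Nat.card_eq_fintype_card, Fintype.card_subtype, Finset.card_filter]
    simp only [h2]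
    rw [Finset.sum_comm]
    have h3 : ∀ u : U, (∑ v : V, if Q (v + u) = c then 1 else 0) = cnt Q c := by
      intro u
      rw [cnt, hc]
      exact Fintype.sum_equiv (Equiv.addRight (u : V)) _ _ fun v => rfl
    simp only [h3, Finset.sum_const, Finset.card_univ, Nat.card_eq_fintype_card, smul_eq_mul]
  have h4 : ∀ v : V, Nat.card F * Nat.card {u : U // Q (v + u) = c} +
      Nat.card U * (if ∀ u ∈ U, QuadraticMap.polar Q u v = 0 then 1 else 0) =
      Nat.card U + Nat.card F * Nat.card U *
        (if (∀ u ∈ U, QuadraticMap.polar Q u v = 0) ∧ Q v = c then 1 else 0) := by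
    intro v
    have hQ : ∀ u : U, Q (v + u) = Q v + QuadraticMap.polar Q u v := by
      intro u
      rw [map_add', hU u u.2, add_zero, QuadraticMap.polar_comm]
    by_cases hv : ∀ u ∈ U, QuadraticMap.polar Q u v = 0
    · have : ∀ u : U, Q (v + u) = Q v := fun u => by rw [hQ, hv u u.2, add_zero]
      simp only [this]
      rw [if_pos hv]
      by_cases hc : Q v = c
      · rw [if_pos ⟨hv, hc⟩]
        rw [Nat.card_congr (Equiv.subtypeUnivEquiv fun _ : U => hc)]
        ring
      · rw [if_neg fun h => hc h.2]
        simp [hc]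
    · have hf : (Q.polarBilin v).comp U.subtype ≠ 0 := by
        intro h
        apply hv
        intro u hu
        rw [QuadraticMap.polar_comm]
        exact LinearMap.congr_fun h ⟨u, hu⟩
      have := card_fibre_mul hf (c - Q v)
      simp only [hv, if_false, false_and, mul_zero, add_zero]
      rw [← this]
      congr 1
      refine Nat.card_congr (Equiv.subtypeEquivRight fun u => ?_)
      rw [hQ, QuadraticMap.polar_comm]
      change _ ↔ QuadraticMap.polar Q v u = c - Q v
      rw [eq_sub_iff_add_eq, add_comm]
  have h5 := Finset.sum_congr (rfl : (Finset.univ : Finset V) = Finset.univ) fun v _ => h4 v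
  simp only [Finset.sum_add_distrib, ← Finset.mul_sum, Finset.sum_const, Finset.card_univ,
    ← Nat.card_eq_fintype_card, smul_eq_mul] at h5
  rw [← h1] at h5
  rw [hc (fun v => ∀ u ∈ U, QuadraticMap.polar Q u v = 0),
    hc (fun v => (∀ u ∈ U, QuadraticMap.polar Q u v = 0) ∧ Q v = c)]
  linear_combination h5

end Fibres

/-! ### The sign of a space read off from its counting constant -/

section Sign

variable {V : Type*} [AddCommGroup V] [Module (ZMod 3) V] {Q : QuadraticForm (ZMod 3) V}

lemma ringChar_zmod_three : ringChar (ZMod 3) ≠ 2 := by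
  rw [ZMod.ringChar_zmod_n]; norm_num

lemma two_ne_zero_zmod : (2 : ZMod 3) ≠ 0 := by decide

lemma Nondeg.polarBilin_nondegenerate {F W : Type*} [Field F] [AddCommGroup W] [Module F W]
    {Q : QuadraticForm F W} (h : Nondeg Q) : Q.polarBilin.Nondegenerate :=
  ⟨h, fun y hy => h y fun x => by rw [QuadraticMap.polar_comm]; exact hy x⟩

/-- Maximality means that U contains all singular vectors of U^⊥, so `card_isotropic` at c = 0
becomes explicit. The number i measures how far U is from dimension m. -/
lemma card_isotropic_of_maximal [Finite V] (hQ : Nondeg Q) {m : ℕ}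
    (hm : Module.finrank (ZMod 3) V = 2 * m) {T : ℤ} (hT : HasCount Q T)
    (U : Submodule (ZMod 3) V) (hU : ∀ u ∈ U, Q u = 0)
    (hmax : ∀ v, (∀ u ∈ U, QuadraticMap.polar Q u v = 0) → Q v = 0 → v ∈ U) :
    ∃ i, Module.finrank (ZMod 3) U + i = m ∧
      2 * T + 3 ^ (Module.finrank (ZMod 3) U + 2 * i) = 3 ^ (Module.finrank (ZMod 3) U + 1) := by
  set j := Module.finrank (ZMod 3) U with hj
  have hUU : ∀ v ∈ U, ∀ u ∈ U, QuadraticMap.polar Q u v = 0 := by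
    intro v hv u hu
    rw [QuadraticMap.polar, hU _ (U.add_mem hu hv), hU u hu, hU v hv]; ring
  have horth := LinearMap.BilinForm.finrank_orthogonal hQ.polarBilin_nondegenerate
    U
  have hle : U ≤ LinearMap.BilinForm.orthogonal Q.polarBilin U := fun v hv u hu => hUU v hv u hu
  have hle' := Submodule.finrank_mono hle
  have hjV := Submodule.finrank_le U
  rw [horth, hm, ← hj] at hle'
  rw [← hj, hm] at hjV
  obtain ⟨i, rfl⟩ : ∃ i, m = j + i := ⟨m - j, by lia⟩
  refine ⟨i, rfl, ?_⟩
  have h := card_isotropic Q U hU 0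
  have c1 : Nat.card {v : V // ∀ u ∈ U, QuadraticMap.polar Q u v = 0} = 3 ^ (j + 2 * i) := by
    have : Nat.card (LinearMap.BilinForm.orthogonal Q.polarBilin U) = 3 ^ (j + 2 * i) := by
      rw [Module.natCard_eq_pow_finrank (K := ZMod 3), horth, hm, ← hj, Nat.card_zmod]
      congr 1; lia
    exact this
  have c2 : Nat.card {v : V // (∀ u ∈ U, QuadraticMap.polar Q u v = 0) ∧ Q v = 0} = 3 ^ j := by
    have : Nat.card U = 3 ^ j := by
      rw [Module.natCard_eq_pow_finrank (K := ZMod 3), Nat.card_zmod]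
    rw [← this]
    exact Nat.card_congr (Equiv.subtypeEquivRight fun v =>
      ⟨fun h => hmax v h.1 h.2, fun h => ⟨hUU v h, hU v h⟩⟩)
  have c3 : Nat.card V = 3 ^ (2 * (j + i)) := by
    rw [Module.natCard_eq_pow_finrank (K := ZMod 3), Nat.card_zmod, hm]
  rw [c1, c2, c3, Nat.card_zmod] at h
  have h0 := hT.card_mul 0
  simp only [hm, devKernel, even_two_mul, if_true, ZMod.card] at h0
  zify at h
  push_cast at h0
  rw [h0] at h
  rw [pow_succ]
  linear_combination h

/-- With i = 0 the relation of `card_isotropic_of_maximal` reads T = 3^m. Conversely, for T = 3^m a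
maximal totally singular subspace must have i = 0, because the left side of the relation is too
large otherwise. -/
lemma exists_totallySingular_iff [Finite V] (hQ : Nondeg Q) {m : ℕ}
    (hm : Module.finrank (ZMod 3) V = 2 * m) {T : ℤ} (hT : HasCount Q T) :
    (∃ U : Submodule (ZMod 3) V, (∀ u ∈ U, Q u = 0) ∧
      2 * Module.finrank (ZMod 3) U = Module.finrank (ZMod 3) V) ↔ T = 3 ^ m := by
  constructor
  · rintro ⟨U, hU, hdim⟩
    obtain ⟨i, hi, h⟩ := card_isotropic_of_maximal hQ hm hT U hU (by
      have hUU : ∀ v ∈ U, ∀ u ∈ U, QuadraticMap.polar Q u v = 0 := by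
        intro v hv u hu
        rw [QuadraticMap.polar, hU _ (U.add_mem hu hv), hU u hu, hU v hv]; ring
      have horth := LinearMap.BilinForm.finrank_orthogonal hQ.polarBilin_nondegenerate
        U
      have hle : U ≤ LinearMap.BilinForm.orthogonal Q.polarBilin U :=
        fun v hv u hu => hUU v hv u hu
      have heq := Submodule.eq_of_le_of_finrank_eq hle (by lia)
      intro v hv _
      rw [heq]
      exact hv)
    obtain rfl : i = 0 := by lia
    obtain rfl : Module.finrank (ZMod 3) U = m := by lia
    rw [pow_succ] at h
    simp only [mul_zero, add_zero] at h
    linarith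
  · intro hT3
    have : Finite (Submodule (ZMod 3) V) := Finite.of_injective _ SetLike.coe_injective
    obtain ⟨U, hU⟩ := Set.Finite.exists_maximal
      (Set.toFinite {U : Submodule (ZMod 3) V | ∀ u ∈ U, Q u = 0})
      ⟨⊥, fun u hu => by rw [(Submodule.mem_bot _).1 hu]; exact QuadraticMap.map_zero Q⟩
    refine ⟨U, hU.prop, ?_⟩
    obtain ⟨i, hi, h⟩ := card_isotropic_of_maximal hQ hm hT U hU.prop (by
      intro v hv hv0
      have hmem : U ⊔ Submodule.span (ZMod 3) {v} ∈
          {U : Submodule (ZMod 3) V | ∀ u ∈ U, Q u = 0} := by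
        intro w hw
        obtain ⟨u, hu, z, hz, rfl⟩ := Submodule.mem_sup.1 hw
        obtain ⟨b, rfl⟩ := Submodule.mem_span_singleton.1 hz
        rw [map_add', hU.prop u hu, QuadraticMap.map_smul, hv0, QuadraticMap.polar_smul_right,
          hv u hu]
        simp
      exact hU.le_of_ge hmem le_sup_left
        (Submodule.mem_sup_right (Submodule.mem_span_singleton_self v)))
    rw [hT3, ← hi] at h
    rcases Nat.eq_zero_or_pos i with rfl | hpos
    · lia
    · exfalso
      set j := Module.finrank (ZMod 3) U
      have h3 : (3 : ℤ) ^ (j + 1) ≤ 3 ^ (j + i) := pow_le_pow_right₀ (by norm_num) (by lia)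
      have h4 : (0 : ℤ) < 3 ^ (j + 2 * i) := by positivity
      have h5 : (0 : ℤ) < 3 ^ (j + i) := by positivity
      linarith

lemma HasCount.even_cases {m : ℕ} (hm : Module.finrank (ZMod 3) V = 2 * m) {T : ℤ}
    (hT : HasCount Q T) : ∃ ξ : ℤˣ, T = ξ * 3 ^ m := by
  have h := hT.sq_eq
  rw [hm, ZMod.card, show (2 * m + 1) / 2 = m by lia, mul_comm, pow_mul] at h
  push_cast at h
  rcases sq_eq_sq_iff_eq_or_eq_neg.1 h with h | h
  · exact ⟨1, by simp [h]⟩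
  · exact ⟨-1, by simp [h]⟩

lemma sgn_eq [Finite V] (W : Submodule (ZMod 3) V) (hW : Nondeg (restr Q W)) {m : ℕ}
    (hm : Module.finrank (ZMod 3) W = 2 * m) {ξ : ℤˣ} (hT : HasCount (restr Q W) (ξ * 3 ^ m)) :
    sgn Q W = ξ := by
  have hiff := exists_totallySingular_iff hW hm hT
  have h2 : (∃ U : Submodule (ZMod 3) V, U ≤ W ∧ (∀ u ∈ U, Q u = 0) ∧
      2 * Module.finrank (ZMod 3) U = Module.finrank (ZMod 3) W) ↔
      ∃ U : Submodule (ZMod 3) W, (∀ u ∈ U, restr Q W u = 0) ∧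
        2 * Module.finrank (ZMod 3) U = Module.finrank (ZMod 3) W := by
    constructor
    · rintro ⟨U, hUW, hU, hd⟩
      refine ⟨U.comap W.subtype, fun u hu => hU u hu, ?_⟩
      rw [(Submodule.comapSubtypeEquivOfLe hUW).finrank_eq, hd]
    · rintro ⟨U, hU, hd⟩
      refine ⟨U.map W.subtype, Submodule.map_subtype_le W U, ?_, ?_⟩
      · rintro _ ⟨u, hu, rfl⟩
        exact hU u hu
      · rw [Submodule.finrank_map_subtype_eq, hd]
  rw [sgn]
  rcases Int.units_eq_one_or ξ with rfl | rfl
  · rw [if_pos (h2.2 (hiff.2 (by simp)))]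
  · rw [if_neg]
    intro h
    have h3 := hiff.1 (h2.1 h)
    have : (0 : ℤ) < 3 ^ m := by positivity
    simp only [Units.val_neg, Units.val_one] at h3
    linarith

end Sign

/-! ### Nonsingular points and Higman's parameters -/

section Points

variable {V : Type*} [AddCommGroup V] [Module (ZMod 3) V] {Q : QuadraticForm (ZMod 3) V}

lemma zmod_three_cases (a : ZMod 3) : a = 0 ∨ a = 1 ∨ a = -1 := by
  revert a; decide

lemma mk_eq_mk_iff_neg {v w : V} (hv : v ≠ 0) (hw : w ≠ 0) :
    Projectivization.mk (ZMod 3) v hv = Projectivization.mk (ZMod 3) w hw ↔ v = w ∨ v = -w := by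
  rw [Projectivization.mk_eq_mk_iff']
  constructor
  · rintro ⟨a, rfl⟩
    rcases zmod_three_cases a with rfl | rfl | rfl
    · simp at hv
    · simp
    · simp
  · rintro (rfl | rfl)
    · exact ⟨1, one_smul _ _⟩
    · exact ⟨-1, by simp⟩

lemma rep_mk (v : V) (hv : v ≠ 0) : (Projectivization.mk (ZMod 3) v hv).rep = v ∨
    (Projectivization.mk (ZMod 3) v hv).rep = -v := by
  rw [← mk_eq_mk_iff_neg (Projectivization.rep_nonzero _) hv, Projectivization.mk_rep]

lemma ne_neg_self {v : V} (hv : v ≠ 0) : v ≠ -v := by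
  intro h
  apply hv
  have h2 : (2 : ZMod 3) • v = 0 := by
    rw [two_smul]; nth_rewrite 1 [h]; simp
  exact (smul_eq_zero.1 h2).resolve_left two_ne_zero_zmod

/-- Every even set of nonzero vectors has twice as many elements as the corresponding set of
points. -/
lemma two_mul_ncard_points [Finite V] {p : V → Prop} (hneg : ∀ v, p (-v) ↔ p v)
    (h0 : ¬ p 0) : 2 * {x : ℙ (ZMod 3) V | p x.rep}.ncard = Nat.card {v : V // p v} := by
  classical
  have := Fintype.ofFinite V
  have hfin : Finite (ℙ (ZMod 3) V) := Quotient.finite _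
  have := Fintype.ofFinite (ℙ (ZMod 3) V)
  have hne : ∀ v : {v : V // p v}, v.1 ≠ 0 := fun v h => h0 (h ▸ v.2)
  let f : {v : V // p v} → {x : ℙ (ZMod 3) V // p x.rep} := fun v =>
    ⟨Projectivization.mk (ZMod 3) v.1 (hne v), by
      rcases rep_mk v.1 (hne v) with h | h
      · rw [h]; exact v.2
      · rw [h, hneg]; exact v.2⟩
  have hfib : ∀ x, Nat.card {v // f v = x} = 2 := by
    rintro ⟨x, hx⟩
    rw [Nat.card_eq_two_iff]
    have hf : ∀ v, f v = ⟨x, hx⟩ ↔ v.1 = x.rep ∨ v.1 = -x.rep := by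
      intro v
      rw [← mk_eq_mk_iff_neg (hne v) x.rep_nonzero, Projectivization.mk_rep, Subtype.ext_iff]
    refine ⟨⟨⟨x.rep, hx⟩, (hf _).2 (Or.inl rfl)⟩, ⟨⟨-x.rep, (hneg _).2 hx⟩, (hf _).2 (Or.inr rfl)⟩,
      ?_, ?_⟩
    · intro h
      exact ne_neg_self x.rep_nonzero (congrArg (fun y => y.1.1) h)
    · ext ⟨v, hv⟩
      simp only [Set.mem_insert_iff, Set.mem_singleton_iff, Set.mem_univ, iff_true]
      rcases (hf v).1 hv with h | h
      · left; exact Subtype.ext (Subtype.ext h)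
      · right; exact Subtype.ext (Subtype.ext h)
  rw [← Nat.card_congr (Equiv.sigmaFiberEquiv f), Nat.card_sigma]
  simp only [hfib, Finset.sum_const, Finset.card_univ, smul_eq_mul]
  rw [mul_comm, ← Nat.card_coe_set_eq, Nat.card_eq_fintype_card]
  rfl

lemma perp_eq_vperp (x : ℙ (ZMod 3) V) : perp Q x = vperp Q x.rep := by
  ext v
  rw [perp, Projectivization.submodule_eq, LinearMap.BilinForm.mem_orthogonal_iff, mem_vperp]
  constructor
  · intro h
    exact h _ (Submodule.mem_span_singleton_self _)
  · intro h n hn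
    obtain ⟨b, rfl⟩ := Submodule.mem_span_singleton.1 hn
    change QuadraticMap.polar Q _ _ = 0
    rw [QuadraticMap.polar_smul_left, h, smul_zero]

lemma submodule_le_perp_iff (x y : ℙ (ZMod 3) V) :
    y.submodule ≤ perp Q x ↔ QuadraticMap.polar Q x.rep y.rep = 0 := by
  rw [Projectivization.submodule_eq, Submodule.span_singleton_le_iff_mem, perp_eq_vperp, mem_vperp]

lemma quadraticChar_zmod_three_injective {a b : ZMod 3}
    (h : quadraticChar (ZMod 3) a = quadraticChar (ZMod 3) b) : a = b := by
  revert a b; decide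

/-- The norm `ε` of the points of type `ξ`. -/
lemma exists_norm [Finite V] (hQ : Nondeg Q) {m : ℕ}
    (hm : Module.finrank (ZMod 3) V = 2 * m + 1) (ξ : ℤˣ) :
    ∃ ε : ZMod 3, ε ≠ 0 ∧ HasCount Q (ξ * quadraticChar (ZMod 3) ε * 3 ^ (m + 1)) ∧
      (∀ x, x ∈ nonsingPoints Q ξ ↔ Q x.rep = ε) ∧
      ∀ v, Q v = ε → HasCount (restr Q (vperp Q v)) (ξ * 3 ^ m) := by
  obtain ⟨T, hT⟩ := exists_hasCount ringChar_zmod_three hQ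
  -- The sign of T is absorbed into ε, since χ takes both values ±1 on the units of F_3.
  obtain ⟨ε, hε, hTε⟩ : ∃ ε : ZMod 3, ε ≠ 0 ∧ T = ξ * quadraticChar (ZMod 3) ε * 3 ^ (m + 1) := by
    have h := hT.sq_eq
    rw [hm, ZMod.card, show (2 * m + 1 + 1) / 2 = m + 1 by lia, mul_comm, pow_mul] at h
    push_cast at h
    have h1 : quadraticChar (ZMod 3) 1 = 1 := by decide
    have h2 : quadraticChar (ZMod 3) (-1) = -1 := by decide
    rcases sq_eq_sq_iff_eq_or_eq_neg.1 h with h | h <;> rcases Int.units_eq_one_or ξ with rfl | rfl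
    · exact ⟨1, by decide, by simp [h]⟩
    · exact ⟨-1, by decide, by simp [h2, h]⟩
    · exact ⟨-1, by decide, by simp [h2, h]⟩
    · exact ⟨1, by decide, by simp [h]⟩
  -- If v^⊥ has sign η, the constant of V equals 3 χ(Q v) η 3^m. Hence η χ(Q v) is the same for all
  -- nonsingular v, so sign and norm determine each other.
  have key : ∀ v, Q v ≠ 0 → ∃ η : ℤˣ, HasCount (restr Q (vperp Q v)) (η * 3 ^ m) ∧
      (η : ℤ) * quadraticChar (ZMod 3) (Q v) = ξ * quadraticChar (ZMod 3) ε ∧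
      sgn Q (vperp Q v) = η := by
    intro v hv
    have hnd := hQ.vperp two_ne_zero_zmod hv
    have hfr := finrank_vperp two_ne_zero_zmod hv
    have hfr' : Module.finrank (ZMod 3) (vperp Q v) = 2 * m := by lia
    obtain ⟨T', hT'⟩ := exists_hasCount ringChar_zmod_three hnd
    obtain ⟨η, rfl⟩ := hT'.even_cases hfr'
    have huniq := hT.unique (hT'.of_even ringChar_zmod_three hv (by rw [hfr']; exact even_two_mul m))
    refine ⟨η, hT', ?_, sgn_eq _ hnd hfr' hT'⟩
    rw [hTε, ZMod.card, pow_succ] at huniq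
    have h3 : (3 : ℤ) ^ m * 3 ≠ 0 := by positivity
    apply mul_right_cancel₀ h3
    rw [huniq]
    push_cast
    ring
  refine ⟨ε, hε, hTε ▸ hT, fun x => ?_, fun v hv => ?_⟩
  · rw [nonsingPoints, Set.mem_ofPred_eq, perp_eq_vperp]
    constructor
    · rintro ⟨h0, hs⟩
      obtain ⟨η, -, h2, h3⟩ := key _ h0
      rw [hs] at h3
      subst h3
      have h4 := mul_left_cancel₀ (Units.ne_zero ξ) h2
      exact quadraticChar_zmod_three_injective h4
    · intro h
      have h0 : Q x.rep ≠ 0 := by rwa [h]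
      obtain ⟨η, -, h2, h3⟩ := key _ h0
      refine ⟨h0, ?_⟩
      rw [h3]
      rw [h] at h2
      exact Units.ext (mul_right_cancel₀ (by rw [Ne, quadraticChar_eq_zero_iff]; exact hε) h2)
  · obtain ⟨η, h1, h2, h3⟩ := key v (by rwa [hv])
    rw [hv] at h2
    have := mul_right_cancel₀ (by rw [Ne, quadraticChar_eq_zero_iff]; exact hε) h2
    rwa [this] at h1

/-- The numerical content of `HasCount` for the hyperplanes `v^⊥` and `v^⊥ ∩ w^⊥`. -/
lemma card_perp_norm {m : ℕ} {ξ : ℤˣ} {ε : ZMod 3} (hε : ε ≠ 0) {v : V}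
    (hv : HasCount (restr Q (vperp Q v)) (ξ * 3 ^ m))
    (hfr : Module.finrank (ZMod 3) (vperp Q v) = 2 * m) :
    (3 : ℤ) * Nat.card {w : V // QuadraticMap.polar Q v w = 0 ∧ Q w = ε} =
      3 ^ (2 * m) - ξ * 3 ^ m := by
  have e : Nat.card {w : V // QuadraticMap.polar Q v w = 0 ∧ Q w = ε} =
      cnt (restr Q (vperp Q v)) ε :=
    Nat.card_congr (Equiv.subtypeSubtypeEquivSubtypeInter
      (fun w => w ∈ vperp Q v) (fun w => Q w = ε)).symm
  have h := hv.card_mul ε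
  rw [hfr] at h
  simp only [devKernel, even_two_mul, if_true, ZMod.card, if_neg hε] at h
  rw [e]
  push_cast at h
  rw [h]; ring

/-- Splitting w off v^⊥ relates the constant of {v, w}^⊥ to ξ3^m by the factor χ(-ε), and -1 is a
nonsquare in F_3. -/
lemma card_perp_perp_of_orthogonal [Finite V] (hQ : Nondeg Q) {m : ℕ} (hm0 : 0 < m)
    {ξ : ℤˣ} {ε : ZMod 3} (hε : ε ≠ 0) {v w : V}
    (hv : HasCount (restr Q (vperp Q v)) (ξ * 3 ^ m))
    (hfr : Module.finrank (ZMod 3) (vperp Q v) = 2 * m) (hQv : Q v ≠ 0) (hw : Q w = ε)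
    (hvw : QuadraticMap.polar Q v w = 0) :
    (3 : ℤ) * Nat.card {z : V // QuadraticMap.polar Q v z = 0 ∧ QuadraticMap.polar Q w z = 0 ∧
      Q z = ε} = 3 ^ (2 * m - 1) - ξ * 3 ^ m := by
  set W := vperp Q v with hW
  let w' : W := ⟨w, hvw⟩
  have hw' : restr Q W w' ≠ 0 := by
    change Q w ≠ 0
    rwa [hw]
  have e : Nat.card {z : V // QuadraticMap.polar Q v z = 0 ∧ QuadraticMap.polar Q w z = 0 ∧
      Q z = ε} = cnt (restr (restr Q W) (vperp (restr Q W) w')) ε := by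
    rw [cnt]
    refine (Nat.card_congr ?_).symm
    refine (Equiv.subtypeSubtypeEquivSubtypeInter
      (fun z : W => z ∈ vperp (restr Q W) w') (fun z => Q z = ε)).trans ?_
    exact Equiv.subtypeSubtypeEquivSubtypeInter (fun z : V => z ∈ W)
      (fun z => QuadraticMap.polar Q w z = 0 ∧ Q z = ε)
  obtain ⟨T, hT⟩ := exists_hasCount ringChar_zmod_three
    ((hQ.vperp two_ne_zero_zmod hQv).vperp two_ne_zero_zmod hw')
  have hfr2 := finrank_vperp two_ne_zero_zmod hw'
  rw [hfr] at hfr2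
  have hodd : Odd (Module.finrank (ZMod 3) (vperp (restr Q W) w')) := ⟨m - 1, by lia⟩
  have hu := hv.unique (hT.of_odd ringChar_zmod_three hw' hodd)
  have h := hT.card_mul ε
  rw [devKernel, if_neg (Nat.not_even_iff_odd.2 hodd), ZMod.card] at h
  rw [show Module.finrank (ZMod 3) (vperp (restr Q W) w') = 2 * m - 1 by lia] at h
  rw [e]
  push_cast at h
  rw [h, hu]
  change _ = _ - quadraticChar (ZMod 3) (-Q w) * T
  rw [hw]
  have : quadraticChar (ZMod 3) (-ε) = - quadraticChar (ZMod 3) ε := by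
    clear hw h hv hu e hw'; revert ε; decide
  rw [this]; ring

/-- As 3 = 0, the vector w - v is singular and orthogonal to v. So {v, w}^⊥ is the perp of a
singular line inside v^⊥, and `card_isotropic` applies. The outcome agrees with the orthogonal case,
which is the reason for λ = μ. -/
lemma card_perp_perp_of_not_orthogonal [Finite V] (hQ : Nondeg Q) {m : ℕ} (hm0 : 0 < m)
    {ξ : ℤˣ} {ε : ZMod 3} (hε : ε ≠ 0) {v w : V}
    (hv : HasCount (restr Q (vperp Q v)) (ξ * 3 ^ m))
    (hfr : Module.finrank (ZMod 3) (vperp Q v) = 2 * m) (hQv : Q v = ε) (hw : Q w = ε)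
    (hvw : QuadraticMap.polar Q v w = -ε) (hne : v ≠ w) :
    (3 : ℤ) * Nat.card {z : V // QuadraticMap.polar Q v z = 0 ∧ QuadraticMap.polar Q w z = 0 ∧
      Q z = ε} = 3 ^ (2 * m - 1) - ξ * 3 ^ m := by
  set W := vperp Q v with hW
  have h3 : (3 : ZMod 3) = 0 := by decide
  have hpu : QuadraticMap.polar Q v (w - v) = 0 := by
    rw [QuadraticMap.polar_sub_right, hvw, polar_self', hQv]
    linear_combination (-ε) * h3
  let u : W := ⟨w - v, hpu⟩
  have hu0 : u ≠ 0 := fun h => hne (sub_eq_zero.1 (congrArg Subtype.val h)).symm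
  have hQu : restr Q W u = 0 := by
    have : Q (v + (w - v)) = Q v + Q (w - v) + QuadraticMap.polar Q v (w - v) := map_add' _ _
    rw [hpu, add_sub_cancel, hw, hQv] at this
    change Q (w - v) = 0
    linear_combination -this
  have hnd := hQ.vperp two_ne_zero_zmod (by rwa [hQv] : Q v ≠ 0)
  have hmem : ∀ z : W, (∀ y ∈ Submodule.span (ZMod 3) {u}, QuadraticMap.polar (restr Q W) y z = 0)
      ↔ QuadraticMap.polar (restr Q W) u z = 0 := by
    intro z
    refine ⟨fun h => h u (Submodule.mem_span_singleton_self u), fun h y hy => ?_⟩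
    obtain ⟨b, rfl⟩ := Submodule.mem_span_singleton.1 hy
    rw [QuadraticMap.polar_smul_left, h, smul_zero]
  have hiso := card_isotropic (restr Q W) (Submodule.span (ZMod 3) {u}) (fun y hy => by
    obtain ⟨b, rfl⟩ := Submodule.mem_span_singleton.1 hy
    rw [QuadraticMap.map_smul, hQu, smul_zero]) ε
  simp only [hmem] at hiso
  have hf : (restr Q W).polarBilin u ≠ 0 := fun h => hu0 (hnd u fun y => LinearMap.congr_fun h y)
  have c1 : 3 * Nat.card {z : W // QuadraticMap.polar (restr Q W) u z = 0} = Nat.card W := by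
    have := card_fibre_mul hf 0
    rwa [Nat.card_zmod] at this
  have c2 : Nat.card W = 3 ^ (2 * m) := by
    rw [Module.natCard_eq_pow_finrank (K := ZMod 3), Nat.card_zmod, hfr]
  have c3 : Nat.card {z : W // QuadraticMap.polar (restr Q W) u z = 0 ∧ restr Q W z = ε} =
      Nat.card {z : V // QuadraticMap.polar Q v z = 0 ∧ QuadraticMap.polar Q w z = 0 ∧
      Q z = ε} := by
    refine Nat.card_congr ((Equiv.subtypeSubtypeEquivSubtypeInter (fun z : V => z ∈ W)
      (fun z => QuadraticMap.polar Q (w - v) z = 0 ∧ Q z = ε)).trans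
        (Equiv.subtypeEquivRight fun z => ?_))
    rw [hW, mem_vperp, QuadraticMap.polar_sub_left]
    constructor
    · rintro ⟨h1, h2, h4⟩
      exact ⟨h1, by rwa [h1, sub_zero] at h2, h4⟩
    · rintro ⟨h1, h2, h4⟩
      exact ⟨h1, by rw [h1, h2, sub_zero], h4⟩
  have h := hv.card_mul ε
  rw [hfr] at h
  simp only [devKernel, even_two_mul, if_true, ZMod.card, if_neg hε] at h
  rw [c3, Nat.card_zmod, c2] at hiso
  rw [c2] at c1
  clear h3
  obtain ⟨n, rfl⟩ : ∃ n, m = n + 1 := ⟨m - 1, by lia⟩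
  rw [show 2 * (n + 1) - 1 = 2 * n + 1 by lia]
  zify at hiso c1
  push_cast at h
  simp only [show 2 * (n + 1) = 2 * n + 2 by ring, pow_succ] at h hiso c1 ⊢
  linarith

/-- Over F_3 the polar value is 0 or ±ε, and replacing w by -w exchanges the last two cases. -/
lemma card_perp_perp [Finite V] (hQ : Nondeg Q) {m : ℕ} (hm0 : 0 < m)
    {ξ : ℤˣ} {ε : ZMod 3} (hε : ε ≠ 0) {v w : V}
    (hv : HasCount (restr Q (vperp Q v)) (ξ * 3 ^ m))
    (hfr : Module.finrank (ZMod 3) (vperp Q v) = 2 * m) (hQv : Q v = ε) (hw : Q w = ε)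
    (hne : v ≠ w) (hne' : v ≠ -w) :
    (3 : ℤ) * Nat.card {z : V // QuadraticMap.polar Q v z = 0 ∧ QuadraticMap.polar Q w z = 0 ∧
      Q z = ε} = 3 ^ (2 * m - 1) - ξ * 3 ^ m := by
  have h3 : QuadraticMap.polar Q v w = 0 ∨ QuadraticMap.polar Q v w = -ε ∨
      QuadraticMap.polar Q v w = ε := by
    generalize QuadraticMap.polar Q v w = a
    clear hw hQv; revert a ε; decide
  rcases h3 with h | h | h
  · exact card_perp_perp_of_orthogonal hQ hm0 hε hv hfr (by rwa [hQv]) hw h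
  · exact card_perp_perp_of_not_orthogonal hQ hm0 hε hv hfr hQv hw h hne
  · have := card_perp_perp_of_not_orthogonal hQ hm0 hε hv hfr hQv
      (by rw [QuadraticMap.map_neg, hw]) (by rw [QuadraticMap.polar_neg_right, h]) hne'
    simpa only [QuadraticMap.polar_neg_left, neg_eq_zero] using this

/-- `Higman's parameters` for the points of type `ξ`, in terms of the dimension `2 n + 3`. -/
theorem exists_isHigmanParams [Finite V] (hQ : Nondeg Q) {n : ℕ}
    (hm : Module.finrank (ZMod 3) V = 2 * (n + 1) + 1) {ξ : ℤˣ} {ε : ZMod 3} (hε : ε ≠ 0)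
    (hT : HasCount Q (ξ * quadraticChar (ZMod 3) ε * 3 ^ (n + 2)))
    (hE : ∀ x, x ∈ nonsingPoints Q ξ ↔ Q x.rep = ε)
    (hperp : ∀ v, Q v = ε → HasCount (restr Q (vperp Q v)) (ξ * 3 ^ (n + 1))) :
    ∃ k l mu : ℕ, IsHigmanParams (nonsingPoints Q ξ) (Delta Q ξ) (Gamma Q ξ) k l mu mu ∧
      2 * (k : ℤ) = 3 ^ n * (3 ^ (n + 1) - ξ) ∧ (l : ℤ) = (3 ^ (n + 1) - ξ) * (3 ^ n + ξ) ∧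
      2 * (mu : ℤ) = 3 ^ n * (3 ^ n - ξ) := by
  have hfin : Finite (ℙ (ZMod 3) V) := Quotient.finite _
  have hfr : ∀ v, Q v = ε → Module.finrank (ZMod 3) (vperp Q v) = 2 * (n + 1) := by
    intro v hv
    have := finrank_vperp (Q := Q) two_ne_zero_zmod (x := v) (by rwa [hv])
    lia
  have hξ1 : (ξ : ℤ) = 1 ∨ (ξ : ℤ) = -1 := by
    rcases Int.units_eq_one_or ξ with rfl | rfl <;> simp
  have hξ : Odd (ξ : ℤ) := by rcases hξ1 with h | h <;> rw [h] <;> decide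
  have hodd : ∀ j, Odd ((3 : ℤ) ^ j) := fun j => Odd.pow (by decide)
  have hpos : ∀ j, 1 ≤ (3 : ℤ) ^ j := fun j => one_le_pow₀ (by norm_num)
  have hexists : ∀ j, ∃ k : ℕ, 2 * (k : ℤ) = 3 ^ n * (3 ^ j - ξ) := by
    intro j
    obtain ⟨a, ha⟩ := ((hodd j).sub_odd hξ)
    have : 0 ≤ a := by have := hpos j; rcases hξ1 with h | h <;> lia
    refine ⟨(3 ^ n * a).toNat, ?_⟩
    rw [Int.toNat_of_nonneg (by positivity), ha]; ring
  obtain ⟨k, hk⟩ := hexists (n + 1)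
  obtain ⟨mu, hmu⟩ := hexists n
  obtain ⟨l, hl⟩ : ∃ l : ℕ, (l : ℤ) = (3 ^ (n + 1) - ξ) * (3 ^ n + ξ) :=
    ⟨(((3 : ℤ) ^ (n + 1) - ξ) * (3 ^ n + ξ)).toNat, Int.toNat_of_nonneg (mul_nonneg
      (by have := hpos (n + 1); rcases hξ1 with h | h <;> lia)
      (by have := hpos n; rcases hξ1 with h | h <;> lia))⟩
  have hD : ∀ x, Delta Q ξ x =
      {y : ℙ (ZMod 3) V | QuadraticMap.polar Q x.rep y.rep = 0 ∧ Q y.rep = ε} := by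
    intro x
    ext y
    simp only [Delta, Set.mem_ofPred_eq, hE, submodule_le_perp_iff, and_comm]
  have hcD : ∀ x ∈ nonsingPoints Q ξ, (Delta Q ξ x).ncard = k := by
    intro x hx
    rw [hE] at hx
    have h1 := card_perp_norm hε (hperp _ hx) (hfr _ hx)
    rw [hD]
    have h2 := two_mul_ncard_points
      (p := fun w => QuadraticMap.polar Q x.rep w = 0 ∧ Q w = ε) (fun v => by
        rw [QuadraticMap.polar_neg_right, neg_eq_zero, QuadraticMap.map_neg]) (fun h => by
        rw [QuadraticMap.map_zero] at h; exact hε h.2.symm)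
    rw [← h2] at h1
    push_cast at h1
    zify
    have h3 : 2 * (n + 1) = (n + 1) + (n + 1) := by ring
    rw [h3, pow_add] at h1
    simp only [pow_succ] at h1 hk
    linarith
  have hcI : ∀ x ∈ nonsingPoints Q ξ, ∀ y ∈ nonsingPoints Q ξ, x ≠ y →
      (Delta Q ξ x ∩ Delta Q ξ y).ncard = mu := by
    intro x hx y hy hxy
    rw [hE] at hx hy
    have hne : ¬ (x.rep = y.rep ∨ x.rep = -y.rep) := by
      rw [← mk_eq_mk_iff_neg x.rep_nonzero y.rep_nonzero, Projectivization.mk_rep,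
        Projectivization.mk_rep]
      exact hxy
    rw [not_or] at hne
    have h1 := card_perp_perp hQ (Nat.succ_pos n) hε (hperp _ hx) (hfr _ hx) hx hy hne.1 hne.2
    have h2 := two_mul_ncard_points
      (p := fun w => QuadraticMap.polar Q x.rep w = 0 ∧ QuadraticMap.polar Q y.rep w = 0 ∧ Q w = ε)
      (fun v => by
        simp only [QuadraticMap.polar_neg_right, neg_eq_zero, QuadraticMap.map_neg]) (fun h => by
        rw [QuadraticMap.map_zero] at h; exact hε h.2.2.symm)
    have h4 : Delta Q ξ x ∩ Delta Q ξ y = {z : ℙ (ZMod 3) V | QuadraticMap.polar Q x.rep z.rep = 0 ∧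
        QuadraticMap.polar Q y.rep z.rep = 0 ∧ Q z.rep = ε} := by
      rw [hD, hD]
      ext z
      simp only [Set.mem_inter_iff, Set.mem_ofPred_eq]
      tauto
    rw [h4]
    rw [← h2, show 2 * (n + 1) - 1 = n + n + 1 by lia] at h1
    push_cast at h1
    zify
    simp only [pow_succ, pow_add] at h1
    linarith
  have hcE : 2 * ((nonsingPoints Q ξ).ncard : ℤ) = 3 ^ (n + 1) * (3 ^ (n + 1) + ξ) := by
    have h1 := hT.card_mul ε
    have h2 := two_mul_ncard_points (p := fun w => Q w = ε) (fun v => by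
        rw [QuadraticMap.map_neg]) (fun h => by
        rw [QuadraticMap.map_zero] at h; exact hε h.symm)
    have h4 : nonsingPoints Q ξ = {z : ℙ (ZMod 3) V | Q z.rep = ε} := by
      ext z; exact hE z
    rw [h4]
    rw [cnt, ← h2, hm] at h1
    have h5 : ¬ Even (2 * (n + 1) + 1) := by simp
    have h6 := quadraticChar_sq_one hε
    simp only [devKernel, h5, if_false, ZMod.card] at h1
    push_cast at h1
    rw [show (3 : ℤ) ^ (2 * (n + 1) + 1) = 3 ^ (n + 1) * 3 ^ (n + 1) * 3 by ring] at h1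
    simp only [pow_succ] at h1 ⊢
    -- This is χ(ε)² = 1 multiplied by the monomial in which it occurs, so that the rest is linear.
    have h7 := congrArg (fun t => (ξ : ℤ) * 3 ^ n * t) h6
    linarith
  have hself : ∀ x ∈ nonsingPoints Q ξ, x ∉ Delta Q ξ x := by
    intro x hx h
    rw [hD] at h
    rw [hE] at hx
    have h1 := h.1
    rw [polar_self', hx] at h1
    exact hε ((mul_eq_zero.1 h1).resolve_left two_ne_zero_zmod)
  have hpart : ∀ x ∈ nonsingPoints Q ξ, (nonsingPoints Q ξ).ncard =
      (Delta Q ξ x).ncard + (Gamma Q ξ x).ncard + 1 := by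
    intro x hx
    have h1 : nonsingPoints Q ξ = insert x (Delta Q ξ x ∪ Gamma Q ξ x) := by
      ext y
      simp only [Set.mem_insert_iff, Set.mem_union, Delta, Gamma, Set.mem_ofPred_eq]
      constructor
      · intro hy; tauto
      · rintro (rfl | h | h)
        · exact hx
        · exact h.1
        · exact h.1
    rw [h1, Set.ncard_insert_of_notMem, Set.ncard_union_eq]
    · rw [Set.disjoint_left]
      rintro y hy hy'
      exact hy'.2.2 hy.2
    · rintro (h | h)
      · exact hself x hx h
      · exact h.2.1 rfl
  refine ⟨k, l, mu, ⟨hcD, fun x hx => ?_, fun x hx y hy => hcI x hx y hy.1 ?_,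
    fun x hx y hy => hcI x hx y hy.1 hy.2.1.symm⟩, hk, hl, hmu⟩
  · have h1 := hpart x hx
    rw [hcD x hx] at h1
    zify at h1 ⊢
    rw [hl]
    rw [h1] at hcE
    have : (ξ : ℤ) * ξ = 1 := by rcases hξ1 with h | h <;> rw [h] <;> norm_num
    simp only [pow_succ] at hcE hk ⊢
    linarith
  · rintro rfl
    exact hself x hx hy

end Points

/-! ### Reflections, Ω(V) and its transitivity -/

section Reflections

open scoped commutatorElement

variable {F V : Type*} [Field F] [AddCommGroup V] [Module F V] {Q : QuadraticForm F V}

/-- The orthogonal reflection in a nonsingular vector. -/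
def orthRefl (Q : QuadraticForm F V) {v : V} (hv : Q v ≠ 0) : V ≃ₗ[F] V :=
  Module.reflection (x := v) (f := (Q v)⁻¹ • Q.polarBilin v) (by
    change (Q v)⁻¹ * QuadraticMap.polar Q v v = 2
    rw [polar_self']
    field_simp)

lemma orthRefl_apply {v : V} (hv : Q v ≠ 0) (w : V) :
    orthRefl Q hv w = w - ((Q v)⁻¹ * QuadraticMap.polar Q v w) • v := rfl

lemma orthRefl_mem {v : V} (hv : Q v ≠ 0) : orthRefl Q hv ∈ isometryGroup Q := by
  intro w
  rw [orthRefl_apply, sub_eq_add_neg, map_add', QuadraticMap.map_neg, QuadraticMap.map_smul,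
    QuadraticMap.polar_neg_right, QuadraticMap.polar_smul_right, QuadraticMap.polar_comm Q w v]
  simp only [smul_eq_mul]
  field_simp
  ring

lemma orthRefl_mul_self {v : V} (hv : Q v ≠ 0) : orthRefl Q hv * orthRefl Q hv = 1 :=
  LinearEquiv.ext fun w => Module.involutive_reflection _ w

lemma orthRefl_of_polar_eq_zero {v : V} (hv : Q v ≠ 0) {w : V}
    (h : QuadraticMap.polar Q v w = 0) : orthRefl Q hv w = w := by
  rw [orthRefl_apply, h, mul_zero, zero_smul, sub_zero]

lemma orthRefl_self {v : V} (hv : Q v ≠ 0) : orthRefl Q hv v = -v := by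
  rw [orthRefl_apply, polar_self', mul_comm 2, inv_mul_cancel_left₀ hv, two_smul]
  abel

lemma polar_map {g : V ≃ₗ[F] V} (hg : g ∈ isometryGroup Q) (v w : V) :
    QuadraticMap.polar Q (g v) (g w) = QuadraticMap.polar Q v w := by
  rw [QuadraticMap.polar, ← map_add, hg, hg, hg, QuadraticMap.polar]

lemma orthRefl_conj {g : V ≃ₗ[F] V} (hg : g ∈ isometryGroup Q) {v w : V} (hv : Q v ≠ 0)
    (hw : Q w ≠ 0) (h : g v = w ∨ g v = -w) : g * orthRefl Q hv = orthRefl Q hw * g := by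
  ext u
  change g (orthRefl Q hv u) = orthRefl Q hw (g u)
  rw [orthRefl_apply, orthRefl_apply, map_sub, map_smul, ← polar_map hg, ← hg v]
  rcases h with h | h
  · rw [h]
  · rw [h, QuadraticMap.map_neg, QuadraticMap.polar_neg_left]
    module

/-- Two vectors of the same nonzero norm are exchanged, up to sign, by the reflection in their
sum or difference. -/
lemma exists_orthRefl (h2 : (2 : F) ≠ 0) {x y : V} (hxy : Q x = Q y) (hx : Q x ≠ 0) :
    ∃ v, ∃ hv : Q v ≠ 0, (v = x - y ∨ v = x + y) ∧
      (orthRefl Q hv x = y ∨ orthRefl Q hv x = -y) := by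
  have h1 : Q (x - y) = 2 * Q x - QuadraticMap.polar Q x y := by
    rw [sub_eq_add_neg, map_add', QuadraticMap.map_neg, QuadraticMap.polar_neg_right, hxy]; ring
  have h1' : Q (x + y) = 2 * Q x + QuadraticMap.polar Q x y := by
    rw [map_add', hxy]; ring
  by_cases h : Q (x - y) = 0
  · have hv : Q (x + y) ≠ 0 := by
      have : Q (x + y) = 2 * (2 * Q x) := by linear_combination h1' + h1 - h
      rw [this]
      exact mul_ne_zero h2 (mul_ne_zero h2 hx)
    refine ⟨x + y, hv, Or.inr rfl, Or.inr ?_⟩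
    rw [orthRefl_apply, QuadraticMap.polar_add_left, polar_self', QuadraticMap.polar_comm Q y x,
      ← h1', inv_mul_cancel₀ hv, one_smul]
    abel
  · refine ⟨x - y, h, Or.inl rfl, Or.inl ?_⟩
    rw [orthRefl_apply, QuadraticMap.polar_sub_left, polar_self', QuadraticMap.polar_comm Q y x,
      ← h1, inv_mul_cancel₀ h, one_smul]
    abel

/-- A reflection r_u carries v to ±w, so r_w is the conjugate of r_v by r_u and the product is the
commutator of r_v and r_u. -/
lemma orthRefl_mul_mem_Omega (h2 : (2 : F) ≠ 0) {v w : V} (hv : Q v ≠ 0) (hw : Q w ≠ 0)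
    (hvw : Q v = Q w) : orthRefl Q hv * orthRefl Q hw ∈ Omega Q := by
  obtain ⟨u, hu, -, h⟩ := exists_orthRefl h2 hvw hv
  have hc := orthRefl_conj (orthRefl_mem hu) hv hw h
  have hinv : (orthRefl Q hv)⁻¹ = orthRefl Q hv := inv_eq_of_mul_eq_one_left (orthRefl_mul_self hv)
  have : orthRefl Q hv * orthRefl Q hw = ⁅orthRefl Q hv, orthRefl Q hu⁆ := by
    rw [commutatorElement_def, hinv, mul_assoc (orthRefl Q hv), hc]
    group
  rw [this]
  exact Subgroup.commutator_mem_commutator (orthRefl_mem hv) (orthRefl_mem hu)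

/-- Modulo commutators squaring is multiplicative: (gh)² = g² [g⁻¹, h] h². -/
lemma mul_self_mul_mem_Omega {g h : V ≃ₗ[F] V} (hg : g ∈ isometryGroup Q)
    (hh : h ∈ isometryGroup Q) (hg2 : g * g ∈ Omega Q) (hh2 : h * h ∈ Omega Q) :
    (g * h) * (g * h) ∈ Omega Q := by
  have : (g * h) * (g * h) = (g * g) * ⁅g⁻¹, h⁆ * (h * h) := by
    rw [commutatorElement_def]; group
  rw [this]
  exact mul_mem (mul_mem hg2 (Subgroup.commutator_mem_commutator (inv_mem hg) hh)) hh2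

lemma orthRefl_mul_self_mem_Omega {v : V} (hv : Q v ≠ 0) :
    orthRefl Q hv * orthRefl Q hv ∈ Omega Q := by
  rw [orthRefl_mul_self]; exact one_mem _

/-- This is the Cartan–Dieudonné induction on the codimension of a fixed subspace U with V = U +
U^⊥. Reflections have trivial square, so multiplying g by them does not affect whether its square
lies in Ω; one or two of them enlarge the fixed space by a nonsingular vector. -/
lemma mul_self_mem_Omega_of_fixes [FiniteDimensional F V] (h2 : (2 : F) ≠ 0) (hQ : Nondeg Q)
    (j : ℕ) : ∀ U : Submodule F V, Module.finrank F V ≤ Module.finrank F U + j →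
      (∀ v, ∃ u ∈ U, ∀ u' ∈ U, QuadraticMap.polar Q u' (v - u) = 0) →
      ∀ g ∈ isometryGroup Q, (∀ u ∈ U, g u = u) → g * g ∈ Omega Q := by
  induction j with
  | zero =>
    intro U hU _ g _ hfix
    have hU' : U = ⊤ := Submodule.eq_top_of_finrank_eq
      (le_antisymm (Submodule.finrank_le U) (by simpa using hU))
    have : g = 1 := LinearEquiv.ext fun v => hfix v (hU' ▸ Submodule.mem_top)
    rw [this]
    exact one_mem _
  | succ j ih =>
    intro U hU hcompl g hg hfix
    by_cases hUtop : U = ⊤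
    · have : g = 1 := LinearEquiv.ext fun v => hfix v (hUtop ▸ Submodule.mem_top)
      rw [this]
      exact one_mem _
    -- If U^⊥ were totally singular, it would be orthogonal to itself and to U, hence zero, and U
    -- would be everything.
    obtain ⟨x, hxU, hx⟩ : ∃ x, (∀ u ∈ U, QuadraticMap.polar Q u x = 0) ∧ Q x ≠ 0 := by
      by_contra! hcon
      apply hUtop
      rw [eq_top_iff]
      intro v _
      obtain ⟨u, hu, hperp⟩ := hcompl v
      have hz : v - u = 0 := by
        refine hQ _ fun w => ?_
        obtain ⟨u', hu', hperp'⟩ := hcompl w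
        have e1 : QuadraticMap.polar Q (v - u) u' = 0 := by
          rw [QuadraticMap.polar_comm]; exact hperp u' hu'
        have e2 : QuadraticMap.polar Q (v - u) (w - u') = 0 := by
          rw [QuadraticMap.polar, hcon _ hperp, hcon _ hperp', hcon, sub_zero, sub_zero]
          intro y hy
          rw [QuadraticMap.polar_add_right, hperp y hy, hperp' y hy, add_zero]
        rw [QuadraticMap.polar_sub_right, e1, sub_zero] at e2
        exact e2
      rw [sub_eq_zero.1 hz]
      exact hu
    have hgx : ∀ u ∈ U, QuadraticMap.polar Q u (g x) = 0 := by
      intro u hu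
      have := polar_map hg u x
      rw [hfix u hu, hxU u hu] at this
      exact this
    have main : ∀ g' ∈ isometryGroup Q, (∀ u ∈ U, g' u = u) → g' x = x → g' * g' ∈ Omega Q := by
      intro g' hg' hfix' hx'
      refine ih (U ⊔ Submodule.span F {x}) ?_ ?_ g' hg' ?_
      · have hlt : U < U ⊔ Submodule.span F {x} := by
          refine lt_of_le_of_ne le_sup_left fun h => ?_
          have hxm : x ∈ U := by
            rw [h]; exact Submodule.mem_sup_right (Submodule.mem_span_singleton_self x)
          have := hxU x hxm
          rw [polar_self'] at this
          exact mul_ne_zero h2 hx this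
        have := Submodule.finrank_lt_finrank_of_lt hlt
        lia
      · intro v
        obtain ⟨u, hu, hperp⟩ := hcompl v
        set b := QuadraticMap.polar Q x (v - u) / (2 * Q x)
        refine ⟨u + b • x, Submodule.add_mem_sup hu (Submodule.smul_mem _ _
          (Submodule.mem_span_singleton_self x)), fun y hy => ?_⟩
        obtain ⟨u', hu', z, hz, rfl⟩ := Submodule.mem_sup.1 hy
        obtain ⟨c, rfl⟩ := Submodule.mem_span_singleton.1 hz
        rw [← sub_sub, QuadraticMap.polar_add_left, QuadraticMap.polar_sub_right, hperp u' hu',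
          QuadraticMap.polar_smul_right, hxU u' hu', QuadraticMap.polar_smul_left,
          QuadraticMap.polar_sub_right, QuadraticMap.polar_smul_right, polar_self']
        simp only [b, smul_eq_mul]
        field_simp
        ring
      · intro y hy
        obtain ⟨u', hu', z, hz, rfl⟩ := Submodule.mem_sup.1 hy
        obtain ⟨c, rfl⟩ := Submodule.mem_span_singleton.1 hz
        rw [map_add, map_smul, hfix' u' hu', hx']
    have reduce : ∀ g' ∈ isometryGroup Q, ∀ v, ∀ hv : Q v ≠ 0,
        (orthRefl Q hv * g') * (orthRefl Q hv * g') ∈ Omega Q → g' * g' ∈ Omega Q := by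
      intro g' hg' v hv h
      have := mul_self_mul_mem_Omega (orthRefl_mem hv) (mul_mem (orthRefl_mem hv) hg')
        (orthRefl_mul_self_mem_Omega hv) h
      rwa [← mul_assoc (orthRefl Q hv), orthRefl_mul_self, one_mul] at this
    obtain ⟨v, hv, hvx, hr⟩ := exists_orthRefl (Q := Q) h2 (x := g x) (y := x) (hg x)
      (by rwa [hg x])
    have hvU : ∀ u ∈ U, QuadraticMap.polar Q v u = 0 := by
      intro u hu
      rw [QuadraticMap.polar_comm]
      rcases hvx with rfl | rfl
      · rw [QuadraticMap.polar_sub_right, hgx u hu, hxU u hu, sub_zero]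
      · rw [QuadraticMap.polar_add_right, hgx u hu, hxU u hu, add_zero]
    apply reduce g hg v hv
    have hfix1 : ∀ u ∈ U, (orthRefl Q hv * g) u = u := fun u hu => by
      rw [LinearEquiv.mul_apply, hfix u hu, orthRefl_of_polar_eq_zero hv (hvU u hu)]
    have hmem1 := mul_mem (orthRefl_mem hv) hg
    rcases hr with hr | hr
    · exact main _ hmem1 hfix1 hr
    · apply reduce _ hmem1 x hx
      refine main _ (mul_mem (orthRefl_mem hx) hmem1) (fun u hu => ?_) ?_
      · rw [LinearEquiv.mul_apply, hfix1 u hu, orthRefl_of_polar_eq_zero hx]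
        rw [QuadraticMap.polar_comm]
        exact hxU u hu
      · rw [LinearEquiv.mul_apply, LinearEquiv.mul_apply, hr, map_neg, orthRefl_self, neg_neg]

/-- Squares of isometries lie in the commutator subgroup of the isometry group. -/
theorem mul_self_mem_Omega [FiniteDimensional F V] (h2 : (2 : F) ≠ 0) (hQ : Nondeg Q)
    {g : V ≃ₗ[F] V} (hg : g ∈ isometryGroup Q) : g * g ∈ Omega Q := by
  refine mul_self_mem_Omega_of_fixes h2 hQ (Module.finrank F V) ⊥ (by simp)
    (fun v => ⟨0, Submodule.zero_mem _, fun u' hu' => ?_⟩) g hg (fun u hu => ?_)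
  · rw [(Submodule.mem_bot F).1 hu', QuadraticMap.polar_zero_left]
  · rw [(Submodule.mem_bot F).1 hu, map_zero]

/-- A norm that is not represented forces q^d = ±T, so d = ⌈d/2⌉ by `sq_eq`, which fails for d ≥ 2.
-/
lemma HasCount.cnt_pos [Fintype F] [DecidableEq F] {T : ℤ} (h : HasCount Q T)
    (hd : 2 ≤ Module.finrank F V) {c : F} (hc : c ≠ 0) : 0 < cnt Q c := by
  rw [Nat.pos_iff_ne_zero]
  intro h0
  have h1 := h.card_mul c
  have hq : 1 < (Fintype.card F : ℤ) := by exact_mod_cast Fintype.one_lt_card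
  have hdev : devKernel F (Module.finrank F V) c ^ 2 = 1 := by
    rw [devKernel]
    split_ifs
    · norm_num
    · exact quadraticChar_sq_one hc
  rw [h0] at h1
  have h2 : ((Fintype.card F : ℤ) ^ Module.finrank F V) ^ 2 =
      (Fintype.card F : ℤ) ^ (2 * ((Module.finrank F V + 1) / 2)) := by
    rw [← h.sq_eq, ← mul_one (T ^ 2), ← hdev, ← mul_pow]
    push_cast at h1
    linear_combination (-(Fintype.card F : ℤ) ^ Module.finrank F V +
      T * devKernel F (Module.finrank F V) c) * h1
  rw [← pow_mul] at h2
  have := pow_right_injective₀ (by lia) (by lia) h2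
  lia

lemma exists_norm_eq [Fintype F] [Finite V] (hF : ringChar F ≠ 2) (hQ : Nondeg Q)
    (hd : 2 ≤ Module.finrank F V) {c : F} (hc : c ≠ 0) : ∃ v, Q v = c := by
  classical
  obtain ⟨T, hT⟩ := exists_hasCount hF hQ
  have := hT.cnt_pos hd hc
  rw [cnt, Nat.card_pos_iff] at this
  obtain ⟨⟨v, hv⟩⟩ := this.1
  exact ⟨v, hv⟩

/-- `Ω(V)` is transitive on the points of given nonzero norm. -/
theorem exists_mem_Omega [Fintype F] [Finite V] (hF : ringChar F ≠ 2) (hQ : Nondeg Q)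
    (hd : 3 ≤ Module.finrank F V) {x y : V} (hxy : Q x = Q y) (hx : Q x ≠ 0) :
    ∃ g ∈ Omega Q, g x = y ∨ g x = -y := by
  have h2 := Ring.two_ne_zero hF
  obtain ⟨v, hv, -, h⟩ := exists_orthRefl h2 hxy hx
  have hfr := finrank_vperp h2 hx
  -- The reflection in v alone need not lie in Ω. It is corrected by one that fixes x, in a vector
  -- of x^⊥ with the norm of v; this needs dim x^⊥ ≥ 2.
  obtain ⟨⟨w, hw⟩, hwv⟩ := exists_norm_eq hF (hQ.vperp h2 hx) (by lia) hv
  have hwv' : Q w = Q v := hwv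
  have hw0 : Q w ≠ 0 := by rwa [hwv']
  refine ⟨_, orthRefl_mul_mem_Omega h2 hv hw0 hwv'.symm, ?_⟩
  rw [LinearEquiv.mul_apply, orthRefl_of_polar_eq_zero hw0]
  · exact h
  · rw [QuadraticMap.polar_comm]; exact hw

end Reflections

/-! ### Trace forms and semilinear isometries -/

section FieldExtension

variable {K V : Type*} [Field K] [Algebra (ZMod 3) K]
  [AddCommGroup V] [Module (ZMod 3) V] [Module K V]

lemma charP_three (K : Type*) [Field K] [Algebra (ZMod 3) K] : CharP K 3 :=
  charP_of_injective_algebraMap (algebraMap (ZMod 3) K).injective 3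

lemma ringChar_ne_two_of_algebra (K : Type*) [Field K] [Algebra (ZMod 3) K] : ringChar K ≠ 2 := by
  have := charP_three K
  rw [ringChar.eq K 3]; norm_num

lemma three_eq_zero_of_algebra (K : Type*) [Field K] [Algebra (ZMod 3) K] : (3 : K) = 0 := by
  have := charP_three K
  exact_mod_cast CharP.cast_eq_zero K 3

lemma trace_ringEquiv (σ : K ≃+* K) (a : K) :
    Algebra.trace (ZMod 3) K (σ a) = Algebra.trace (ZMod 3) K a :=
  Algebra.trace_eq_of_algEquiv (AlgEquiv.ofRingEquiv (f := σ) fun r =>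
    RingHom.congr_fun (Subsingleton.elim ((σ : K →+* K).comp (algebraMap (ZMod 3) K))
      (algebraMap (ZMod 3) K)) r) a

lemma trace_cube [Finite K] (a : K) :
    Algebra.trace (ZMod 3) K (a ^ 3) = Algebra.trace (ZMod 3) K a := by
  have := charP_three K
  exact trace_ringEquiv (RingEquiv.ofBijective (frobenius K 3)
    (Finite.injective_iff_bijective.1 (frobenius K 3).injective)) a

section Trace

variable {Q : QuadraticForm (ZMod 3) V} {Qs : QuadraticForm K V}
  (hQs : ∀ v, Q v = Algebra.trace (ZMod 3) K (Qs v))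

include hQs

lemma polar_eq_trace (v w : V) :
    QuadraticMap.polar Q v w = Algebra.trace (ZMod 3) K (QuadraticMap.polar Qs v w) := by
  simp only [QuadraticMap.polar, hQs, map_sub]

lemma Nondeg.of_trace (hQ : Nondeg Q) : Nondeg Qs := by
  intro x hx
  refine hQ x fun y => ?_
  rw [polar_eq_trace hQs, hx, map_zero]

/-- Comparing Q on the vectors av for all a shows that the defect d is trace-orthogonal to every
square. In characteristic 3 every b equals (b + 1)² - (b - 1)², so d is orthogonal to all of K. -/
lemma norm_semilinear [Finite K] {g : V ≃ₗ[ZMod 3] V} (hg : g ∈ isometryGroup Q) {σ : K ≃+* K}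
    (hσ : ∀ (a : K) (v : V), g (a • v) = σ a • g v) (v : V) : Qs (g v) = σ (Qs v) := by
  set d := Qs v - σ.symm (Qs (g v)) with hd
  have hsq : ∀ a : K, Algebra.trace (ZMod 3) K (a * a * d) = 0 := by
    intro a
    have h1 := hg (a • v)
    rw [hσ, hQs, hQs, QuadraticMap.map_smul, QuadraticMap.map_smul, smul_eq_mul, smul_eq_mul,
      ← trace_ringEquiv σ.symm, map_mul σ.symm, map_mul σ.symm,
      RingEquiv.symm_apply_apply] at h1
    rw [hd, mul_sub, map_sub, h1, sub_self]
  have hall : ∀ b : K, Algebra.trace (ZMod 3) K (d * b) = 0 := by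
    intro b
    have h3 := three_eq_zero_of_algebra K
    have : d * b = (b + 1) * (b + 1) * d - (b - 1) * (b - 1) * d := by
      linear_combination (-(b * d)) * h3
    rw [this, map_sub, hsq, hsq, sub_zero]
  have hd0 : d = 0 := by
    have : FiniteDimensional (ZMod 3) K := Module.Finite.of_finite
    exact (traceForm_nondegenerate (ZMod 3) K).1 d fun b => by
      rw [Algebra.traceForm_apply]; exact hall b
  rw [sub_eq_zero.1 hd0, RingEquiv.apply_symm_apply]

end Trace

/-- Restriction of scalars as a homomorphism of groups. -/
def restrictScalarsHom (K V : Type*) [Field K] [Algebra (ZMod 3) K]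
    [AddCommGroup V] [Module (ZMod 3) V] [Module K V] [IsScalarTower (ZMod 3) K V] :
    (V ≃ₗ[K] V) →* (V ≃ₗ[ZMod 3] V) where
  toFun g := g.restrictScalars (ZMod 3)
  map_one' := rfl
  map_mul' _ _ := rfl

variable [IsScalarTower (ZMod 3) K V]

lemma restrictScalarsHom_apply (g : V ≃ₗ[K] V) (v : V) : restrictScalarsHom K V g v = g v := rfl

lemma restrictScalarsHom_mem_Omega {Q : QuadraticForm (ZMod 3) V} {Qs : QuadraticForm K V}
    (hQs : ∀ v, Q v = Algebra.trace (ZMod 3) K (Qs v)) {g : V ≃ₗ[K] V} (hg : g ∈ Omega Qs) :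
    restrictScalarsHom K V g ∈ Omega Q := by
  have hle : (isometryGroup Qs).map (restrictScalarsHom K V) ≤ isometryGroup Q := by
    rintro _ ⟨g, hg, rfl⟩ v
    rw [hQs, hQs, restrictScalarsHom_apply, hg v]
  have := Subgroup.commutator_mono hle hle
  rw [← Subgroup.map_commutator] at this
  exact this (Subgroup.mem_map_of_mem _ hg)

omit [Module K V] [IsScalarTower (ZMod 3) K V] in
lemma Nondeg.exists_linearEquiv [Finite V] {Q : QuadraticForm (ZMod 3) V} (hQ : Nondeg Q)
    (f : V →+ V) (hf : ∀ v, Q (f v) = Q v) :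
    ∃ g ∈ isometryGroup Q, ∀ v, g v = f v := by
  let f' := f.toZModLinearMap 3
  have hinj : Function.Injective f' := by
    rw [injective_iff_map_eq_zero]
    intro v hv
    refine hQ v fun w => ?_
    have hv' : f v = 0 := hv
    rw [QuadraticMap.polar, ← hf (v + w), map_add, hv', zero_add, hf, ← hf v, hv',
      QuadraticMap.map_zero]
    ring
  have : FiniteDimensional (ZMod 3) V := Module.Finite.of_finite
  exact ⟨LinearEquiv.ofInjectiveEndo f' hinj, fun v => hf v, fun v => rfl⟩

omit [IsScalarTower (ZMod 3) K V] in
/-- A semilinear isometry inducing the Frobenius automorphism on the norms. -/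
lemma exists_frobenius_isometry [Finite K] [Finite V] {Q : QuadraticForm (ZMod 3) V}
    {Qs : QuadraticForm K V} (hQs : ∀ v, Q v = Algebra.trace (ZMod 3) K (Qs v)) (hQ : Nondeg Q) :
    ∃ h ∈ isometryGroup Q, (∀ (a : K) (v : V), h (a • v) = a ^ 3 • h v) ∧
      ∀ v, Qs (h v) = Qs v ^ 3 := by
  have := charP_three K
  have h2 : (2 : K) ≠ 0 := Ring.two_ne_zero (ringChar_ne_two_of_algebra K)
  have := invertibleOfNonzero h2
  have hcube : ∀ a b : K, (a + b) ^ 3 = a ^ 3 + b ^ 3 := fun a b => add_pow_char a b 3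
  obtain ⟨v, hv⟩ := LinearMap.BilinForm.exists_orthogonal_basis (B := Qs.polarBilin)
    ⟨fun x y => QuadraticMap.polar_comm Qs x y⟩
  have hnorm : ∀ c : Fin (Module.finrank K V) → K, Qs (∑ i, c i • v i) =
      ∑ i, c i ^ 2 * Qs (v i) := by
    intro c
    induction (Finset.univ : Finset (Fin (Module.finrank K V))) using Finset.induction_on with
    | empty => simp
    | insert i s hi ih =>
      have h0 : QuadraticMap.polar Qs (c i • v i) (∑ j ∈ s, c j • v j) = 0 := by
        change Qs.polarBilin (c i • v i) (∑ j ∈ s, c j • v j) = 0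
        rw [map_sum]
        refine Finset.sum_eq_zero fun j hj => ?_
        have : Qs.polarBilin (v i) (v j) = 0 := hv (fun hij : i = j => hi (hij ▸ hj))
        rw [map_smul, map_smul, LinearMap.smul_apply, this, smul_zero, smul_zero]
      rw [Finset.sum_insert hi, Finset.sum_insert hi, map_add', ih, h0, QuadraticMap.map_smul,
        smul_eq_mul]
      ring
  -- In an orthogonal basis the coordinates are cubed. The extra factor Qs(v_i) makes the norm of
  -- the image of v_i equal to Qs(v_i)³.
  let f : V →+ V :=
    { toFun := fun x => ∑ i, (v.repr x i ^ 3 * Qs (v i)) • v i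
      map_zero' := by simp
      map_add' := fun x y => by
        simp only [map_add, Finsupp.add_apply, hcube, add_mul, add_smul, Finset.sum_add_distrib] }
  have hfQ : ∀ x, Qs (f x) = Qs x ^ 3 := by
    intro x
    change Qs (∑ i, (v.repr x i ^ 3 * Qs (v i)) • v i) = _
    conv_rhs => rw [← v.sum_repr x]
    rw [hnorm, hnorm, ← frobenius_def, map_sum]
    refine Finset.sum_congr rfl fun i _ => ?_
    rw [frobenius_def]
    ring
  have hσ : ∀ a : K, Algebra.trace (ZMod 3) K (a ^ 3) = Algebra.trace (ZMod 3) K a := fun a => by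
    have h := trace_ringEquiv (RingEquiv.ofBijective (frobenius K 3)
      (Finite.injective_iff_bijective.1 (frobenius K 3).injective)) a
    exact h
  obtain ⟨h, hh, hhf⟩ := hQ.exists_linearEquiv f fun x => by rw [hQs, hfQ, hσ, hQs]
  refine ⟨h, hh, fun a x => ?_, fun x => by rw [hhf, hfQ]⟩
  rw [hhf, hhf]
  change ∑ i, (v.repr (a • x) i ^ 3 * Qs (v i)) • v i =
    a ^ 3 • ∑ i, (v.repr x i ^ 3 * Qs (v i)) • v i
  rw [Finset.smul_sum]
  refine Finset.sum_congr rfl fun i _ => ?_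
  rw [map_smul, Finsupp.smul_apply, smul_eq_mul, smul_smul]
  ring_nf

/-! ### Orbits of the semilinear group on points -/

section Orbits

variable {Q : QuadraticForm (ZMod 3) V} {Qs : QuadraticForm K V}
  {G : Subgroup (V ≃ₗ[ZMod 3] V)}

omit [Field K] [Algebra (ZMod 3) K] [Module K V] [IsScalarTower (ZMod 3) K V] in
lemma eq_mk_iff {x : ℙ (ZMod 3) V} {v : V} (hv : v ≠ 0) :
    x = Projectivization.mk (ZMod 3) v hv ↔ x.rep = v ∨ x.rep = -v := by
  rw [← mk_eq_mk_iff_neg x.rep_nonzero hv, Projectivization.mk_rep]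

omit [Algebra (ZMod 3) K] [IsScalarTower (ZMod 3) K V] in
lemma smul_point (g : fieldExtSubgroup K G) (x : ℙ (ZMod 3) V) :
    g • x = Projectivization.mk (ZMod 3) (g.1.1 x.rep)
      (by simpa using x.rep_nonzero) := by
  conv_lhs => rw [← x.mk_rep]
  rfl

omit [Algebra (ZMod 3) K] [IsScalarTower (ZMod 3) K V] in
lemma mem_orbit_of_semilinear {g : V ≃ₗ[ZMod 3] V} (hg : g ∈ G) {σ : K ≃+* K}
    (hσ : ∀ (a : K) (v : V), g (a • v) = σ a • g v) {x y : ℙ (ZMod 3) V}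
    (h : g x.rep = y.rep ∨ g x.rep = -y.rep) :
    y ∈ MulAction.orbit (fieldExtSubgroup K G) x := by
  refine ⟨⟨⟨g, hg⟩, σ, hσ⟩, ?_⟩
  change (⟨⟨g, hg⟩, σ, hσ⟩ : fieldExtSubgroup K G) • x = y
  rw [smul_point, eq_comm, eq_mk_iff]
  rcases h with h | h
  · exact Or.inl h.symm
  · exact Or.inr (neg_eq_iff_eq_neg.1 h.symm)

omit [IsScalarTower (ZMod 3) K V] in
/-- Norms of points in the same orbit are conjugate. -/
lemma exists_norm_eq_of_mem_orbit [Finite K] (hQs : ∀ v, Q v = Algebra.trace (ZMod 3) K (Qs v))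
    (hGI : G ≤ isometryGroup Q) {x y : ℙ (ZMod 3) V}
    (h : y ∈ MulAction.orbit (fieldExtSubgroup K G) x) :
    ∃ σ : K ≃+* K, Qs y.rep = σ (Qs x.rep) := by
  obtain ⟨g, rfl⟩ := h
  obtain ⟨σ, hσ⟩ := g.2
  refine ⟨σ, ?_⟩
  rw [← norm_semilinear hQs (hGI g.1.2) hσ]
  rcases (eq_mk_iff (x := g • x) (by simpa using x.rep_nonzero)).1 (smul_point g x) with h | h
  · exact congrArg Qs h
  · exact (congrArg Qs h).trans (QuadraticMap.map_neg _ _)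

/-- Points of the same nonzero norm over the large field are in the same orbit. -/
lemma mem_orbit_of_norm_eq [Finite K] [Finite V]
    (hQs : ∀ v, Q v = Algebra.trace (ZMod 3) K (Qs v)) (hQ : Nondeg Q) (hΩG : Omega Q ≤ G)
    (hd : 3 ≤ Module.finrank K V) {x y : ℙ (ZMod 3) V} (hxy : Qs x.rep = Qs y.rep)
    (hx : Qs x.rep ≠ 0) : y ∈ MulAction.orbit (fieldExtSubgroup K G) x := by
  have := Fintype.ofFinite K
  obtain ⟨g, hg, h⟩ := exists_mem_Omega (ringChar_ne_two_of_algebra K) (hQ.of_trace hQs) hd hxy hx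
  exact mem_orbit_of_semilinear (g := restrictScalarsHom K V g) (σ := RingEquiv.refl K)
    (hΩG (restrictScalarsHom_mem_Omega hQs hg)) (fun a v => map_smul g a v) h

/-- If `|K| = 27`, points of conjugate norms are in the same orbit. -/
lemma mem_orbit_of_norm_eq_pow [Finite K] [Finite V]
    (hQs : ∀ v, Q v = Algebra.trace (ZMod 3) K (Qs v)) (hQ : Nondeg Q) (hΩG : Omega Q ≤ G)
    (hd : 3 ≤ Module.finrank K V) (hK : ∀ a : K, a ^ 27 = a) {x y : ℙ (ZMod 3) V}
    (hxy : Qs x.rep ^ 3 = Qs y.rep) (hx : Qs x.rep ≠ 0) :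
    y ∈ MulAction.orbit (fieldExtSubgroup K G) x := by
  have := Fintype.ofFinite K
  have := charP_three K
  have : FiniteDimensional (ZMod 3) V := Module.Finite.of_finite
  obtain ⟨h, hh, hsl, hn⟩ := exists_frobenius_isometry hQs hQ
  -- The isometry h itself need not lie in G, but squares lie in Ω. The fourth power induces a ↦
  -- a^81 = a³, again the Frobenius map, because a^27 = a.
  have h4 : (h * h) * (h * h) ∈ Omega Q :=
    mul_self_mem_Omega two_ne_zero_zmod hQ (mul_mem hh hh)
  have hn4 : ∀ v, Qs (((h * h) * (h * h)) v) = Qs v ^ 3 := by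
    intro v
    simp only [LinearEquiv.mul_apply, hn]
    calc _ = (Qs v ^ 27) ^ 3 := by ring
      _ = _ := by rw [hK]
  have hsl4 : ∀ (a : K) (v : V), ((h * h) * (h * h)) (a • v) =
      a ^ 3 • ((h * h) * (h * h)) v := by
    intro a v
    simp only [LinearEquiv.mul_apply, hsl]
    congr 1
    calc _ = (a ^ 27) ^ 3 := by ring
      _ = _ := by rw [hK]
  obtain ⟨g, hg, hgy⟩ := exists_mem_Omega (ringChar_ne_two_of_algebra K) (hQ.of_trace hQs) hd
    (x := ((h * h) * (h * h)) x.rep) (y := y.rep) ((hn4 _).trans hxy)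
    (by rw [hn4]; exact pow_ne_zero 3 hx)
  refine mem_orbit_of_semilinear (g := restrictScalarsHom K V g * ((h * h) * (h * h)))
    (σ := RingEquiv.ofBijective (frobenius K 3)
      (Finite.injective_iff_bijective.1 (frobenius K 3).injective))
    (hΩG (mul_mem (restrictScalarsHom_mem_Omega hQs hg) h4)) (fun a v => ?_) hgy
  rw [LinearEquiv.mul_apply, hsl4, restrictScalarsHom_apply, map_smul]
  rfl

end Orbits

end FieldExtension

/-! ### Norm counts over the large field with a trace condition -/

section TraceCounts

variable {K V : Type*} [Field K] [Algebra (ZMod 3) K] [Fintype K]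

lemma card_trace_mul_eq_zero {a : K} (ha : a ≠ 0) (t : ZMod 3) :
    3 * Nat.card {b : K // Algebra.trace (ZMod 3) K (a * b) = t} = Fintype.card K := by
  have : FiniteDimensional (ZMod 3) K := Module.Finite.of_finite
  have hf : Algebra.traceForm (ZMod 3) K a ≠ 0 := fun h =>
    ha ((traceForm_nondegenerate (ZMod 3) K).1 a fun b => LinearMap.congr_fun h b)
  have := card_fibre_mul hf t
  rw [Nat.card_zmod, Nat.card_eq_fintype_card (α := K)] at this
  exact this

lemma card_mem_eq_sum {V : Type*} [Finite V] {X : Type*} [DecidableEq X] (f : V → X) (p : V → Prop)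
    (C : Finset X) :
    Nat.card {y : V // f y ∈ C ∧ p y} = ∑ c ∈ C, Nat.card {y : V // f y = c ∧ p y} := by
  classical
  have := Fintype.ofFinite V
  simp only [Nat.card_eq_fintype_card, Fintype.card_subtype]
  rw [Finset.card_eq_sum_card_fiberwise (f := f) (t := C)]
  · refine Finset.sum_congr rfl fun c hc => ?_
    congr 1
    ext y
    simp only [Finset.mem_filter, Finset.mem_univ, true_and]
    constructor
    · rintro ⟨⟨_, h⟩, h'⟩; exact ⟨h', h⟩
    · rintro ⟨rfl, h⟩; exact ⟨⟨hc, h⟩, rfl⟩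
  · intro y hy
    exact (Finset.mem_filter.1 hy).2.1

variable [DecidableEq K] [AddCommGroup V] [Module K V] {Qs : QuadraticForm K V}

/-- The number of vectors with norm in `C` which are orthogonal to `x` for the trace form. -/
lemma card_trace_perp [Finite V] {x : V} (hx : Qs x ≠ 0) {T : ℤ}
    (hd : Even (Module.finrank K (vperp Qs x))) (hT : HasCount (restr Qs (vperp Qs x)) T)
    (C : Finset K) :
    3 * Nat.card {y : V // Qs y ∈ C ∧
        Algebra.trace (ZMod 3) K (QuadraticMap.polar Qs x y) = 0} =
      C.card * ((Fintype.card K : ℤ) ^ Module.finrank K (vperp Qs x) - T) + 3 * T *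
        (Finset.univ.filter fun b : K =>
          Algebra.trace (ZMod 3) K (Qs x * b) = 0 ∧ b * b * Qs x ∈ C).card := by
  have hF := ringChar_ne_two_of_algebra K
  have h2 := Ring.two_ne_zero hF
  have hq : (Fintype.card K : ℤ) ≠ 0 := by exact_mod_cast Fintype.card_ne_zero
  set q : ℤ := (Fintype.card K : ℤ) with hqdef
  set d := Module.finrank K (vperp Qs x)
  have hcond : ∀ b : K, Algebra.trace (ZMod 3) K (2 * b * Qs x) = 0 ↔
      Algebra.trace (ZMod 3) K (Qs x * b) = 0 := by
    intro b
    have h3 := three_eq_zero_of_algebra K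
    rw [show 2 * b * Qs x = -(Qs x * b) by linear_combination b * Qs x * h3, map_neg, neg_eq_zero]
  -- Writing y = bx + z with z in x^⊥, the trace condition concerns b only. So one sums over b in B,
  -- and z is counted in the even-dimensional space x^⊥.
  set B := Finset.univ.filter fun b : K => Algebra.trace (ZMod 3) K (Qs x * b) = 0 with hB
  have hBcard : 3 * (B.card : ℤ) = q := by
    have := card_trace_mul_eq_zero hx 0
    rw [Nat.card_eq_fintype_card, Fintype.card_subtype] at this
    rw [hqdef]
    exact_mod_cast this
  have h1 : ∀ c : K, q * Nat.card {y : V // Qs y = c ∧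
        Algebra.trace (ZMod 3) K (QuadraticMap.polar Qs x y) = 0} =
      B.card * (q ^ d - T) + q * T * (B.filter fun b => b * b * Qs x = c).card := by
    intro c
    rw [card_split h2 hx c (fun z => Algebra.trace (ZMod 3) K z = 0)]
    simp only [hcond]
    push_cast
    rw [Finset.mul_sum]
    have hterm : ∀ b ∈ B, q * (cnt (restr Qs (vperp Qs x)) (c - b * b * Qs x) : ℤ) =
        (q ^ d - T) + q * T * (if b * b * Qs x = c then 1 else 0) := by
      intro b _
      rw [hT.card_mul, devKernel, if_pos hd]
      have : c - b * b * Qs x = 0 ↔ b * b * Qs x = c := by rw [sub_eq_zero, eq_comm]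
      simp only [this]
      split_ifs <;> ring
    rw [← hB, Finset.sum_congr rfl hterm, Finset.sum_add_distrib, Finset.sum_const, nsmul_eq_mul,
      ← Finset.mul_sum, Finset.sum_boole]
  have h3 : ((Finset.univ.filter fun b : K =>
          Algebra.trace (ZMod 3) K (Qs x * b) = 0 ∧ b * b * Qs x ∈ C).card : ℤ) =
      ∑ c ∈ C, ((B.filter fun b => b * b * Qs x = c).card : ℤ) := by
    rw [← Finset.filter_filter, ← hB, Finset.card_eq_sum_card_fiberwise
      (f := fun b => b * b * Qs x) (t := C)]
    · push_cast
      refine Finset.sum_congr rfl fun c hc => ?_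
      congr 2
      ext b
      simp only [Finset.mem_filter]
      constructor
      · rintro ⟨⟨h, _⟩, h'⟩; exact ⟨h, h'⟩
      · rintro ⟨h, rfl⟩; exact ⟨⟨h, hc⟩, rfl⟩
    · intro b hb
      exact (Finset.mem_filter.1 hb).2
  rw [h3, card_mem_eq_sum Qs
    (fun y => Algebra.trace (ZMod 3) K (QuadraticMap.polar Qs x y) = 0) C]
  apply mul_left_cancel₀ hq
  have h4 : q * ∑ c ∈ C, (Nat.card {y : V // Qs y = c ∧
        Algebra.trace (ZMod 3) K (QuadraticMap.polar Qs x y) = 0} : ℤ) =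
      C.card * (B.card * (q ^ d - T)) +
        q * T * ∑ c ∈ C, ((B.filter fun b => b * b * Qs x = c).card : ℤ) := by
    rw [Finset.mul_sum, Finset.sum_congr rfl fun c _ => h1 c, Finset.sum_add_distrib,
      Finset.sum_const, nsmul_eq_mul, Finset.mul_sum]
  push_cast
  linear_combination 3 * h4 + C.card * (q ^ d - T) * hBcard

/-- The number of vectors with norm in `C`, for `C` a set of norms in the square class of that of
`x`. -/
lemma card_norm_mem [Finite V] {x : V} (hx : Qs x ≠ 0) {T : ℤ}
    (hd : Even (Module.finrank K (vperp Qs x))) (hT : HasCount (restr Qs (vperp Qs x)) T)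
    (C : Finset K) (hC : ∀ c ∈ C, quadraticChar K c = quadraticChar K (Qs x)) :
    (Nat.card {y : V // Qs y ∈ C} : ℤ) =
      C.card * ((Fintype.card K : ℤ) ^ Module.finrank K (vperp Qs x) + T) := by
  have hF := ringChar_ne_two_of_algebra K
  have hq : (Fintype.card K : ℤ) ≠ 0 := by exact_mod_cast Fintype.card_ne_zero
  have hQ := hT.of_even hF hx hd
  have h1 := card_mem_eq_sum Qs (fun _ => True) C
  simp only [and_true] at h1
  rw [h1]
  push_cast
  apply mul_left_cancel₀ hq
  have hfr := finrank_vperp (Ring.two_ne_zero hF) hx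
  have hodd : ¬ Even (Module.finrank K V) := by
    rw [← hfr, Nat.even_add_one, not_not]; exact hd
  rw [Finset.mul_sum]
  have hterm : ∀ c ∈ C, (Fintype.card K : ℤ) * Nat.card {y : V // Qs y = c} =
      Fintype.card K * ((Fintype.card K : ℤ) ^ Module.finrank K (vperp Qs x) + T) := by
    intro c hc
    have := hQ.card_mul c
    rw [cnt] at this
    rw [this, devKernel, if_neg hodd, hC c hc, ← hfr]
    linear_combination (Fintype.card K * T : ℤ) * quadraticChar_sq_one hx
  rw [Finset.sum_congr rfl hterm, Finset.sum_const, nsmul_eq_mul]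
  ring

end TraceCounts

/-! ### Traces and squares in the field with 27 elements -/

section CubicField

variable {K : Type*} [Field K] [Algebra (ZMod 3) K] (hK : Module.finrank (ZMod 3) K = 3)

lemma eq_of_cube_eq {z : K} (hz : z ^ 3 = z) : ∃ r : ZMod 3, algebraMap (ZMod 3) K r = z := by
  have : z * ((z - 1) * (z + 1)) = 0 := by linear_combination hz
  rcases mul_eq_zero.1 this with h | h
  · exact ⟨0, by rw [h, map_zero]⟩
  rcases mul_eq_zero.1 h with h | h
  · exact ⟨1, by rw [map_one, sub_eq_zero.1 h]⟩
  · exact ⟨-1, by rw [map_neg, map_one, eq_neg_of_add_eq_zero_left h]⟩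

lemma trace_algebraMap_mul (r : ZMod 3) (a : K) :
    Algebra.trace (ZMod 3) K (algebraMap (ZMod 3) K r * a) =
      r * Algebra.trace (ZMod 3) K a := by
  rw [← Algebra.smul_def, map_smul, smul_eq_mul]

include hK

lemma natCard_cubic : Nat.card K = 27 := by
  have : FiniteDimensional (ZMod 3) K := FiniteDimensional.of_finrank_pos (by lia)
  rw [Module.natCard_eq_pow_finrank (K := ZMod 3), Nat.card_zmod, hK]; norm_num

lemma finite_cubic : Finite K := Nat.finite_of_card_ne_zero (by rw [natCard_cubic hK]; norm_num)

lemma pow_card_cubic (a : K) : a ^ 27 = a := by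
  have := finite_cubic hK
  have := Fintype.ofFinite K
  have h := FiniteField.pow_card a
  rwa [← Nat.card_eq_fintype_card, natCard_cubic hK] at h

lemma trace_cubic (a : K) : algebraMap (ZMod 3) K (Algebra.trace (ZMod 3) K a) =
    a + a ^ 3 + a ^ 9 := by
  have := finite_cubic hK
  rw [FiniteField.algebraMap_trace_eq_sum_pow, hK, Nat.card_zmod]
  simp [Finset.sum_range_succ]

lemma trace_algebraMap_cubic (r : ZMod 3) :
    Algebra.trace (ZMod 3) K (algebraMap (ZMod 3) K r) = 0 := by
  rw [Algebra.trace_algebraMap, hK]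
  simp only [nsmul_eq_mul]
  rw [show ((3 : ℕ) : ZMod 3) = 0 from rfl, zero_mul]

/-- The minimal polynomial of an element of nonzero trace. -/
lemma exists_coeffs_cubic {a : K} (ha : Algebra.trace (ZMod 3) K a ≠ 0) :
    ∃ b c : ZMod 3, algebraMap (ZMod 3) K b = a ^ 4 + a ^ 10 + a ^ 12 ∧
      algebraMap (ZMod 3) K c = a ^ 13 ∧
      c = (if b = -1 then 1 else -1) * Algebra.trace (ZMod 3) K a ∧
      Algebra.trace (ZMod 3) K (a ^ 2) = 1 + b ∧
      (Algebra.trace (ZMod 3) K (a ^ 5) = 0 ↔ b = -1) := by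
  have h27 := pow_card_cubic hK
  have := charP_three K
  have h3 := three_eq_zero_of_algebra K
  have htr := trace_cubic hK a
  have hadd : ∀ x y : K, (x + y) ^ 3 = x ^ 3 + y ^ 3 := fun x y => add_pow_char x y 3
  have hsub : ∀ x y : K, (x - y) ^ 3 = x ^ 3 - y ^ 3 := fun x y => sub_pow_char x y
  -- These are the second and third elementary symmetric functions of the conjugates a, a³, a⁹,
  -- hence fixed by cubing.
  obtain ⟨b, hb⟩ := eq_of_cube_eq (z := a ^ 4 + a ^ 10 + a ^ 12) (by
    rw [hadd, hadd]
    linear_combination (a ^ 3 + a ^ 9) * h27 a)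
  obtain ⟨c, hc⟩ := eq_of_cube_eq (z := a ^ 13) (by linear_combination (a ^ 12) * h27 a)
  set ε := Algebra.trace (ZMod 3) K a with hε
  have hnot : ∀ s : ZMod 3, algebraMap (ZMod 3) K s ≠ a := by
    rintro s rfl
    exact ha (trace_algebraMap_cubic hK s)
  have hcub : a ^ 3 = algebraMap (ZMod 3) K ε * a ^ 2 - algebraMap (ZMod 3) K b * a +
      algebraMap (ZMod 3) K c := by
    rw [htr, hb, hc]; ring
  -- An element of nonzero trace is outside F_3, so its cubic has no root there. The finite check
  -- below shows that this determines c from the trace and b.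
  have hroot : ∀ s : ZMod 3, s ^ 3 - ε * s ^ 2 + b * s - c ≠ 0 := by
    intro s h
    have h' := congrArg (algebraMap (ZMod 3) K) h
    simp only [map_add, map_sub, map_mul, map_pow, map_zero] at h'
    set σ := algebraMap (ZMod 3) K s
    have hs3 : σ ^ 3 = σ := by
      rw [← map_pow, ZMod.pow_card]
    -- The power 13 = 1 + 3 + 9 is the norm, so this is the cubic evaluated at σ.
    have hprod : (σ - a) ^ 13 = 0 := by
      have e1 : (σ - a) ^ 13 = (σ - a) * (σ - a) ^ 3 * ((σ - a) ^ 3) ^ 3 := by ring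
      rw [e1, hsub, hsub, hs3, hs3]
      rw [htr, hb, hc] at h'
      linear_combination h'
    exact hnot s (sub_eq_zero.1 (pow_eq_zero_iff (by norm_num) |>.1 hprod))
  have h2 : Algebra.trace (ZMod 3) K (a ^ 2) = ε ^ 2 + b := by
    apply (algebraMap (ZMod 3) K).injective
    rw [trace_cubic hK, map_add, map_pow, htr, hb]
    linear_combination (-(a ^ 4 + a ^ 10 + a ^ 12)) * h3
  have h5 : Algebra.trace (ZMod 3) K (a ^ 5) =
      ((ε * ε - b) * ε - ε * b + c) * (ε ^ 2 + b) + (-(ε * ε - b) * b + ε * c) * ε := by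
    have : a ^ 5 = algebraMap (ZMod 3) K ((ε * ε - b) * ε - ε * b + c) * a ^ 2 +
        algebraMap (ZMod 3) K (-(ε * ε - b) * b + ε * c) * a +
        algebraMap (ZMod 3) K ((ε * ε - b) * c) := by
      simp only [map_add, map_sub, map_mul, map_neg]
      generalize algebraMap (ZMod 3) K ε = e at *
      generalize algebraMap (ZMod 3) K b = b' at *
      generalize algebraMap (ZMod 3) K c = c' at *
      linear_combination (a ^ 2 + e * a + (e * e - b')) * hcub
    rw [this, map_add, map_add, trace_algebraMap_mul, trace_algebraMap_mul,
      trace_algebraMap_cubic hK, h2, ← hε, add_zero]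
  refine ⟨b, c, hb, hc, ?_, ?_, ?_⟩
  · have r0 := hroot 0
    have r1 := hroot 1
    have r2 := hroot (-1)
    clear * - ha r0 r1 r2
    revert ha r0 r1 r2
    generalize ε = e
    revert e b c
    decide
  · rw [h2]
    clear * - ha
    revert ha
    generalize ε = e
    revert e b
    decide
  · rw [h5]
    have r0 := hroot 0
    have r1 := hroot 1
    have r2 := hroot (-1)
    clear * - ha r0 r1 r2
    revert ha r0 r1 r2
    generalize ε = e
    revert e b c
    decide

/-- By `exists_coeffs_cubic` the traces of a and a² determine all coefficients of the minimal
polynomial. Hence a' is a root of the polynomial with roots a, a³, a⁹. -/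
lemma conj_of_trace_sq_eq {a a' : K} (ha : Algebra.trace (ZMod 3) K a ≠ 0)
    (h1 : Algebra.trace (ZMod 3) K a' = Algebra.trace (ZMod 3) K a)
    (h2 : Algebra.trace (ZMod 3) K (a' ^ 2) = Algebra.trace (ZMod 3) K (a ^ 2)) :
    a' = a ∨ a' = a ^ 3 ∨ a' = a ^ 9 := by
  obtain ⟨b, c, hb, hc, hbc, ht, -⟩ := exists_coeffs_cubic hK ha
  obtain ⟨b', c', hb', hc', hbc', ht', -⟩ := exists_coeffs_cubic hK (h1.symm ▸ ha : _ ≠ (0 : ZMod 3))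
  have hbb : b' = b := by
    rw [ht, ht'] at h2; exact add_left_cancel h2
  have hcc : c' = c := by rw [hbc, hbc', hbb, h1]
  have htr := trace_cubic hK a
  have htr' := trace_cubic hK a'
  rw [h1] at htr'
  have : (a' - a) * ((a' - a ^ 3) * (a' - a ^ 9)) = 0 := by
    rw [hbb, hb] at hb'
    rw [hcc, hc] at hc'
    rw [htr] at htr'
    linear_combination (-(a' ^ 2)) * htr' + a' * hb' - hc'
  rcases mul_eq_zero.1 this with h | h
  · exact Or.inl (sub_eq_zero.1 h)
  rcases mul_eq_zero.1 h with h | h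
  · exact Or.inr (Or.inl (sub_eq_zero.1 h))
  · exact Or.inr (Or.inr (sub_eq_zero.1 h))

/-- By Euler's criterion the character of a is a^13, which is the norm c found in
`exists_coeffs_cubic`. -/
lemma quadraticChar_cubic [Fintype K] [DecidableEq K] {a : K}
    (ha : Algebra.trace (ZMod 3) K a ≠ 0) :
    quadraticChar K a = (if Algebra.trace (ZMod 3) K (a ^ 2) = 0 then 1 else -1) *
      quadraticChar (ZMod 3) (Algebra.trace (ZMod 3) K a) := by
  obtain ⟨b, c, hb, hc, hbc, ht, -⟩ := exists_coeffs_cubic hK ha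
  have hF := ringChar_ne_two_of_algebra K
  have ha0 : a ≠ 0 := by rintro rfl; exact ha (map_zero _)
  have hpow := quadraticChar_eq_pow_of_char_ne_two' hF a
  rw [← Nat.card_eq_fintype_card, natCard_cubic hK] at hpow
  have hcond : Algebra.trace (ZMod 3) K (a ^ 2) = 0 ↔ b = -1 := by
    rw [ht]; clear * -; revert b; decide
  simp only [hcond]
  have hq : quadraticChar K a = quadraticChar (ZMod 3) c := by
    have hc0 : c ≠ 0 := by
      rintro rfl
      rw [map_zero] at hc
      exact pow_ne_zero 13 ha0 hc.symm
    have h1 : (quadraticChar K a : K) = algebraMap (ZMod 3) K c := by rw [hpow, hc]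
    have hne : (1 : K) ≠ -1 := fun h => Ring.two_ne_zero hF (by linear_combination h)
    have hcc : c = 1 ∨ c = -1 := by clear * - hc0; revert c; decide
    rcases hcc with rfl | rfl <;> rcases quadraticChar_dichotomy ha0 with h | h
    · rw [h]; decide
    · rw [h] at h1
      exact absurd h1.symm (by simpa using hne)
    · rw [h] at h1
      exact absurd h1 (by simpa using hne)
    · rw [h]; decide
  rw [hq, hbc]
  clear * - ha
  revert ha
  generalize Algebra.trace (ZMod 3) K a = e
  revert e b
  decide

/-- Adding s in F_3 to a keeps the trace and moves the trace of a² by 2sε. So each value of the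
latter occurs for 3 of the 9 elements, and `quadraticChar_cubic` gives 3 - 6 = -3 times χ(ε). -/
lemma sum_quadraticChar_cubic [Fintype K] [DecidableEq K] {ε : ZMod 3} (hε : ε ≠ 0) :
    ∑ a : K with Algebra.trace (ZMod 3) K a = ε, quadraticChar K a =
      -3 * quadraticChar (ZMod 3) ε := by
  set A := Finset.univ.filter fun a : K => Algebra.trace (ZMod 3) K a = ε with hA
  let f : ZMod 3 → ℕ := fun t => (A.filter fun a => Algebra.trace (ZMod 3) K (a ^ 2) = t).card
  have hAcard : A.card = 9 := by
    have := card_trace_mul_eq_zero (K := K) one_ne_zero ε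
    simp only [one_mul] at this
    rw [Nat.card_eq_fintype_card, Fintype.card_subtype, ← Nat.card_eq_fintype_card,
      natCard_cubic hK] at this
    have : 3 * A.card = 27 := this
    lia
  have hshift : ∀ t s : ZMod 3, f t ≤ f (t + 2 * s * ε) := by
    intro t s
    refine Finset.card_le_card_of_injOn (fun a => a + algebraMap (ZMod 3) K s) ?_ ?_
    · intro a ha
      simp only [hA, Finset.coe_filter, Finset.mem_filter, Finset.mem_univ, true_and,
        Set.mem_ofPred_eq] at ha ⊢
      refine ⟨by rw [map_add, trace_algebraMap_cubic hK, ha.1, add_zero], ?_⟩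
      rw [show (a + algebraMap (ZMod 3) K s) ^ 2 = a ^ 2 + algebraMap (ZMod 3) K (2 * s) * a +
        algebraMap (ZMod 3) K (s * s) by simp only [map_mul, map_ofNat]; ring, map_add, map_add,
        trace_algebraMap_mul, trace_algebraMap_cubic hK, ha.1, ha.2, add_zero]
    · intro a _ b _ h
      exact add_right_cancel h
  have hsum : ∑ t, f t = 9 := by
    rw [← hAcard, Finset.card_eq_sum_card_fiberwise (t := Finset.univ)
      (f := fun a => Algebra.trace (ZMod 3) K (a ^ 2)) (fun _ _ => Finset.mem_univ _)]
  have hf : ∀ t t', f t ≤ f t' := by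
    intro t t'
    have h := hshift t ((t - t') * ε)
    have : t + 2 * ((t - t') * ε) * ε = t' := by
      clear * - hε; revert t t' ε; decide
    rwa [this] at h
  have hf0 : f 0 = 3 := by
    have h1 : ∀ t, f t = f 0 := fun t => le_antisymm (hf _ _) (hf _ _)
    simp only [h1, Finset.sum_const, Finset.card_univ, ZMod.card, smul_eq_mul] at hsum
    lia
  have hterm : ∀ a ∈ A, quadraticChar K a =
      (2 * (if Algebra.trace (ZMod 3) K (a ^ 2) = 0 then 1 else 0) - 1) *
        quadraticChar (ZMod 3) ε := by
    intro a ha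
    have ha' : Algebra.trace (ZMod 3) K a = ε := (Finset.mem_filter.1 ha).2
    rw [quadraticChar_cubic hK (by rwa [ha']), ha']
    split_ifs <;> ring
  rw [Finset.sum_congr rfl hterm, ← Finset.sum_mul, Finset.sum_sub_distrib, ← Finset.mul_sum,
    Finset.sum_boole, Finset.sum_const, hAcard]
  change (2 * ((f 0 : ℕ) : ℤ) - _) * _ = _
  rw [hf0]
  norm_num

end CubicField

/-! ### Counting vectors with conjugate norms, α = 3 -/

section CubicOrbits

variable {K V : Type*} [Field K] [Algebra (ZMod 3) K]
  [AddCommGroup V] [Module (ZMod 3) V] [Module K V]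
  {Q : QuadraticForm (ZMod 3) V} {Qs : QuadraticForm K V}

section Conjugates

variable (hK : Module.finrank (ZMod 3) K = 3) {a : K}
  (ha : Algebra.trace (ZMod 3) K a ≠ 0)

include hK ha

lemma pow_three_ne_self_cubic : a ^ 3 ≠ a := by
  intro h
  obtain ⟨r, rfl⟩ := eq_of_cube_eq h
  exact ha (trace_algebraMap_cubic hK r)

lemma pow_nine_ne_self_cubic : a ^ 9 ≠ a := by
  intro h
  refine pow_three_ne_self_cubic hK ha ?_
  rw [← pow_card_cubic hK a]
  calc (a ^ 27) ^ 3 = (a ^ 27) ^ 3 := rfl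
    _ = (a ^ 9) ^ 3 := by rw [pow_card_cubic hK a, h]
    _ = a ^ 27 := by ring

lemma pow_nine_ne_pow_three_cubic : a ^ 9 ≠ a ^ 3 := by
  intro h
  refine pow_nine_ne_self_cubic hK ha ?_
  calc a ^ 9 = (a ^ 3) ^ 3 := by ring
    _ = (a ^ 9) ^ 3 := by rw [h]
    _ = a ^ 27 := by ring
    _ = a := pow_card_cubic hK a

lemma card_conjugates [DecidableEq K] : ({a, a ^ 3, a ^ 9} : Finset K).card = 3 :=
  Finset.card_eq_three.2 ⟨a, a ^ 3, a ^ 9, (pow_three_ne_self_cubic hK ha).symm,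
    (pow_nine_ne_self_cubic hK ha).symm, (pow_nine_ne_pow_three_cubic hK ha).symm, rfl⟩

omit hK in
lemma mul_self_mul_mem_conjugates [DecidableEq K] (b : K) :
    b * b * a ∈ ({a, a ^ 3, a ^ 9} : Finset K) ↔
      b = 1 ∨ b = -1 ∨ b = a ∨ b = -a ∨ b = a ^ 4 ∨ b = -a ^ 4 := by
  have ha0 : a ≠ 0 := by rintro rfl; exact ha (map_zero _)
  have key : ∀ z : K, b * b * a = z * z * a ↔ b = z ∨ b = -z := by
    intro z
    rw [mul_left_inj' ha0, mul_self_eq_mul_self_iff]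
  have h1 := key 1
  have h2 := key a
  have h3 := key (a ^ 4)
  rw [show (1 : K) * 1 * a = a by ring] at h1
  rw [show a * a * a = a ^ 3 by ring] at h2
  rw [show a ^ 4 * a ^ 4 * a = a ^ 9 by ring] at h3
  rw [Finset.mem_insert, Finset.mem_insert, Finset.mem_singleton, h1, h2, h3]
  simp only [or_assoc]

/-- The candidates are ±1, ±a, ±a⁴. The trace of a excludes ±1, and the traces of a² and a⁵ vanish
together, so the other four all occur or all fail. -/
lemma card_conjugate_multipliers [Fintype K] [DecidableEq K] :
    (Finset.univ.filter fun b : K => Algebra.trace (ZMod 3) K (a * b) = 0 ∧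
      b * b * a ∈ ({a, a ^ 3, a ^ 9} : Finset K)).card =
      if Algebra.trace (ZMod 3) K (a ^ 2) = 0 then 4 else 0 := by
  obtain ⟨β, c, -, -, -, ht, h5⟩ := exists_coeffs_cubic hK ha
  have h25 : Algebra.trace (ZMod 3) K (a ^ 5) = 0 ↔ Algebra.trace (ZMod 3) K (a ^ 2) = 0 := by
    rw [h5, ht]
    clear * -
    revert β; decide
  have ha0 : a ≠ 0 := by rintro rfl; exact ha (map_zero _)
  have hneg : ∀ b : K, Algebra.trace (ZMod 3) K (a * -b) = 0 ↔
      Algebra.trace (ZMod 3) K (a * b) = 0 := fun b => by rw [mul_neg, map_neg, neg_eq_zero]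
  have e2 : a * a = a ^ 2 := by ring
  have e5 : a * a ^ 4 = a ^ 5 := by ring
  have h1 : ¬ Algebra.trace (ZMod 3) K (a * 1) = 0 := by rwa [mul_one]
  have hfilter : ∀ b : K, (Algebra.trace (ZMod 3) K (a * b) = 0 ∧
      b * b * a ∈ ({a, a ^ 3, a ^ 9} : Finset K)) ↔ Algebra.trace (ZMod 3) K (a ^ 2) = 0 ∧
      (b = a ∨ b = -a ∨ b = a ^ 4 ∨ b = -a ^ 4) := by
    intro b
    rw [mul_self_mul_mem_conjugates ha]
    constructor
    · rintro ⟨hb, rfl | rfl | rfl | rfl | rfl | rfl⟩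
      · exact absurd hb h1
      · exact absurd ((hneg 1).1 hb) h1
      · exact ⟨by rwa [e2] at hb, by tauto⟩
      · exact ⟨by rwa [hneg, e2] at hb, by tauto⟩
      · exact ⟨by rwa [e5, h25] at hb, by tauto⟩
      · exact ⟨by rwa [hneg, e5, h25] at hb, by tauto⟩
    · rintro ⟨hb, rfl | rfl | rfl | rfl⟩
      · exact ⟨by rwa [e2], by tauto⟩
      · exact ⟨by rwa [hneg, e2], by tauto⟩
      · exact ⟨by rwa [e5, h25], by tauto⟩
      · exact ⟨by rwa [hneg, e5, h25], by tauto⟩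
  simp only [hfilter]
  split_ifs with h
  · have hset : (Finset.univ.filter fun b : K => Algebra.trace (ZMod 3) K (a ^ 2) = 0 ∧
        (b = a ∨ b = -a ∨ b = a ^ 4 ∨ b = -a ^ 4)) = {a, -a, a ^ 4, -a ^ 4} := by
      ext b
      simp [h]
    rw [hset]
    have h2 := Ring.two_ne_zero (ringChar_ne_two_of_algebra K)
    have hn : ∀ z : K, z ≠ 0 → z ≠ -z := fun z hz hzz =>
      mul_ne_zero h2 hz (by linear_combination hzz)
    have h4 : a ^ 4 ≠ 0 := pow_ne_zero 4 ha0
    have hd1 : a ≠ a ^ 4 := by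
      intro hh
      have h3 : a ^ 3 = 1 := mul_left_cancel₀ ha0 (by linear_combination -hh)
      apply pow_nine_ne_pow_three_cubic hK ha
      rw [show a ^ 9 = (a ^ 3) ^ 3 by ring, h3]; ring
    have hd2 : a ≠ -a ^ 4 := by
      intro hh
      have h3 : a ^ 3 = -1 := mul_left_cancel₀ ha0 (by linear_combination hh)
      apply pow_nine_ne_pow_three_cubic hK ha
      rw [show a ^ 9 = (a ^ 3) ^ 3 by ring, h3]; ring
    have hd3 : -a ≠ a ^ 4 := fun hh => hd2 (by rw [← hh, neg_neg])
    have hd4 : -a ≠ -a ^ 4 := fun hh => hd1 (neg_injective hh)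
    rw [Finset.card_insert_of_notMem, Finset.card_insert_of_notMem, Finset.card_insert_of_notMem,
      Finset.card_singleton]
    · simpa using hn _ h4
    · simp only [Finset.mem_insert, Finset.mem_singleton, not_or]
      exact ⟨hd3, hd4⟩
    · simp only [Finset.mem_insert, Finset.mem_singleton, not_or]
      exact ⟨hn _ ha0, hd1, hd2⟩
  · rw [Finset.card_eq_zero, Finset.filter_eq_empty_iff]
    rintro b - ⟨h', -⟩
    exact h h'

end Conjugates

/-- The constant governing the norm counts over the large field. -/
lemma hasCount_cubic [Finite V] [Fintype K] [DecidableEq K] [IsScalarTower (ZMod 3) K V]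
    (hK : Module.finrank (ZMod 3) K = 3) (hQs : ∀ v, Q v = Algebra.trace (ZMod 3) K (Qs v))
    {n : ℕ} (hm : Module.finrank (ZMod 3) V = 2 * (n + 1) + 1) {ξ : ℤˣ} {ε : ZMod 3} (hε : ε ≠ 0)
    (hT : HasCount Q (ξ * quadraticChar (ZMod 3) ε * 3 ^ (n + 2)))
    {T : ℤ} (hTs : HasCount Qs T) : T = -(ξ * quadraticChar (ZMod 3) ε * 3 ^ (n + 3)) := by
  set A := Finset.univ.filter fun a : K => Algebra.trace (ZMod 3) K a = ε with hA
  have hdim := Module.finrank_mul_finrank (ZMod 3) K V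
  rw [hK, hm] at hdim
  have hodd : ¬ Even (Module.finrank K V) := by
    rw [Nat.not_even_iff_odd]
    by_contra h
    obtain ⟨j, hj⟩ := Nat.not_odd_iff_even.1 h
    lia
  have hcardK : (Fintype.card K : ℤ) = 27 := by
    rw [← Nat.card_eq_fintype_card, natCard_cubic hK]; norm_num
  have h1 := card_mem_eq_sum Qs (fun _ => True) A
  simp only [and_true, hA, Finset.mem_filter, Finset.mem_univ, true_and, ← hQs] at h1
  have h2 := hT.card_mul ε
  have h3 : ∀ a, (27 : ℤ) * Nat.card {v : V // Qs v = a} = 3 ^ (2 * (n + 1) + 1) +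
      T * quadraticChar K a := by
    intro a
    have := hTs.card_mul a
    rw [hcardK, devKernel, if_neg hodd] at this
    rw [← hdim, pow_mul]
    exact this
  -- A vector has Q-norm ε exactly when its norm over K has trace ε. Summing over this fibre of the
  -- trace ties T to the constant of Q.
  have h4 : (27 : ℤ) * cnt Q ε = A.card * 3 ^ (2 * (n + 1) + 1) +
      T * (-3 * quadraticChar (ZMod 3) ε) := by
    rw [cnt, h1, ← sum_quadraticChar_cubic hK hε]
    push_cast
    rw [Finset.mul_sum, Finset.sum_congr rfl fun a _ => h3 a, Finset.sum_add_distrib,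
      Finset.sum_const, nsmul_eq_mul, Finset.mul_sum]
  have hAcard : (A.card : ℤ) = 9 := by
    have := card_trace_mul_eq_zero (K := K) one_ne_zero ε
    simp only [one_mul] at this
    rw [Nat.card_eq_fintype_card, Fintype.card_subtype, ← Nat.card_eq_fintype_card,
      natCard_cubic hK] at this
    have h' : 3 * A.card = 27 := this
    lia
  have h5 : ¬ Even (2 * (n + 1) + 1) := by simp
  rw [hm, devKernel, if_neg h5, ZMod.card] at h2
  push_cast at h2
  have hsq := quadraticChar_sq_one hε
  set χ := quadraticChar (ZMod 3) ε
  rw [hAcard] at h4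
  have h6 : -3 * T * χ = ξ * 3 ^ (n + 4) := by
    have e : (ξ : ℤ) * χ * 3 ^ (n + 2) * χ = ξ * 3 ^ (n + 2) := by
      linear_combination (ξ : ℤ) * 3 ^ (n + 2) * hsq
    rw [e] at h2
    rw [show (3 : ℤ) ^ (n + 4) = 9 * 3 ^ (n + 2) by ring]
    linarith
  have h7 : 3 * T = 3 * -(ξ * χ * 3 ^ (n + 3)) := by
    rw [show (3 : ℤ) ^ (n + 4) = 3 * 3 ^ (n + 3) by ring] at h6
    linear_combination -χ * h6 - 3 * T * hsq
  linarith

/-- The equation satisfied by the orbit sizes in the cubic case, in terms of vectors. -/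
lemma card_conjugate_norms [Finite V] [Fintype K] [DecidableEq K] [IsScalarTower (ZMod 3) K V]
    (hK : Module.finrank (ZMod 3) K = 3) (hQs : ∀ v, Q v = Algebra.trace (ZMod 3) K (Qs v))
    (hQ : Nondeg Q)
    {n : ℕ} (hm : Module.finrank (ZMod 3) V = 2 * (n + 1) + 1) {ξ : ℤˣ} {ε : ZMod 3} (hε : ε ≠ 0)
    (hT : HasCount Q (ξ * quadraticChar (ZMod 3) ε * 3 ^ (n + 2))) {x : V} (hx : Q x = ε) :
    (Nat.card {y : V // Qs y ∈ ({Qs x, Qs x ^ 3, Qs x ^ 9} : Finset K)} : ℤ) =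
      3 * Nat.card {y : V // Qs y ∈ ({Qs x, Qs x ^ 3, Qs x ^ 9} : Finset K) ∧
        Algebra.trace (ZMod 3) K (QuadraticMap.polar Qs x y) = 0} + 2 * ξ * 3 ^ (n + 1) := by
  have hF := ringChar_ne_two_of_algebra K
  have htr : Algebra.trace (ZMod 3) K (Qs x) = ε := by rw [← hQs, hx]
  have htr0 : Algebra.trace (ZMod 3) K (Qs x) ≠ 0 := by rwa [htr]
  have hx0 : Qs x ≠ 0 := fun h => htr0 (by rw [h, map_zero])
  obtain ⟨T, hTp⟩ := exists_hasCount hF ((hQ.of_trace hQs).vperp (Ring.two_ne_zero hF) hx0)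
  have hdim := Module.finrank_mul_finrank (ZMod 3) K V
  rw [hK, hm] at hdim
  have hfr := finrank_vperp (Ring.two_ne_zero hF) hx0
  obtain ⟨j, hj⟩ : Even (Module.finrank K (vperp Qs x)) := by
    by_contra h
    obtain ⟨j, hj⟩ := Nat.not_even_iff_odd.1 h
    lia
  have heven : Even (Module.finrank K (vperp Qs x)) := ⟨j, hj⟩
  have hcardK : (Fintype.card K : ℤ) = 27 := by
    rw [← Nat.card_eq_fintype_card, natCard_cubic hK]; norm_num
  have hTval := hasCount_cubic hK hQs hm hε hT (hTp.of_even hF hx0 heven)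
  rw [hcardK, quadraticChar_cubic hK htr0, htr] at hTval
  have hsq := quadraticChar_sq_one hε
  set χ := quadraticChar (ZMod 3) ε
  have hchar : ∀ c ∈ ({Qs x, Qs x ^ 3, Qs x ^ 9} : Finset K),
      quadraticChar K c = quadraticChar K (Qs x) := by
    have h3 : ∀ z : K, z ≠ 0 → quadraticChar K (z ^ 3) = quadraticChar K z := by
      intro z hz
      rw [pow_succ, map_mul, quadraticChar_sq_one' hz, one_mul]
    intro c hc
    simp only [Finset.mem_insert, Finset.mem_singleton] at hc
    rcases hc with rfl | rfl | rfl
    · rfl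
    · exact h3 _ hx0
    · rw [show Qs x ^ 9 = (Qs x ^ 3) ^ 3 by ring, h3 _ (pow_ne_zero 3 hx0), h3 _ hx0]
  have h1 := card_norm_mem hx0 heven hTp _ hchar
  have h2 := card_trace_perp hx0 heven hTp ({Qs x, Qs x ^ 3, Qs x ^ 9} : Finset K)
  rw [card_conjugate_multipliers hK htr0] at h2
  rw [card_conjugates hK htr0, hcardK] at h1 h2
  have hn : (3 : ℤ) ^ (n + 3) = 27 * 3 ^ n := by ring
  rw [hn] at hTval
  -- The difference of the two counts is -6T when there are four multipliers and 6T when there are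
  -- none. The sign of T changes accordingly, so both cases give the same value.
  have hT1 : (if Algebra.trace (ZMod 3) K (Qs x ^ 2) = 0 then 1 else -1) * T = -(ξ * 3 ^ n) := by
    have h27 : (27 : ℤ) ≠ 0 := by norm_num
    apply mul_left_cancel₀ h27
    linear_combination χ * hTval - (27 * ξ * 3 ^ n +
      27 * (if Algebra.trace (ZMod 3) K (Qs x ^ 2) = 0 then 1 else -1) * T : ℤ) * hsq
  rw [h1, h2]
  push_cast
  split_ifs at hT1 ⊢
  · rw [one_mul] at hT1
    rw [hT1]; ring
  · have : T = ξ * 3 ^ n := by linarith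
    rw [this]; ring

end CubicOrbits

/-! ### Equation (1) with explicit parameters -/

section Equation

/-- The parameters of the rank three graph on the points of type `ξ` in dimension `2 n + 3`. -/
structure PointParams (n : ℕ) (ξ : ℤˣ) (k l mu : ℕ) : Prop where
  two_mul_k : 2 * (k : ℤ) = 3 ^ n * (3 ^ (n + 1) - ξ)
  l_eq : (l : ℤ) = (3 ^ (n + 1) - ξ) * (3 ^ n + ξ)
  two_mul_mu : 2 * (mu : ℤ) = 3 ^ n * (3 ^ n - ξ)

variable {n : ℕ} {ξ : ℤˣ} {k l mu : ℕ}

lemma units_cast_sq (ξ : ℤˣ) : (ξ : ℝ) * ξ = 1 := by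
  rcases Int.units_eq_one_or ξ with rfl | rfl <;> simp

lemma units_cast_cases (ξ : ℤˣ) : (ξ : ℝ) = 1 ∨ (ξ : ℝ) = -1 := by
  rcases Int.units_eq_one_or ξ with rfl | rfl <;> simp

lemma PointParams.real_k (h : PointParams n ξ k l mu) :
    (k : ℝ) = 3 ^ n * (3 * 3 ^ n - ξ) / 2 := by
  have := congrArg (Int.cast : ℤ → ℝ) h.two_mul_k
  push_cast at this
  rw [pow_succ] at this
  linarith

lemma PointParams.real_l (h : PointParams n ξ k l mu) :
    (l : ℝ) = (3 * 3 ^ n - ξ) * (3 ^ n + ξ) := by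
  have := congrArg (Int.cast : ℤ → ℝ) h.l_eq
  push_cast at this
  rw [this, pow_succ]; ring

lemma PointParams.real_mu (h : PointParams n ξ k l mu) :
    (mu : ℝ) = 3 ^ n * (3 ^ n - ξ) / 2 := by
  have := congrArg (Int.cast : ℤ → ℝ) h.two_mul_mu
  push_cast at this
  linarith

lemma PointParams.sqrt_discr (h : PointParams n ξ k l mu) : √(discr k mu mu) = 2 * 3 ^ n := by
  have : discr k mu mu = (2 * 3 ^ n) ^ 2 := by
    rw [discr, h.real_k, h.real_mu]; ring
  rw [this, Real.sqrt_sq (by positivity)]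

lemma PointParams.eigS_eq (h : PointParams n ξ k l mu) : eigS k mu mu = 3 ^ n := by
  rw [eigS, h.sqrt_discr]; ring

lemma PointParams.eigT_eq (h : PointParams n ξ k l mu) : eigT k mu mu = -3 ^ n := by
  rw [eigT, h.sqrt_discr]; ring

lemma three_le_three_pow (hn : 1 ≤ n) : (3 : ℝ) ≤ 3 ^ n := by
  calc (3 : ℝ) = 3 ^ 1 := by norm_num
    _ ≤ 3 ^ n := pow_le_pow_right₀ (by norm_num) hn

/-- As the orbit has d + c + 1 points, the right side says that its length is 3d + ξ3^(n+1). -/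
lemma PointParams.equation_pos_iff (h : PointParams n ξ k l mu) (hn : 1 ≤ n) (d c : ℝ) :
    1 + d * (ξ * 3 ^ n) / k = (ξ * 3 ^ n + 1) * c / l ↔ c = 2 * d + 3 * ξ * 3 ^ n - 1 := by
  rw [h.real_k, h.real_l]
  have hz := units_cast_sq ξ
  have hc := units_cast_cases ξ
  have hp := three_le_three_pow hn
  generalize (ξ : ℝ) = z at *
  generalize (3 : ℝ) ^ n = p at *
  have h1 : 3 * p - z ≠ 0 := by rcases hc with rfl | rfl <;> intro h <;> linarith
  have h2 : p + z ≠ 0 := by rcases hc with rfl | rfl <;> intro h <;> linarith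
  have h3 : p ≠ 0 := by intro h; linarith
  have e1 : (z * p + 1) * c / ((3 * p - z) * (p + z)) = z * c / (3 * p - z) := by
    rw [div_eq_div_iff (mul_ne_zero h1 h2) h1]
    linear_combination (-(3 * p - z) * c) * hz
  rw [e1]
  have e2 : 1 + d * (z * p) / (p * (3 * p - z) / 2) = (3 * p - z + 2 * d * z) / (3 * p - z) := by
    clear e1
    generalize 3 * p - z = w at *
    field_simp
  rw [e2, div_left_inj' h1]
  constructor
  · intro e
    linear_combination (-z) * e - (c - 2 * d + 1) * hz
  · intro e
    rw [e]
    linear_combination (-3 * p) * hz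

/-- For the other eigenvalue only consequences of the equation are needed, in order to refute it. -/
lemma PointParams.equation_neg (h : PointParams n ξ k l mu) (hn : 1 ≤ n) {d c : ℝ}
    (he : 1 + d * -(ξ * 3 ^ n) / k = (-(ξ * 3 ^ n) + 1) * c / l) :
    (3 * 3 ^ n - ξ - 2 * d * ξ) * (3 ^ n + ξ) = -ξ * (3 ^ n - ξ) * c := by
  rw [h.real_k, h.real_l] at he
  have hz := units_cast_sq ξ
  have hc := units_cast_cases ξ
  have hp := three_le_three_pow hn
  generalize (ξ : ℝ) = z at *
  generalize (3 : ℝ) ^ n = p at *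
  have h1 : 3 * p - z ≠ 0 := by rcases hc with rfl | rfl <;> intro h <;> linarith
  have h2 : p + z ≠ 0 := by rcases hc with rfl | rfl <;> intro h <;> linarith
  have h3 : p ≠ 0 := by intro h; linarith
  have e2 : 1 + d * -(z * p) / (p * (3 * p - z) / 2) = (3 * p - z - 2 * d * z) / (3 * p - z) := by
    clear he
    generalize 3 * p - z = w at *
    field_simp
    ring
  rw [e2, div_eq_div_iff h1 (mul_ne_zero h1 h2)] at he
  have := mul_left_cancel₀ h1 (show (3 * p - z) * ((3 * p - z - 2 * d * z) * (p + z)) =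
    (3 * p - z) * ((-(z * p) + 1) * c) by linear_combination he)
  rw [this]
  linear_combination (-c) * hz

end Equation

/-! ### Orbits as sets of points of given norms -/

section OrbitPoints

variable {V : Type*} [AddCommGroup V] [Module (ZMod 3) V] [Finite V]
  {Q : QuadraticForm (ZMod 3) V} {ξ : ℤˣ} {ε : ZMod 3}

omit [Finite V] in
lemma Delta_eq (hE : ∀ x, x ∈ nonsingPoints Q ξ ↔ Q x.rep = ε) (x : ℙ (ZMod 3) V) :
    Delta Q ξ x = {y : ℙ (ZMod 3) V | QuadraticMap.polar Q x.rep y.rep = 0 ∧ Q y.rep = ε} := by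
  ext y
  simp only [Delta, Set.mem_ofPred_eq, hE, submodule_le_perp_iff, and_comm]

omit [Finite V] in
lemma notMem_Delta_self (hε : ε ≠ 0) (hE : ∀ x, x ∈ nonsingPoints Q ξ ↔ Q x.rep = ε)
    {x : ℙ (ZMod 3) V} (hx : x ∈ nonsingPoints Q ξ) : x ∉ Delta Q ξ x := by
  intro h
  rw [Delta_eq hE] at h
  rw [hE] at hx
  have h1 := h.1
  rw [polar_self', hx] at h1
  exact hε ((mul_eq_zero.1 h1).resolve_left two_ne_zero_zmod)

lemma ncard_eq_add_one (hε : ε ≠ 0) (hE : ∀ x, x ∈ nonsingPoints Q ξ ↔ Q x.rep = ε)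
    {x : ℙ (ZMod 3) V} {O : Set (ℙ (ZMod 3) V)} (hO : O ⊆ nonsingPoints Q ξ) (hx : x ∈ O) :
    O.ncard = (O ∩ Delta Q ξ x).ncard + (O ∩ Gamma Q ξ x).ncard + 1 := by
  have hfin : Finite (ℙ (ZMod 3) V) := Quotient.finite _
  have hself := notMem_Delta_self hε hE (hO hx)
  have h1 : O = insert x (O ∩ Delta Q ξ x ∪ O ∩ Gamma Q ξ x) := by
    ext y
    simp only [Set.mem_insert_iff, Set.mem_union, Set.mem_inter_iff, Delta, Gamma,
      Set.mem_ofPred_eq]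
    constructor
    · intro hy
      have := hO hy
      tauto
    · rintro (rfl | h | h)
      · exact hx
      · exact h.1
      · exact h.1
  conv_lhs => rw [h1]
  rw [Set.ncard_insert_of_notMem, Set.ncard_union_eq]
  · rw [Set.disjoint_left]
    rintro y hy hy'
    exact hy'.2.2.2 hy.2.2
  · rintro (h | h)
    · exact hself h.2
    · exact h.2.2.1 rfl

variable {K : Type*} [Field K] [Algebra (ZMod 3) K] [Module K V]
  {Qs : QuadraticForm K V}
  {G : Subgroup (V ≃ₗ[ZMod 3] V)}

omit [Finite V] in
lemma orbit_subset_nonsingPoints [Finite K] (hQs : ∀ v, Q v = Algebra.trace (ZMod 3) K (Qs v))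
    (hGI : G ≤ isometryGroup Q) (hE : ∀ x, x ∈ nonsingPoints Q ξ ↔ Q x.rep = ε)
    {x : ℙ (ZMod 3) V} (hx : x ∈ nonsingPoints Q ξ) :
    MulAction.orbit (fieldExtSubgroup K G) x ⊆ nonsingPoints Q ξ := by
  intro y hy
  obtain ⟨σ, hσ⟩ := exists_norm_eq_of_mem_orbit hQs hGI hy
  rw [hE] at hx ⊢
  rw [hQs, hσ, trace_ringEquiv, ← hQs, hx]

omit [Algebra (ZMod 3) K] in
lemma two_mul_ncard_norm [DecidableEq K] (C : Finset K) (hC : (0 : K) ∉ C) :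
    2 * {y : ℙ (ZMod 3) V | Qs y.rep ∈ C}.ncard = Nat.card {y : V // Qs y ∈ C} :=
  two_mul_ncard_points (p := fun v => Qs v ∈ C) (fun v => by rw [QuadraticMap.map_neg])
    (fun h => hC (by rwa [QuadraticMap.map_zero] at h))

lemma two_mul_ncard_norm_Delta [DecidableEq K]
    (hQs : ∀ v, Q v = Algebra.trace (ZMod 3) K (Qs v))
    (hE : ∀ x, x ∈ nonsingPoints Q ξ ↔ Q x.rep = ε) (C : Finset K) (hC : (0 : K) ∉ C)
    (hCε : ∀ c ∈ C, Algebra.trace (ZMod 3) K c = ε) (x : ℙ (ZMod 3) V) :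
    2 * ({y : ℙ (ZMod 3) V | Qs y.rep ∈ C} ∩ Delta Q ξ x).ncard =
      Nat.card {y : V // Qs y ∈ C ∧
        Algebra.trace (ZMod 3) K (QuadraticMap.polar Qs x.rep y) = 0} := by
  rw [← two_mul_ncard_points (p := fun v => Qs v ∈ C ∧
    Algebra.trace (ZMod 3) K (QuadraticMap.polar Qs x.rep v) = 0)]
  · congr 2
    ext y
    rw [Delta_eq hE]
    simp only [Set.mem_inter_iff, Set.mem_ofPred_eq, polar_eq_trace hQs]
    constructor
    · rintro ⟨h1, h2, -⟩
      exact ⟨h1, h2⟩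
    · rintro ⟨h1, h2⟩
      exact ⟨h1, h2, by rw [hQs, hCε _ h1]⟩
  · intro v
    rw [QuadraticMap.map_neg, QuadraticMap.polar_neg_right, map_neg, neg_eq_zero]
  · rintro ⟨h, -⟩
    exact hC (by rwa [QuadraticMap.map_zero] at h)

variable [IsScalarTower (ZMod 3) K V]

section Cubic

variable (hK : Module.finrank (ZMod 3) K = 3)
  (hQs : ∀ v, Q v = Algebra.trace (ZMod 3) K (Qs v)) (hQ : Nondeg Q)
  (hΩG : Omega Q ≤ G) (hGI : G ≤ isometryGroup Q)
  (hd : 3 ≤ Module.finrank K V)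

include hK hQs hQ hΩG hGI hd

/-- Traces are invariant under field automorphisms. Conversely, equal traces of the norm and of its
square give conjugate norms, and conjugate norms give one orbit. -/
lemma mem_orbit_iff_cubic {x y : ℙ (ZMod 3) V} (hx : Q x.rep ≠ 0) :
    y ∈ MulAction.orbit (fieldExtSubgroup K G) x ↔ Q y.rep = Q x.rep ∧
      Algebra.trace (ZMod 3) K (Qs y.rep ^ 2) = Algebra.trace (ZMod 3) K (Qs x.rep ^ 2) := by
  have := finite_cubic hK
  have h0 : ∀ v, Q v ≠ 0 → Qs v ≠ 0 := fun v hv h => hv (by rw [hQs, h, map_zero])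
  constructor
  · intro h
    obtain ⟨σ, hσ⟩ := exists_norm_eq_of_mem_orbit hQs hGI h
    rw [hQs, hQs, hσ, trace_ringEquiv, ← map_pow, trace_ringEquiv]
    exact ⟨rfl, rfl⟩
  · rintro ⟨h1, h2⟩
    have hy : Q y.rep ≠ 0 := by rwa [h1]
    rw [hQs, hQs x.rep] at h1
    rcases conj_of_trace_sq_eq hK (by rwa [← hQs]) h1 h2 with h | h | h
    · exact mem_orbit_of_norm_eq hQs hQ hΩG hd h.symm (h0 _ hx)
    · exact mem_orbit_of_norm_eq_pow hQs hQ hΩG hd (pow_card_cubic hK) h.symm (h0 _ hx)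
    · rw [MulAction.mem_orbit_symm]
      refine mem_orbit_of_norm_eq_pow hQs hQ hΩG hd (pow_card_cubic hK) ?_ (h0 _ hy)
      rw [h]
      calc (Qs x.rep ^ 9) ^ 3 = Qs x.rep ^ 27 := by ring
        _ = _ := pow_card_cubic hK _

lemma orbit_eq_conjugates [DecidableEq K] {x : ℙ (ZMod 3) V} (hx : Q x.rep ≠ 0) :
    MulAction.orbit (fieldExtSubgroup K G) x =
      {y | Qs y.rep ∈ ({Qs x.rep, Qs x.rep ^ 3, Qs x.rep ^ 9} : Finset K)} := by
  have := finite_cubic hK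
  have hcube := trace_cube (K := K)
  ext y
  rw [mem_orbit_iff_cubic hK hQs hQ hΩG hGI hd hx, Set.mem_ofPred_eq]
  simp only [Finset.mem_insert, Finset.mem_singleton]
  constructor
  · rintro ⟨h1, h2⟩
    rw [hQs, hQs x.rep] at h1
    exact conj_of_trace_sq_eq hK (by rwa [← hQs]) h1 h2
  · rw [hQs, hQs x.rep]
    rintro (h | h | h)
    · rw [h]; exact ⟨rfl, rfl⟩
    · rw [h]
      refine ⟨hcube _, ?_⟩
      rw [← hcube (Qs x.rep ^ 2)]; ring_nf
    · rw [h]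
      constructor
      · rw [← hcube (Qs x.rep), ← hcube (Qs x.rep ^ 3)]; ring_nf
      · rw [← hcube (Qs x.rep ^ 2), ← hcube ((Qs x.rep ^ 2) ^ 3)]; ring_nf

/-- The orbit lengths in the cubic case. -/
theorem ncard_orbit_cubic {n : ℕ} (hm : Module.finrank (ZMod 3) V = 2 * (n + 1) + 1)
    (hε : ε ≠ 0) (hT : HasCount Q (ξ * quadraticChar (ZMod 3) ε * 3 ^ (n + 2)))
    (hE : ∀ x, x ∈ nonsingPoints Q ξ ↔ Q x.rep = ε)
    {x : ℙ (ZMod 3) V} (hx : x ∈ nonsingPoints Q ξ) :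
    ((MulAction.orbit (fieldExtSubgroup K G) x).ncard : ℤ) =
      3 * (MulAction.orbit (fieldExtSubgroup K G) x ∩ Delta Q ξ x).ncard + ξ * 3 ^ (n + 1) := by
  classical
  have := finite_cubic hK
  have := Fintype.ofFinite K
  have hxε := (hE x).1 hx
  have hx0 : Q x.rep ≠ 0 := by rwa [hxε]
  have h := card_conjugate_norms hK hQs hQ hm hε hT hxε
  have hO := orbit_eq_conjugates hK hQs hQ hΩG hGI hd hx0
  have hC0 : (0 : K) ∉ ({Qs x.rep, Qs x.rep ^ 3, Qs x.rep ^ 9} : Finset K) := by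
    have ha : Qs x.rep ≠ 0 := fun h => hx0 (by rw [hQs, h, map_zero])
    simp only [Finset.mem_insert, Finset.mem_singleton, not_or]
    exact ⟨ha.symm, (pow_ne_zero 3 ha).symm, (pow_ne_zero 9 ha).symm⟩
  have hCε : ∀ c ∈ ({Qs x.rep, Qs x.rep ^ 3, Qs x.rep ^ 9} : Finset K),
      Algebra.trace (ZMod 3) K c = ε := by
    have hcube := trace_cube (K := K)
    intro c hc
    simp only [Finset.mem_insert, Finset.mem_singleton] at hc
    rw [← hxε, hQs]
    rcases hc with rfl | rfl | rfl
    · rfl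
    · exact hcube _
    · rw [show Qs x.rep ^ 9 = (Qs x.rep ^ 3) ^ 3 by ring, hcube, hcube]
  rw [hO]
  have h1 := two_mul_ncard_norm (V := V) (Qs := Qs) _ hC0
  have h2 := two_mul_ncard_norm_Delta hQs hE _ hC0 hCε x
  rw [← h1, ← h2] at h
  push_cast at h
  linarith

/-- There are exactly three orbits in the cubic case. -/
theorem ncard_orbits_cubic (hε : ε ≠ 0) (hE : ∀ x, x ∈ nonsingPoints Q ξ ↔ Q x.rep = ε) :
    ((fun x => MulAction.orbit (fieldExtSubgroup K G) x) '' nonsingPoints Q ξ).ncard = 3 := by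
  have := finite_cubic hK
  have := Fintype.ofFinite K
  let f : ZMod 3 → Set (ℙ (ZMod 3) V) := fun t =>
    {y | Q y.rep = ε ∧ Algebra.trace (ZMod 3) K (Qs y.rep ^ 2) = t}
  have horb : ∀ x ∈ nonsingPoints Q ξ, MulAction.orbit (fieldExtSubgroup K G) x =
      f (Algebra.trace (ZMod 3) K (Qs x.rep ^ 2)) := by
    intro x hx
    rw [hE] at hx
    ext y
    rw [mem_orbit_iff_cubic hK hQs hQ hΩG hGI hd (by rwa [hx]), hx]
    rfl
  -- Starting from any a of trace ε, a shift by s in F_3 gives the trace of the square any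
  -- prescribed value.
  have hex : ∀ t, ∃ x ∈ nonsingPoints Q ξ, Algebra.trace (ZMod 3) K (Qs x.rep ^ 2) = t := by
    intro t
    obtain ⟨a, ha⟩ : ∃ a : K, Algebra.trace (ZMod 3) K a = ε :=
      Algebra.trace_surjective (ZMod 3) K ε
    obtain ⟨s, hs⟩ : ∃ s : ZMod 3, Algebra.trace (ZMod 3) K (a ^ 2) + 2 * s * ε = t := by
      generalize Algebra.trace (ZMod 3) K (a ^ 2) = u
      clear * - hε
      revert ε u t; decide
    set a' := a + algebraMap (ZMod 3) K s with ha'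
    have h1 : Algebra.trace (ZMod 3) K a' = ε := by
      rw [ha', map_add, trace_algebraMap_cubic hK, ha, add_zero]
    have h2 : Algebra.trace (ZMod 3) K (a' ^ 2) = t := by
      rw [ha', show (a + algebraMap (ZMod 3) K s) ^ 2 = a ^ 2 + algebraMap (ZMod 3) K (2 * s) * a +
        algebraMap (ZMod 3) K (s * s) by simp only [map_mul, map_ofNat]; ring, map_add, map_add,
        trace_algebraMap_mul, trace_algebraMap_cubic hK, ha, add_zero, hs]
    have h0 : a' ≠ 0 := by
      intro h
      rw [h, map_zero] at h1
      exact hε h1.symm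
    obtain ⟨v, hv⟩ := exists_norm_eq (ringChar_ne_two_of_algebra K) (hQ.of_trace hQs)
      (by lia) h0
    have hv0 : v ≠ 0 := by
      rintro rfl
      rw [QuadraticMap.map_zero] at hv
      exact h0 hv.symm
    have hrep : Qs (Projectivization.mk (ZMod 3) v hv0).rep = a' := by
      rcases rep_mk v hv0 with h | h
      · rw [h, hv]
      · rw [h, QuadraticMap.map_neg, hv]
    exact ⟨Projectivization.mk (ZMod 3) v hv0, by rw [hE, hQs, hrep, h1], by rw [hrep, h2]⟩
  have hinj : Function.Injective f := by
    intro t t' h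
    obtain ⟨x, hx, rfl⟩ := hex t
    have : x ∈ f t' := by rw [← h]; exact ⟨(hE x).1 hx, rfl⟩
    exact this.2
  have himage : (fun x => MulAction.orbit (fieldExtSubgroup K G) x) '' nonsingPoints Q ξ =
      Set.range f := by
    ext S
    constructor
    · rintro ⟨x, hx, rfl⟩
      exact ⟨_, (horb x hx).symm⟩
    · rintro ⟨t, rfl⟩
      obtain ⟨x, hx, rfl⟩ := hex t
      exact ⟨x, hx, horb x hx⟩
  rw [himage, ← Set.image_univ, Set.ncard_image_of_injective _ hinj, Set.ncard_univ, Nat.card_zmod]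

end Cubic

end OrbitPoints

/-! ### Arithmetic obstructions to equation (1) -/

section Equation

variable {n : ℕ} {ξ : ℤˣ} {k l mu : ℕ}

lemma PointParams.eig_cases (h : PointParams n ξ k l mu) {r : ℝ}
    (hr : r = eigS k mu mu ∨ r = eigT k mu mu) : r = ξ * 3 ^ n ∨ r = -(ξ * 3 ^ n) := by
  rw [h.eigS_eq, h.eigT_eq] at hr
  rcases units_cast_cases ξ with h | h <;> rw [h] <;> simpa [or_comm] using hr

/-- The equation fails for an orbit of size `(T ^ 2 + T) / 2` with `(T ^ 2 - T) / 6` points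
in `x^⊥`. -/
lemma PointParams.equation_false_of_quadratic (h : PointParams n ξ k l mu) (hn : 1 ≤ n) {T : ℤ}
    (hT3 : 3 ∣ T) (hT : T ^ 2 ≠ 3 ^ (2 * (n + 1))) {o d c : ℕ} (ho : 2 * (o : ℤ) = T ^ 2 + T)
    (hd : 6 * (d : ℤ) = T ^ 2 - T) (hc : o = d + c + 1) {r : ℝ}
    (hr : r = eigS k mu mu ∨ r = eigT k mu mu) :
    ¬ (1 + (d : ℝ) * r / k = (r + 1) * c / l) := by
  have hz : (ξ : ℤ) * ξ = 1 := by rcases Int.units_eq_one_or ξ with rfl | rfl <;> simp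
  have hne : (3 * 3 ^ n : ℤ) - ξ * T ≠ 0 := by
    intro e
    apply hT
    rw [mul_comm 2, pow_mul, pow_succ]
    linear_combination (-(T * (ξ * ξ + 1))) * T * hz + T ^ 2 * (ξ * ξ) * hz -
      (ξ * T + 3 * 3 ^ n) * e
  have hc' : 3 * (c : ℤ) = T ^ 2 + 2 * T - 3 := by
    have : (o : ℤ) = d + c + 1 := by exact_mod_cast hc
    linarith
  intro he
  rcases h.eig_cases hr with rfl | rfl
  · rw [h.equation_pos_iff hn] at he
    have he' : (c : ℤ) = 2 * d + 3 * ξ * 3 ^ n - 1 := by exact_mod_cast he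
    apply hne
    -- For r = ξ3^n the quadratic terms cancel and T is forced to the value excluded by the
    -- hypothesis on T².
    have hTz : T = 3 * (ξ * 3 ^ n) := by
      rw [mul_assoc] at he'
      linarith
    rw [hTz]
    linear_combination (-3 * 3 ^ n) * hz
  · have he := h.equation_neg hn he
    have he' : (3 * 3 ^ n - (ξ : ℤ) - 2 * d * ξ) * (3 ^ n + ξ) = -ξ * (3 ^ n - ξ) * c := by
      exact_mod_cast he
    -- For r = -ξ3^n the equation factors. The first factor is nonzero as before, and the second is
    -- congruent to ξ modulo 3.
    have hprod : ((3 * 3 ^ n : ℤ) - ξ * T) * (3 * 3 ^ n + 2 * ξ * T + ξ) = 0 := by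
      generalize (3 : ℤ) ^ n = p at *
      rcases Int.units_eq_one_or ξ with rfl | rfl
      · simp only [Units.val_one] at he' ⊢
        linear_combination 3 * he' + (p + 1) * hd - (p - 1) * hc'
      · simp only [Units.val_neg, Units.val_one] at he' ⊢
        linear_combination 3 * he' - (p - 1) * hd + (p + 1) * hc'
    have h2 := (mul_eq_zero.1 hprod).resolve_left hne
    obtain ⟨t, rfl⟩ := hT3
    rcases Int.units_eq_one_or ξ with rfl | rfl
    · simp only [Units.val_one] at h2; lia
    · simp only [Units.val_neg, Units.val_one] at h2; lia

/-- The equation fails for small orbits, with one possible exception. -/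
lemma PointParams.equation_false_of_small (h : PointParams n ξ k l mu) (hn : 1 ≤ n)
    {d c : ℕ} (hc : d + c ≤ 2 * n + 2) (hd : n = 1 → d ≤ 3) {r : ℝ}
    (hr : r = eigS k mu mu ∨ r = eigT k mu mu) :
    ¬ (1 + (d : ℝ) * r / k = (r + 1) * c / l) := by
  have hp : 3 * (3 ^ n : ℤ) ≥ 4 * n + 5 ∧ (3 ≤ (3 ^ n : ℤ)) ∧
      (2 ≤ n → 3 * (3 ^ n : ℤ) ≥ 4 * n + 6) ∧ (n = 1 → (3 ^ n : ℤ) = 3) := by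
    clear hd hr hc h
    induction n, hn using Nat.le_induction with
    | base => norm_num
    | succ k hk ih =>
      rw [pow_succ]
      push_cast
      lia
  intro he
  rcases h.eig_cases hr with rfl | rfl
  · rw [h.equation_pos_iff hn] at he
    have he' : (c : ℤ) = 2 * d + 3 * ξ * 3 ^ n - 1 := by exact_mod_cast he
    rcases Int.units_eq_one_or ξ with rfl | rfl
    · simp only [Units.val_one] at he'; lia
    · simp only [Units.val_neg, Units.val_one] at he'; lia
  · have he := h.equation_neg hn he
    have he' : (3 * 3 ^ n - (ξ : ℤ) - 2 * d * ξ) * (3 ^ n + ξ) = -ξ * (3 ^ n - ξ) * c := by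
      exact_mod_cast he
    generalize (3 : ℤ) ^ n = p at *
    obtain ⟨h1, h2, h3, h4⟩ := hp
    have hc0 : (0 : ℤ) ≤ c := by positivity
    have hc1 : (d : ℤ) + c ≤ 2 * n + 2 := by exact_mod_cast hc
    rcases Int.units_eq_one_or ξ with rfl | rfl
    · simp only [Units.val_one] at he'
      have h5 : 3 * p - 1 - 2 * d ≤ 0 := by
        by_contra! h6
        nlinarith
      -- The numerical exception is n = 1, ξ = +, d = 4, c = 0, which does solve the equation; the
      -- bound d ≤ 3 removes it.
      rcases Nat.lt_or_ge 1 n with h6 | h6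
      · have := h3 h6; lia
      · have h7 : n = 1 := by lia
        have := hd h7; have := h4 h7; lia
    · simp only [Units.val_neg, Units.val_one] at he'
      have : (3 * p + 1) * (p - 1) ≤ (p + 1) * c := by
        nlinarith
      nlinarith

end Equation

/-! ### The case α ≠ 3 with dim V_♯ at least 3 -/

section Fields

variable {V : Type*} [AddCommGroup V] [Module (ZMod 3) V] [Finite V]
  {Q : QuadraticForm (ZMod 3) V} {ξ : ℤˣ} {ε : ZMod 3}
  {K : Type*} [Field K] [Finite K] [Algebra (ZMod 3) K] [Module K V] [IsScalarTower (ZMod 3) K V]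
  {Qs : QuadraticForm K V} {G : Subgroup (V ≃ₗ[ZMod 3] V)} {n k l mu : ℕ}

theorem exists_not_orbitEquation_of_three_le (hα : (Module.finrank (ZMod 3) K).Prime)
    (hα3 : Module.finrank (ZMod 3) K ≠ 3) (hm : Module.finrank (ZMod 3) V = 2 * (n + 1) + 1)
    (hn : 1 ≤ n) (hQs : ∀ v, Q v = Algebra.trace (ZMod 3) K (Qs v)) (hQ : Nondeg Q)
    (hΩG : Omega Q ≤ G) (hGI : G ≤ isometryGroup Q) (hd : 3 ≤ Module.finrank K V)
    (hε : ε ≠ 0) (hE : ∀ x, x ∈ nonsingPoints Q ξ ↔ Q x.rep = ε) (hP : PointParams n ξ k l mu) :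
    ∃ x ∈ nonsingPoints Q ξ, ∀ r : ℝ, (r = eigS k mu mu ∨ r = eigT k mu mu) →
      ¬ OrbitEquation (M := fieldExtSubgroup K G) (Delta Q ξ) (Gamma Q ξ) k l r x := by
  classical
  have := Fintype.ofFinite K
  have hF := ringChar_ne_two_of_algebra K
  have h2 := Ring.two_ne_zero hF
  have hαe := Module.finrank_mul_finrank (ZMod 3) K V
  have hα0 : ((Module.finrank (ZMod 3) K : ℕ) : ZMod 3) ≠ 0 := by
    rw [Ne, ZMod.natCast_eq_zero_iff]
    intro h
    exact hα3 ((Nat.prime_dvd_prime_iff_eq Nat.prime_three hα).1 h).symm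
  -- On F_3 the trace is multiplication by α, which is invertible when α ≠ 3. A norm in F_3 is fixed
  -- by all automorphisms, so its orbit is a single norm class.
  obtain ⟨s, hs⟩ : ∃ s : ZMod 3, Module.finrank (ZMod 3) K • s = ε :=
    ⟨(Module.finrank (ZMod 3) K : ZMod 3)⁻¹ * ε, by
      rw [nsmul_eq_mul, mul_inv_cancel_left₀ hα0]⟩
  set a := algebraMap (ZMod 3) K s with ha
  have htr : Algebra.trace (ZMod 3) K a = ε := by rw [ha, Algebra.trace_algebraMap, hs]
  have ha0 : a ≠ 0 := by rintro h; rw [h, map_zero] at htr; exact hε htr.symm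
  obtain ⟨v, hv⟩ := exists_norm_eq hF (hQ.of_trace hQs) (by lia) ha0
  have hv0 : v ≠ 0 := by rintro rfl; rw [QuadraticMap.map_zero] at hv; exact ha0 hv.symm
  set x := Projectivization.mk (ZMod 3) v hv0 with hxdef
  have hx : Qs x.rep = a := by
    rcases rep_mk v hv0 with h | h
    · rw [h, hv]
    · rw [h, QuadraticMap.map_neg, hv]
  have hx0 : Qs x.rep ≠ 0 := by rwa [hx]
  have hxE : x ∈ nonsingPoints Q ξ := by rw [hE, hQs, hx, htr]
  refine ⟨x, hxE, fun r hr => ?_⟩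
  have hO : MulAction.orbit (fieldExtSubgroup K G) x =
      {y : ℙ (ZMod 3) V | Qs y.rep ∈ ({a} : Finset K)} := by
    ext y
    rw [Set.mem_ofPred_eq, Finset.mem_singleton]
    constructor
    · intro h
      obtain ⟨σ, hσ⟩ := exists_norm_eq_of_mem_orbit hQs hGI h
      rw [hσ, hx, ha]
      exact RingHom.congr_fun (Subsingleton.elim ((σ : K →+* K).comp (algebraMap (ZMod 3) K))
        (algebraMap (ZMod 3) K)) s
    · intro h
      exact mem_orbit_of_norm_eq hQs hQ hΩG hd (hx.trans h.symm) hx0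
  have hfr := finrank_vperp h2 hx0
  have hodd : Odd (Module.finrank K V) := by
    have : Odd (Module.finrank (ZMod 3) K * Module.finrank K V) := by rw [hαe, hm]; exact ⟨_, rfl⟩
    exact (Nat.odd_mul.1 this).2
  obtain ⟨j, hj⟩ := hodd
  have hdim : Module.finrank K (vperp Qs x.rep) = 2 * j := by lia
  obtain ⟨T, hT⟩ := exists_hasCount hF ((hQ.of_trace hQs).vperp h2 hx0)
  have hTsq : T ^ 2 = (Fintype.card K : ℤ) ^ (2 * j) := by
    rw [hT.sq_eq, hdim]; congr 1; lia
  have hcardK : (Fintype.card K : ℤ) = 3 ^ Module.finrank (ZMod 3) K := by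
    rw [← Nat.card_eq_fintype_card, Module.natCard_eq_pow_finrank (K := ZMod 3), Nat.card_zmod]
    norm_num
  have hC0 : (0 : K) ∉ ({a} : Finset K) := by simpa using ha0.symm
  have hev : Even (Module.finrank K (vperp Qs x.rep)) := ⟨j, by lia⟩
  have h3 := card_trace_perp hx0 hev hT {a}
  have h4 := card_norm_mem hx0 hev hT {a} (by simp [hx])
  rw [← two_mul_ncard_norm _ hC0, ← hO, hdim, ← hTsq] at h4
  rw [← two_mul_ncard_norm_Delta hQs hE _ hC0 (by simp [htr]), ← hO, hdim, ← hTsq,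
    Finset.filter_false_of_mem] at h3
  · refine hP.equation_false_of_quadratic hn (T := T) ?_ ?_ ?_ ?_
      (ncard_eq_add_one hε hE (orbit_subset_nonsingPoints hQs hGI hE hxE) (MulAction.mem_orbit_self x)) hr
    · refine Int.prime_three.dvd_of_dvd_pow (n := 2) ?_
      rw [hTsq, hcardK, ← pow_mul]
      refine dvd_pow_self _ (mul_ne_zero hα.ne_zero (by lia))
    · rw [hTsq, hcardK, ← pow_mul]
      -- Here α · 2j = 2n + 3 - α, which equals 2n + 2 only for α = 1.
      intro h
      have := Int.pow_right_injective (a := 3) (by norm_num) h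
      have hα2 := hα.two_le
      rw [hj, hm] at hαe
      have : Module.finrank (ZMod 3) K * (2 * j) + Module.finrank (ZMod 3) K =
        2 * (n + 1) + 1 := by rw [← hαe]; ring
      lia
    · push_cast at h4
      simpa using h4
    · push_cast at h3
      simp at h3
      linarith
  -- No multiplier contributes: b² = 1 gives b = ±1, and then the trace of ab is ±ε.
  · intro b _
    rw [Finset.mem_singleton, hx]
    rintro ⟨h5, h6⟩
    have h7 : (b - 1) * (b + 1) = 0 := mul_right_cancel₀ ha0 (by linear_combination h6)
    rcases mul_eq_zero.1 h7 with h | h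
    · rw [sub_eq_zero.1 h, mul_one, htr] at h5
      exact hε h5
    · rw [eq_neg_of_add_eq_zero_left h, mul_neg_one, map_neg, htr, neg_eq_zero] at h5
      exact hε h5

end Fields

/-! ### The field with 243 elements -/

section DimensionFive

variable {K : Type*} [Field K] [Algebra (ZMod 3) K]

lemma natCard_eq_three_pow [Finite K] : Nat.card K = 3 ^ Module.finrank (ZMod 3) K := by
  rw [Module.natCard_eq_pow_finrank (K := ZMod 3), Nat.card_zmod]

lemma exists_pow_eq_of_ringEquiv [Finite K] (σ : K ≃+* K) :
    ∃ i < Module.finrank (ZMod 3) K, ∀ a, σ a = a ^ 3 ^ i := by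
  let σ' : K ≃ₐ[ZMod 3] K := AlgEquiv.ofRingEquiv (f := σ) fun r =>
    RingHom.congr_fun (Subsingleton.elim ((σ : K →+* K).comp (algebraMap (ZMod 3) K))
      (algebraMap (ZMod 3) K)) r
  obtain ⟨i, hi⟩ := (FiniteField.bijective_frobeniusAlgEquivOfAlgebraic_pow (ZMod 3) K).2 σ'
  refine ⟨i, i.2, fun a => ?_⟩
  have : σ' a = σ a := rfl
  rw [← this, ← hi]
  simp [AlgEquiv.coe_pow, FiniteField.coe_frobeniusAlgEquivOfAlgebraic_iterate]

/-- A root of unity of order eleven in the field with `243` elements with vanishing trace. -/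
lemma exists_trace_pow_eq [Finite K] (hK : Module.finrank (ZMod 3) K = 5) :
    ∃ z : K, Algebra.trace (ZMod 3) K z = 0 ∧ Algebra.trace (ZMod 3) K (z ^ 2) = -1 ∧
      Algebra.trace (ZMod 3) K (z ^ 4) = 0 := by
  have := Fintype.ofFinite K
  obtain ⟨g, hg⟩ := IsCyclic.exists_generator (α := Kˣ)
  have hord : orderOf g = 242 := by
    rw [orderOf_eq_card_of_forall_mem_zpowers hg, Nat.card_units, natCard_eq_three_pow, hK]
    rfl
  obtain ⟨z, hz, hz1⟩ : ∃ z : K, z ^ 11 = 1 ∧ z ≠ 1 := by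
    refine ⟨((g ^ 22 : Kˣ) : K), ?_, ?_⟩
    · rw [← Units.val_pow_eq_pow_val, ← pow_mul, show 22 * 11 = orderOf g from hord.symm,
        pow_orderOf_eq_one, Units.val_one]
    · rw [Ne, Units.val_eq_one]
      intro h
      have := orderOf_dvd_of_pow_eq_one h
      rw [hord] at this
      omega
  have hsum : 1 + z + z ^ 2 + z ^ 3 + z ^ 4 + z ^ 5 + z ^ 6 + z ^ 7 + z ^ 8 + z ^ 9 + z ^ 10 = 0 :=
    mul_left_cancel₀ (sub_ne_zero.2 hz1) (by linear_combination hz)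
  have htr : ∀ a : K, algebraMap (ZMod 3) K (Algebra.trace (ZMod 3) K a) =
      a + a ^ 3 + a ^ 9 + a ^ 27 + a ^ 81 := by
    intro a
    rw [FiniteField.algebraMap_trace_eq_sum_pow, hK, Nat.card_zmod]
    simp [Finset.sum_range_succ]
  have hred : ∀ i, z ^ (i + 11) = z ^ i := fun i => by rw [pow_add, hz, mul_one]
  -- The powers of 3 modulo 11 are the five nonzero squares. So the traces of z and z² are the two
  -- Gaussian periods, over squares and nonsquares.
  have h1 : algebraMap (ZMod 3) K (Algebra.trace (ZMod 3) K z) =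
      z + z ^ 3 + z ^ 9 + z ^ 5 + z ^ 4 := by
    rw [htr]
    simp only [hred]
  have h2 : algebraMap (ZMod 3) K (Algebra.trace (ZMod 3) K (z ^ 2)) =
      z ^ 2 + z ^ 6 + z ^ 7 + z ^ 10 + z ^ 8 := by
    rw [htr]
    simp only [← pow_mul]
    simp only [Nat.reduceMul, hred]
  have h4 : Algebra.trace (ZMod 3) K (z ^ 4) = Algebra.trace (ZMod 3) K z := by
    apply (algebraMap (ZMod 3) K).injective
    rw [h1, htr]
    simp only [← pow_mul]
    simp only [Nat.reduceMul, hred]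
    ring
  have h8 : Algebra.trace (ZMod 3) K (z ^ 8) = Algebra.trace (ZMod 3) K (z ^ 2) := by
    apply (algebraMap (ZMod 3) K).injective
    rw [h2, htr]
    simp only [← pow_mul]
    simp only [Nat.reduceMul, hred]
    ring
  have h3 := three_eq_zero_of_algebra K
  have hadd : Algebra.trace (ZMod 3) K z + Algebra.trace (ZMod 3) K (z ^ 2) = -1 := by
    apply (algebraMap (ZMod 3) K).injective
    rw [map_add, h1, h2, map_neg, map_one]
    linear_combination hsum
  -- As -1 is a nonsquare modulo 11, the product of the periods is 5 plus twice the sum of all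
  -- nontrivial powers, which is 3 = 0. The polynomial coefficient reduces exponents modulo 11.
  have hmul : Algebra.trace (ZMod 3) K z * Algebra.trace (ZMod 3) K (z ^ 2) = 0 := by
    apply (algebraMap (ZMod 3) K).injective
    rw [map_mul, h1, h2, map_zero]
    linear_combination (5 * z ^ 0 + 2 * z ^ 1 + 2 * z ^ 2 + 1 * z ^ 3 + 2 * z ^ 4 + 1 * z ^ 5 + 1 * z ^ 6 + 1 * z ^ 8) * hz +
      2 * hsum + h3
  rcases mul_eq_zero.1 hmul with h | h
  · exact ⟨z, h, by simpa [h] using hadd, by rw [h4, h]⟩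
  · refine ⟨z ^ 2, h, ?_, ?_⟩
    · rw [← pow_mul, h4]; simpa [h] using hadd
    · rw [← pow_mul, h8, h]

lemma trace_algebraMap_quintic [Finite K] (hK : Module.finrank (ZMod 3) K = 5) (s : ZMod 3) :
    Algebra.trace (ZMod 3) K (algebraMap (ZMod 3) K s) = -s := by
  rw [Algebra.trace_algebraMap, hK, nsmul_eq_mul, show ((5 : ℕ) : ZMod 3) = -1 from rfl, neg_one_mul]

/-- The vector cv with Q_♯(v) = δ then has norm of trace ε, and the second condition makes it
nonorthogonal to c³v, which has the Frobenius-conjugate norm. The element 1 serves if δ = -ε, since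
its trace is 5 = -1, and 1 + z serves if δ = ε. -/
lemma exists_trace_sq_eq [Finite K] (hK : Module.finrank (ZMod 3) K = 5) {ε δ : ZMod 3}
    (hε : ε ≠ 0) (hδ : δ ≠ 0) : ∃ c : K,
      Algebra.trace (ZMod 3) K (algebraMap (ZMod 3) K δ * c ^ 2) = ε ∧
      Algebra.trace (ZMod 3) K (c ^ 4) ≠ 0 := by
  have hone : Algebra.trace (ZMod 3) K (1 : K) = -1 := by
    rw [← map_one (algebraMap (ZMod 3) K), trace_algebraMap_quintic hK]
  rcases (show δ = -ε ∨ δ = ε by clear * - hε hδ; revert ε δ; decide) with rfl | rfl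
  · refine ⟨1, ?_, ?_⟩
    · rw [one_pow, mul_one, trace_algebraMap_quintic hK, neg_neg]
    · rw [one_pow, hone]; decide
  · obtain ⟨z, h1, h2, h4⟩ := exists_trace_pow_eq hK
    have h3 := three_eq_zero_of_algebra K
    refine ⟨1 + z, ?_, ?_⟩
    · rw [trace_algebraMap_mul, show (1 + z) ^ 2 = 1 + z + z + z ^ 2 by ring, map_add, map_add,
        map_add, h1, h2, hone]
      clear * -; revert δ; decide
    · rw [show (1 + z) ^ 4 = 1 + z + z ^ 3 + z ^ 4 by
          linear_combination (z + 2 * z ^ 2 + z ^ 3) * h3,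
        map_add, map_add, map_add, trace_cube, h1, h4, hone]
      decide

end DimensionFive

/-! ### The case dim V_♯ = 1 -/

section OneDimensional

variable {V : Type*} [AddCommGroup V] [Module (ZMod 3) V] [Finite V]
  {Q : QuadraticForm (ZMod 3) V} {ξ : ℤˣ} {ε : ZMod 3}
  {K : Type*} [Field K] [Finite K] [Algebra (ZMod 3) K] [Module K V]
  {Qs : QuadraticForm K V} {G : Subgroup (V ≃ₗ[ZMod 3] V)} {n k l mu : ℕ}

omit [Module (ZMod 3) V] [Finite V] [Finite K] [Algebra (ZMod 3) K] in
lemma rep_eq_of_norm_eq (hd : Module.finrank K V = 1) {v w : V} (h : Qs v = Qs w)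
    (hv : Qs v ≠ 0) : v = w ∨ v = -w := by
  have hv0 : v ≠ 0 := by rintro rfl; exact hv (QuadraticMap.map_zero _)
  obtain ⟨b, rfl⟩ := (finrank_eq_one_iff_of_nonzero' v hv0).1 hd w
  rw [QuadraticMap.map_smul, smul_eq_mul] at h
  have : (b - 1) * (b + 1) = 0 := mul_right_cancel₀ hv (by linear_combination -h)
  rcases mul_eq_zero.1 this with h | h
  · left; rw [sub_eq_zero.1 h, one_smul]
  · right; rw [eq_neg_of_add_eq_zero_left h, neg_smul, one_smul, neg_neg]

omit [Finite V] [Finite K] [Algebra (ZMod 3) K] in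
lemma point_eq_of_norm_eq (hd : Module.finrank K V = 1) {x y : ℙ (ZMod 3) V}
    (h : Qs x.rep = Qs y.rep) (hx : Qs x.rep ≠ 0) : x = y := by
  rw [← y.mk_rep, eq_mk_iff]
  exact rep_eq_of_norm_eq hd h hx

omit [Finite V] in
lemma norm_mem_of_mem_orbit (hQs : ∀ v, Q v = Algebra.trace (ZMod 3) K (Qs v))
    (hGI : G ≤ isometryGroup Q) {x y : ℙ (ZMod 3) V}
    (h : y ∈ MulAction.orbit (fieldExtSubgroup K G) x) :
    ∃ i < Module.finrank (ZMod 3) K, Qs y.rep = Qs x.rep ^ 3 ^ i := by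
  obtain ⟨σ, hσ⟩ := exists_norm_eq_of_mem_orbit hQs hGI h
  obtain ⟨i, hi, h⟩ := exists_pow_eq_of_ringEquiv σ
  exact ⟨i, hi, by rw [hσ, h]⟩

-- On a line over K a point is determined by its norm, so points of the orbit inject into the
-- exponents i of the Frobenius powers.
omit [Finite V] in
lemma ncard_orbit_le (hd : Module.finrank K V = 1)
    (hQs : ∀ v, Q v = Algebra.trace (ZMod 3) K (Qs v)) (hGI : G ≤ isometryGroup Q)
    {x : ℙ (ZMod 3) V} (hx : Qs x.rep ≠ 0) (S : Set (ℙ (ZMod 3) V)) (I : Finset ℕ)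
    (hS : S ⊆ MulAction.orbit (fieldExtSubgroup K G) x)
    (hI : ∀ i < Module.finrank (ZMod 3) K, i ∉ I → ∀ y ∈ S, Qs y.rep ≠ Qs x.rep ^ 3 ^ i) :
    S.ncard ≤ I.card := by
  classical
  rw [← Set.ncard_coe_finset I]
  have h : ∀ y ∈ S, ∃ i ∈ I, Qs y.rep = Qs x.rep ^ 3 ^ i := by
    intro y hy
    obtain ⟨i, hi, h⟩ := norm_mem_of_mem_orbit hQs hGI (hS hy)
    exact ⟨i, by_contra fun h' => hI i hi h' y hy h, h⟩
  choose! f hf hf' using h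
  refine Set.ncard_le_ncard_of_injOn f (fun y hy => hf y hy) ?_ I.finite_toSet
  intro y hy z hz h
  refine point_eq_of_norm_eq hd (by rw [hf' y hy, hf' z hz, h]) ?_
  rw [hf' y hy]
  exact pow_ne_zero _ hx

/-- In the one-dimensional space over the field with `243` elements there is a point whose orbit
has at most three points in the perp. -/
lemma exists_ncard_orbit_Delta_le (hK : Module.finrank (ZMod 3) K = 5)
    (hd : Module.finrank K V = 1) (hQs : ∀ v, Q v = Algebra.trace (ZMod 3) K (Qs v))
    (hQ : Nondeg Q) (hGI : G ≤ isometryGroup Q) (hε : ε ≠ 0)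
    (hE : ∀ x, x ∈ nonsingPoints Q ξ ↔ Q x.rep = ε) :
    ∃ x ∈ nonsingPoints Q ξ,
      (MulAction.orbit (fieldExtSubgroup K G) x ∩ Delta Q ξ x).ncard ≤ 3 := by
  have := Fintype.ofFinite K
  have h2 := Ring.two_ne_zero (ringChar_ne_two_of_algebra K)
  obtain ⟨u, hu0⟩ : ∃ u : V, u ≠ 0 := by
    obtain ⟨u, hu, -⟩ := finrank_eq_one_iff'.1 hd
    exact ⟨u, hu⟩
  have hgen := (finrank_eq_one_iff_of_nonzero' u hu0).1 hd
  have hu : Qs u ≠ 0 := by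
    intro h
    apply hu0
    refine hQ.of_trace hQs u fun w => ?_
    obtain ⟨b, rfl⟩ := hgen w
    rw [QuadraticMap.polar_smul_right, polar_self', h, mul_zero, smul_zero]
  -- The exponent 60 makes the norm Qs(u)^121, which is ±1 because the multiplicative group has
  -- order 242.
  obtain ⟨δ, hδ0, hδ⟩ : ∃ δ : ZMod 3, δ ≠ 0 ∧ Qs (Qs u ^ 60 • u) = algebraMap (ZMod 3) K δ := by
    have hpow : Qs u ^ 242 = 1 := by
      have := FiniteField.pow_card_sub_one_eq_one _ hu
      rwa [← Nat.card_eq_fintype_card, natCard_eq_three_pow, hK] at this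
    have h : (Qs u ^ 121 - 1) * (Qs u ^ 121 + 1) = 0 := by linear_combination hpow
    have hQ' : Qs (Qs u ^ 60 • u) = Qs u ^ 121 := by
      rw [QuadraticMap.map_smul, smul_eq_mul]; ring
    rcases mul_eq_zero.1 h with h | h
    · exact ⟨1, by decide, by rw [hQ', sub_eq_zero.1 h, map_one]⟩
    · exact ⟨-1, by decide, by rw [hQ', eq_neg_of_add_eq_zero_left h, map_neg, map_one]⟩
  generalize Qs u ^ 60 • u = v at hδ
  obtain ⟨c, hc, hc4⟩ := exists_trace_sq_eq hK hε hδ0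
  have hδ3 : algebraMap (ZMod 3) K δ ^ 3 = algebraMap (ZMod 3) K δ := by
    rw [← map_pow, ZMod.pow_card]
  have hQc : ∀ b : K, Qs (b • v) = algebraMap (ZMod 3) K δ * b ^ 2 := by
    intro b
    rw [QuadraticMap.map_smul, smul_eq_mul, hδ]; ring
  have hcv : c • v ≠ 0 := by
    intro h
    have := hQc c
    rw [h, QuadraticMap.map_zero] at this
    rw [← this, map_zero] at hc
    exact hε hc.symm
  have hrep := rep_mk (c • v) hcv
  set x := Projectivization.mk (ZMod 3) (c • v) hcv with hxdef
  have hx : Qs x.rep = algebraMap (ZMod 3) K δ * c ^ 2 := by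
    rcases hrep with h | h
    · rw [h, hQc]
    · rw [h, QuadraticMap.map_neg, hQc]
  have hxE : x ∈ nonsingPoints Q ξ := by rw [hE, hQs, hx, hc]
  have hx0 : Qs x.rep ≠ 0 := by
    intro h
    rw [hE, hQs, h, map_zero] at hxE
    exact hε hxE.symm
  refine ⟨x, hxE, ?_⟩
  -- The exponent 0 gives x itself, which is not in its own perp, and the exponent 1 gives the point
  -- of c³v, excluded by the choice of c.
  refine (ncard_orbit_le hd hQs hGI hx0 _ {2, 3, 4} Set.inter_subset_left ?_).trans (by simp)
  rintro i hi hiI y ⟨-, hy⟩ h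
  rw [hK] at hi
  rw [Delta_eq hE] at hy
  obtain rfl | rfl : i = 0 ∨ i = 1 := by
    simp only [Finset.mem_insert, Finset.mem_singleton] at hiI
    lia
  · rw [pow_zero, pow_one] at h
    rw [point_eq_of_norm_eq hd h (h ▸ hx0)] at hy
    exact notMem_Delta_self hε hE hxE (by rw [Delta_eq hE]; exact hy)
  · have hnorm : Qs y.rep = Qs (c ^ 3 • v) := by
      rw [h, hx, hQc, pow_one, mul_pow, hδ3]; ring
    have hpol : QuadraticMap.polar Qs (c • v) (c ^ 3 • v) =
        algebraMap (ZMod 3) K (2 * δ) * c ^ 4 := by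
      rw [QuadraticMap.polar_smul_left, QuadraticMap.polar_smul_right, polar_self', hδ, map_mul,
        map_ofNat]
      simp only [smul_eq_mul]
      ring
    have hne : Algebra.trace (ZMod 3) K (QuadraticMap.polar Qs (c • v) (c ^ 3 • v)) ≠ 0 := by
      rw [hpol, trace_algebraMap_mul]
      exact mul_ne_zero (mul_ne_zero two_ne_zero_zmod hδ0) hc4
    have hy1 := hy.1
    rw [polar_eq_trace hQs] at hy1
    rcases hrep with h1 | h1 <;>
      rcases rep_eq_of_norm_eq hd hnorm (by rw [h]; exact pow_ne_zero _ hx0) with h3 | h3 <;>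
      rw [h1, h3] at hy1 <;> apply hne <;>
      simpa [QuadraticMap.polar_neg_left, QuadraticMap.polar_neg_right] using hy1

theorem exists_not_orbitEquation_of_one_dim (hd : Module.finrank K V = 1)
    (hm : Module.finrank (ZMod 3) K = 2 * (n + 1) + 1) (hn : 1 ≤ n)
    (hQs : ∀ v, Q v = Algebra.trace (ZMod 3) K (Qs v)) (hQ : Nondeg Q)
    (hGI : G ≤ isometryGroup Q) (hε : ε ≠ 0) (hE : ∀ x, x ∈ nonsingPoints Q ξ ↔ Q x.rep = ε)
    (hne : (nonsingPoints Q ξ).Nonempty) (hP : PointParams n ξ k l mu) :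
    ∃ x ∈ nonsingPoints Q ξ, ∀ r : ℝ, (r = eigS k mu mu ∨ r = eigT k mu mu) →
      ¬ OrbitEquation (M := fieldExtSubgroup K G) (Delta Q ξ) (Gamma Q ξ) k l r x := by
  obtain ⟨x, hx, hxd⟩ : ∃ x ∈ nonsingPoints Q ξ, n = 1 →
      (MulAction.orbit (fieldExtSubgroup K G) x ∩ Delta Q ξ x).ncard ≤ 3 := by
    by_cases h : n = 1
    · subst h
      obtain ⟨x, hx, h⟩ := exists_ncard_orbit_Delta_le (G := G) (by rw [hm]) hd hQs hQ hGI hε hE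
      exact ⟨x, hx, fun _ => h⟩
    · obtain ⟨x, hx⟩ := hne
      exact ⟨x, hx, fun h' => absurd h' h⟩
  refine ⟨x, hx, fun r hr => hP.equation_false_of_small hn ?_ hxd hr⟩
  have h1 := ncard_eq_add_one hε hE (orbit_subset_nonsingPoints hQs hGI hE hx)
    (MulAction.mem_orbit_self (M := fieldExtSubgroup K G) x)
  have hx0 : Qs x.rep ≠ 0 := by
    intro h
    rw [hE, hQs, h, map_zero] at hx
    exact hε hx.symm
  have h2 := ncard_orbit_le (G := G) hd hQs hGI hx0 _ (Finset.range (Module.finrank (ZMod 3) K))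
    subset_rfl (fun i hi h => absurd (Finset.mem_range.2 hi) h)
  rw [Finset.card_range, hm] at h2
  lia

end OneDimensional

/-! ### Comparing permutation characters -/

section Characters

variable {G : Type*} [Group G]

/-- A vector which is invariant under a subgroup gives an intertwining map on the cosets. -/
lemma exists_intertwiningMap [Finite G] {P : Subgroup G} {E : Type*} [AddCommGroup E] [Module ℂ E]
    (σ : Representation ℂ G E) {u : E} (hu : ∀ p ∈ P, σ p u = u) (hu0 : u ≠ 0) :
    ∃ φ : Representation.IntertwiningMap (Representation.ofMulAction ℂ G (G ⧸ P)) σ, φ ≠ 0 := by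
  -- Invariance of u under P makes the image independent of the coset representative.
  have hF : ∀ (g : G) (h : G ⧸ P), σ (g • h).out u = σ g (σ h.out u) := by
    intro g h
    have h1 : (((g • h).out : G) : G ⧸ P) = ((g * h.out : G) : G ⧸ P) := by
      rw [QuotientGroup.out_eq', ← smul_eq_mul, ← MulAction.Quotient.smul_coe,
        QuotientGroup.out_eq']
    have h2 := hu _ (QuotientGroup.eq.1 h1)
    have h3 := congrArg (σ (g • h).out) h2
    rw [← Module.End.mul_apply, ← map_mul, mul_inv_cancel_left, map_mul, Module.End.mul_apply] at h3
    exact h3.symm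
  let f : MonoidAlgebra ℂ (G ⧸ P) →ₗ[ℂ] E :=
    (Finsupp.linearCombination ℂ fun h : G ⧸ P => σ h.out u) ∘ₗ
      (MonoidAlgebra.coeffLinearEquiv ℂ).toLinearMap
  have hf : ∀ h r, f (MonoidAlgebra.single h r) = r • σ h.out u := by
    intro h r
    simp [f]
  let φ : Representation.IntertwiningMap (Representation.ofMulAction ℂ G (G ⧸ P)) σ :=
    { f with
      isIntertwining' := fun g => by
        ext h
        simp [hf, hF, Representation.ofMulAction_single] }
  refine ⟨φ, fun h => hu0 ?_⟩
  have h1 : φ (MonoidAlgebra.single ((1 : G) : G ⧸ P) 1) = σ ((1 : G) : G ⧸ P).out u := by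
    rw [← one_smul ℂ (σ _ u)]
    exact hf _ _
  rw [h] at h1
  have h2 := congrArg (σ ((1 : G) : G ⧸ P).out⁻¹) h1
  rw [← Module.End.mul_apply, ← map_mul, inv_mul_cancel, map_one] at h2
  simpa using h2.symm

/-- The image of the trivial coset is fixed by M, and its translates span the image. -/
lemma intertwiningMap_eq_zero {M : Subgroup G} {E : Type*} [AddCommGroup E] [Module ℂ E]
    (σ : Representation ℂ G E) (hM : ∀ v, (∀ m ∈ M, σ m v = v) → v = 0)
    (φ : Representation.IntertwiningMap (Representation.ofMulAction ℂ G (G ⧸ M)) σ) : φ = 0 := by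
  have h0 : φ (MonoidAlgebra.single ((1 : G) : G ⧸ M) 1) = 0 := by
    refine hM _ fun m hm => ?_
    rw [← φ.isIntertwining, Representation.ofMulAction_single, MulAction.Quotient.smul_coe,
      smul_eq_mul, mul_one, QuotientGroup.eq.2 (show m⁻¹ * 1 ∈ M by simpa using hm)]
  apply Representation.IntertwiningMap.ext
  ext h
  obtain ⟨g, rfl⟩ := QuotientGroup.mk_surjective h
  have h1 := Representation.IntertwiningMap.isIntertwining _ _ φ g (MonoidAlgebra.single ((1 : G) : G ⧸ M) 1)
  rw [h0, map_zero, Representation.ofMulAction_single, MulAction.Quotient.smul_coe,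
    smul_eq_mul, mul_one] at h1
  exact h1

/-- By Frobenius reciprocity σ pairs to zero with 1_M^G and positively with 1_P^G. A character equal
to the difference would have negative pairing with σ. -/
theorem not_charLE [Finite G] {P M : Subgroup G} {E : Type*} [AddCommGroup E] [Module ℂ E]
    [FiniteDimensional ℂ E] (σ : Representation ℂ G E)
    (hM : ∀ v, (∀ m ∈ M, σ m v = v) → v = 0) {u : E} (hu : ∀ p ∈ P, σ p u = u) (hu0 : u ≠ 0) :
    ¬ CharLE (permChar P) (permChar M) := by
  rintro ⟨n, ρ, hρ⟩
  have := Fintype.ofFinite G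
  have : Invertible (Nat.card G : ℂ) := invertibleOfNonzero (by exact_mod_cast Nat.card_pos.ne')
  obtain ⟨φ, hφ⟩ := exists_intertwiningMap σ hu hu0
  have hMz : Module.finrank ℂ
      (Representation.IntertwiningMap (Representation.ofMulAction ℂ G (G ⧸ M)) σ) = 0 := by
    have : Subsingleton
        (Representation.IntertwiningMap (Representation.ofMulAction ℂ G (G ⧸ M)) σ) :=
      subsingleton_of_forall_eq 0 (intertwiningMap_eq_zero σ hM)
    exact Module.finrank_zero_of_subsingleton
  have hPpos : 0 < Module.finrank ℂ
      (Representation.IntertwiningMap (Representation.ofMulAction ℂ G (G ⧸ P)) σ) := by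
    have : Nontrivial (Representation.IntertwiningMap
      (Representation.ofMulAction ℂ G (G ⧸ P)) σ) := ⟨φ, 0, hφ⟩
    have : FiniteDimensional ℂ (Representation.IntertwiningMap
      (Representation.ofMulAction ℂ G (G ⧸ P)) σ) := inferInstance
    exact Module.finrank_pos
  have e1 := Representation.card_inv_mul_sum_char_mul_char_eq_finrank
    (Representation.ofMulAction ℂ G (G ⧸ M)) σ
  have e2 := Representation.card_inv_mul_sum_char_mul_char_eq_finrank
    (Representation.ofMulAction ℂ G (G ⧸ P)) σ
  have e3 := Representation.card_inv_mul_sum_char_mul_char_eq_finrank ρ σ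
  have hsum : ∀ g : G, (Representation.ofMulAction ℂ G (G ⧸ M)).character g =
      (Representation.ofMulAction ℂ G (G ⧸ P)).character g + ρ.character g := by
    intro g
    have := congrFun hρ g
    simp only [Pi.sub_apply, permChar] at this
    rw [← this]; ring
  simp only [hsum, mul_add, Finset.sum_add_distrib, e2, e3, hMz] at e1
  have : Module.finrank ℂ
      (Representation.IntertwiningMap (Representation.ofMulAction ℂ G (G ⧸ P)) σ) +
      Module.finrank ℂ (Representation.IntertwiningMap ρ σ) = 0 := by exact_mod_cast e1
  lia

end Characters

/-! ### Eigenspaces of the orthogonality relation -/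

section Eigenspace

open Matrix

variable {X : Type*} [Fintype X] (𝕜 : Type*) [Field 𝕜] (N : X → X → Prop)

open Classical in
/-- The adjacency matrix of a relation. -/
def relMatrix : Matrix X X 𝕜 := Matrix.of fun x y => if N x y then 1 else 0

/-- A symmetric relation on `E`, regular of valency `k`, such that any two distinct points have
`mu` common neighbours, with eigenvalue `r` satisfying the relations which hold for non-singular
points over the field with three elements. -/
structure RankThreeRel (N : X → X → Prop) (E : Set X) (k mu : ℕ) (r : ℤ) : Prop where
  symm : ∀ {x y}, N x y → N y x
  left_mem : ∀ {x y}, N x y → x ∈ E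
  irrefl : ∀ x, ¬ N x x
  card_nbhd : ∀ x ∈ E, {y | N x y}.ncard = k
  card_common : ∀ x ∈ E, ∀ y ∈ E, x ≠ y → {z | N x z ∧ N y z}.ncard = mu
  card_eq : (E.ncard : ℤ) = 3 * (k + r)
  sq_eq : r ^ 2 = k - mu
  sub_eq : (k : ℤ) - r = 3 * mu
  ne_zero : r ≠ 0

variable {𝕜 N} {E : Set X} {k mu : ℕ} {r : ℤ}

lemma relMatrix_mulVec (f : X → 𝕜) (x : X) [DecidablePred (N x)] :
    (relMatrix 𝕜 N *ᵥ f) x = ∑ y with N x y, f y := by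
  simp [relMatrix, Matrix.mulVec, dotProduct, Finset.sum_filter]

namespace RankThreeRel

variable (h : RankThreeRel N E k mu r)
include h

omit [Fintype X] in
lemma relMatrix_transpose : (relMatrix 𝕜 N)ᵀ = relMatrix 𝕜 N := by
  ext x y
  simp only [relMatrix, Matrix.transpose_apply, Matrix.of_apply]
  congr 1
  exact propext ⟨h.symm, h.symm⟩

lemma dotProduct_relMatrix (f g : X → 𝕜) :
    f ⬝ᵥ (relMatrix 𝕜 N *ᵥ g) = (relMatrix 𝕜 N *ᵥ f) ⬝ᵥ g := by
  rw [dotProduct_mulVec, ← mulVec_transpose, h.relMatrix_transpose]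

lemma mulVec_apply_of_notMem (f : X → 𝕜) {x : X} (hx : x ∉ E) : (relMatrix 𝕜 N *ᵥ f) x = 0 := by
  classical
  rw [relMatrix_mulVec, Finset.filter_false_of_mem fun y _ hy => hx (h.left_mem hy),
    Finset.sum_empty]

lemma mulVec_indicator : relMatrix 𝕜 N *ᵥ E.indicator 1 = (k : 𝕜) • E.indicator 1 := by
  classical
  ext x
  by_cases hx : x ∈ E
  · rw [relMatrix_mulVec, Finset.sum_congr rfl (g := fun _ => (1 : 𝕜))]
    · simp [hx, ← h.card_nbhd x hx, Set.ncard_eq_toFinset_card']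
    · intro y hy
      have : y ∈ E := h.left_mem (h.symm (Finset.mem_filter.1 hy).2)
      simp [this]
  · rw [h.mulVec_apply_of_notMem _ hx]; simp [hx]

/-- On E the square of the adjacency matrix is (k - μ)I + μJ, because λ = μ. -/
lemma mulVec_mulVec (f : X → 𝕜) (hf : ∀ x ∉ E, f x = 0) :
    relMatrix 𝕜 N *ᵥ (relMatrix 𝕜 N *ᵥ f) =
      (r : 𝕜) ^ 2 • f + ((mu : 𝕜) * ∑ x, f x) • E.indicator 1 := by
  classical
  have hsq : (r : 𝕜) ^ 2 = k - mu := by exact_mod_cast congrArg (Int.cast : ℤ → 𝕜) h.sq_eq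
  ext x
  by_cases hx : x ∈ E
  · have hentry : ∀ y ∈ E, (relMatrix 𝕜 N * relMatrix 𝕜 N) x y =
        (if y = x then (k : 𝕜) - mu else 0) + mu := by
      intro y hy
      have : (relMatrix 𝕜 N * relMatrix 𝕜 N) x y = ({z | N x z ∧ N y z}.ncard : 𝕜) := by
        have hs : ∀ z, N z y ↔ N y z := fun z => ⟨h.symm, h.symm⟩
        simp [relMatrix, Matrix.mul_apply, Set.ncard_eq_toFinset_card', hs, ← ite_and,
          Finset.sum_boole]
        congr 2
        ext z
        simp [and_comm]
      rw [this]
      split_ifs with e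
      · subst e
        simp [h.card_nbhd y hy]
      · rw [h.card_common x hx y hy (Ne.symm e), zero_add]
    rw [Matrix.mulVec_mulVec, mulVec, dotProduct, Finset.sum_congr rfl
      (g := fun y => (if y = x then (k : 𝕜) - mu else 0) * f y + mu * f y)]
    · rw [Finset.sum_add_distrib, ← Finset.mul_sum]
      simp [hx, hsq]
    · intro y _
      by_cases hy : y ∈ E
      · rw [hentry y hy]; ring
      · rw [hf y hy]; ring
  · rw [h.mulVec_apply_of_notMem _ hx]; simp [hx, hf x hx]

lemma eq_zero_of_notMem [CharZero 𝕜] {f : X → 𝕜} (hf : relMatrix 𝕜 N *ᵥ f = (r : 𝕜) • f) {x : X}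
    (hx : x ∉ E) : f x = 0 := by
  have h1 := congrFun hf x
  rw [h.mulVec_apply_of_notMem _ hx, Pi.smul_apply, smul_eq_mul, zero_eq_mul] at h1
  exact h1.resolve_left (by exact_mod_cast h.ne_zero)

end RankThreeRel

variable (N E r) in
/-- The multiple of the projection of `g` to the eigenspace of the eigenvalue `r`. -/
def eigenProj (g : X → 𝕜) : X → 𝕜 :=
  relMatrix 𝕜 N *ᵥ g + (r : 𝕜) • g - ((∑ x, g x) / 3) • E.indicator 1

namespace RankThreeRel

variable (h : RankThreeRel N E k mu r)
include h

lemma sum_indicator : ∑ x, E.indicator (1 : X → 𝕜) x = 3 * (k + r) := by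
  classical
  have h1 : ((E.ncard : ℤ) : 𝕜) = 3 * (k + r) := by rw [h.card_eq]; push_cast; ring
  rw [← h1]
  simp [Set.indicator_apply, Set.ncard_eq_toFinset_card']

/-- Since A² acts as r² on functions of sum zero, A + r maps these to the r-eigenspace. The
correction by a third of the sum handles the constant part: k - r = 3μ is used here, and |E| = 3(k +
r) in `sum_eigenProj`. -/
lemma mulVec_eigenProj [CharZero 𝕜] (g : X → 𝕜) (hg : ∀ x ∉ E, g x = 0) :
    relMatrix 𝕜 N *ᵥ eigenProj N E r g = (r : 𝕜) • eigenProj N E r g := by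
  have hsub : (k : 𝕜) - r = 3 * mu := by exact_mod_cast congrArg (Int.cast : ℤ → 𝕜) h.sub_eq
  rw [eigenProj, mulVec_sub, mulVec_add, h.mulVec_mulVec g hg, mulVec_smul, mulVec_smul,
    h.mulVec_indicator]
  ext x
  simp only [Pi.sub_apply, Pi.add_apply, Pi.smul_apply, smul_eq_mul]
  linear_combination (-(∑ x, g x) / 3 * E.indicator 1 x) * hsub

lemma sum_eigenProj [CharZero 𝕜] (g : X → 𝕜) (hg : ∀ x ∉ E, g x = 0) :
    ∑ x, eigenProj N E r g x = 0 := by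
  have h1 : ∑ x, (relMatrix 𝕜 N *ᵥ g) x = k * ∑ x, g x := by
    have h2 : ∑ x, (relMatrix 𝕜 N *ᵥ g) x = E.indicator 1 ⬝ᵥ (relMatrix 𝕜 N *ᵥ g) := by
      refine Finset.sum_congr rfl fun x _ => ?_
      by_cases hx : x ∈ E
      · simp [hx]
      · simp [hx, h.mulVec_apply_of_notMem g hx]
    rw [h2, h.dotProduct_relMatrix, h.mulVec_indicator, smul_dotProduct, smul_eq_mul]
    congr 1
    refine Finset.sum_congr rfl fun x _ => ?_
    by_cases hx : x ∈ E
    · simp [hx]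
    · simp [hx, hg x hx]
  simp only [eigenProj, Pi.sub_apply, Pi.add_apply, Pi.smul_apply, smul_eq_mul,
    Finset.sum_sub_distrib, Finset.sum_add_distrib, ← Finset.mul_sum, h1, h.sum_indicator]
  ring

lemma dotProduct_eigenProj [CharZero 𝕜] {f : X → 𝕜} (hf : relMatrix 𝕜 N *ᵥ f = (r : 𝕜) • f)
    (hf0 : ∑ x, f x = 0) (g : X → 𝕜) : f ⬝ᵥ eigenProj N E r g = 2 * r * (f ⬝ᵥ g) := by
  have h1 : f ⬝ᵥ E.indicator 1 = 0 := by
    rw [← hf0]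
    refine Finset.sum_congr rfl fun x _ => ?_
    by_cases hx : x ∈ E
    · simp [hx]
    · simp [hx, h.eq_zero_of_notMem hf hx]
  rw [eigenProj, dotProduct_sub, dotProduct_add, h.dotProduct_relMatrix, hf, dotProduct_smul,
    dotProduct_smul, h1, smul_dotProduct]
  simp only [smul_eq_mul]
  ring

/-- An eigenvector which is constant on sets meeting every neighbourhood in the right number of
points vanishes. -/
lemma eq_zero_of_constant {f : X → ℝ} (hf : relMatrix ℝ N *ᵥ f = (r : ℝ) • f)
    (hf0 : ∑ x, f x = 0) (hO : ∀ x ∈ E, ∃ O : Set X, x ∈ O ∧ O ⊆ E ∧ (∀ y ∈ O, f y = f x) ∧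
      ∀ y ∈ O, (O.ncard : ℤ) = 3 * ((O ∩ {z | N y z}).ncard + r)) : f = 0 := by
  classical
  ext x
  by_cases hx : x ∈ E
  · obtain ⟨O, hxO, hOE, hfO, hcard⟩ := hO x hx
    set g : X → ℝ := O.indicator 1 with hg
    have hg0 : ∀ x ∉ E, g x = 0 := fun y hy => by
      simpa [hg] using fun h' => hy (hOE h')
    have hgsum : ∑ x, g x = O.ncard := by
      simp [hg, Set.indicator_apply, Set.ncard_eq_toFinset_card']
    have hr : (r : ℝ) ≠ 0 := by exact_mod_cast h.ne_zero
    -- On O the projection of the indicator has the value |O ∩ N(y)| + r - |O|/3, which is zero by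
    -- hypothesis; off O the indicator vanishes.
    have hzero : eigenProj N E r g ⬝ᵥ g = 0 := by
      refine Finset.sum_eq_zero fun y _ => ?_
      by_cases hy : y ∈ O
      · have h1 : (relMatrix ℝ N *ᵥ g) y = (O ∩ {z | N y z}).ncard := by
          rw [relMatrix_mulVec]
          simp [hg, Set.indicator_apply, Set.ncard_eq_toFinset_card', Set.inter_def,
            Finset.filter_filter, and_comm]
        have h2 : (O.ncard : ℝ) = 3 * ((O ∩ {z | N y z}).ncard + r) := by
          exact_mod_cast congrArg (Int.cast : ℤ → ℝ) (hcard y hy)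
        have h3 : eigenProj N E r g y = 0 := by
          simp only [eigenProj, Pi.sub_apply, Pi.add_apply, Pi.smul_apply, smul_eq_mul, h1, hgsum]
          simp [hg, hy, hOE hy, h2]
        rw [h3, zero_mul]
      · simp [hg, hy]
    -- The projection pairs with itself as 2r times its pairing with g. Positive definiteness over ℝ
    -- then makes it zero.
    have hproj : eigenProj N E r g = 0 := by
      rw [← dotProduct_self_eq_zero, h.dotProduct_eigenProj (h.mulVec_eigenProj g hg0)
        (h.sum_eigenProj g hg0), hzero, mul_zero]
    have h1 := h.dotProduct_eigenProj hf hf0 g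
    rw [hproj, dotProduct_zero, zero_eq_mul] at h1
    have h2 : f ⬝ᵥ g = O.ncard * f x := by
      rw [← hgsum, Finset.sum_mul]
      refine Finset.sum_congr rfl fun y _ => ?_
      by_cases hy : y ∈ O
      · simp [hg, hy, hfO y hy]
      · simp [hg, hy]
    rw [h2] at h1
    have h3 : (O.ncard : ℝ) ≠ 0 := by
      have := (Set.ncard_pos (Set.toFinite O)).2 ⟨x, hxO⟩
      exact_mod_cast this.ne'
    simpa [hr, h3] using h1
  · exact h.eq_zero_of_notMem hf hx

lemma exists_eigenvector {x : X} (hx : x ∈ E) :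
    ∃ u : X → ℂ, u ≠ 0 ∧ relMatrix ℂ N *ᵥ u = (r : ℂ) • u ∧ ∑ x, u x = 0 ∧
      ∀ e : X ≃ X, e x = x → (∀ y z, N (e y) (e z) ↔ N y z) → (∀ y, e y ∈ E ↔ y ∈ E) →
        u ∘ e = u := by
  classical
  have hg : ∀ y ∉ E, (Pi.single x 1 : X → ℂ) y = 0 := fun y hy => by
    rw [Pi.single_apply, if_neg]; rintro rfl; exact hy hx
  refine ⟨eigenProj N E r (Pi.single x 1), ?_, h.mulVec_eigenProj _ hg, h.sum_eigenProj _ hg, ?_⟩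
  · intro h0
    have h1 := congrFun h0 x
    have h2 : (relMatrix ℂ N *ᵥ Pi.single x 1) x = 0 := by
      simp [relMatrix, h.irrefl]
    simp only [eigenProj, Pi.sub_apply, Pi.add_apply, Pi.smul_apply, smul_eq_mul, h2] at h1
    simp [hx] at h1
    have h3 : (3 * r : ℂ) = 1 := by linear_combination 3 * h1
    -- The value of the projection at x is r - 1/3, which is nonzero for an integer r.
    have h4 : 3 * r = 1 := by exact_mod_cast h3
    lia
  · intro e hex he hE
    ext y
    have h1 : (relMatrix ℂ N *ᵥ Pi.single x 1) (e y) = (relMatrix ℂ N *ᵥ Pi.single x 1) y := by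
      have := he y x
      rw [hex] at this
      simp [relMatrix, this]
    have h2 : (Pi.single x 1 : X → ℂ) (e y) = (Pi.single x 1 : X → ℂ) y := by
      rw [Pi.single_apply, Pi.single_apply]
      congr 1
      rw [← hex, e.apply_eq_iff_eq, hex]
    simp only [eigenProj, Function.comp_apply, Pi.sub_apply, Pi.add_apply, Pi.smul_apply, h1, h2,
      Set.indicator_apply, hE, Pi.one_apply]

end RankThreeRel

variable {G : Type*} [Group G] [MulAction G X]

variable (G X) in
/-- The action of a group on complex functions. -/
def functionRep : Representation ℂ G (X → ℂ) where
  toFun g := LinearMap.funLeft ℂ ℂ (g⁻¹ • ·)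
  map_one' := by ext f x; simp [LinearMap.funLeft_apply]
  map_mul' g g' := by ext f x; simp [LinearMap.funLeft_apply, mul_smul]

omit [Fintype X] in
lemma functionRep_apply (g : G) (f : X → ℂ) (x : X) : functionRep X G g f x = f (g⁻¹ • x) := rfl

lemma relMatrix_mulVec_functionRep (hN : ∀ (g : G) x y, N (g • x) (g • y) ↔ N x y) (g : G)
    (f : X → ℂ) : relMatrix ℂ N *ᵥ functionRep X G g f =
      functionRep X G g (relMatrix ℂ N *ᵥ f) := by
  ext x
  rw [functionRep_apply]
  simp only [mulVec, dotProduct, functionRep_apply]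
  refine Fintype.sum_equiv (MulAction.toPerm g⁻¹) _ _ fun y => ?_
  congr 1
  simp only [relMatrix, Matrix.of_apply, MulAction.toPerm_apply]
  congr 1
  exact propext (hN g⁻¹ x y).symm

/-- The functions in an eigenspace of a relation with vanishing sum. -/
def eigenRep (hN : ∀ (g : G) x y, N (g • x) (g • y) ↔ N x y) (r : ℂ) :
    Subrepresentation (functionRep X G) where
  toSubmodule :=
    { carrier := {f | relMatrix ℂ N *ᵥ f = r • f ∧ ∑ x, f x = 0}
      zero_mem' := by simp
      add_mem' := by
        rintro f g ⟨hf, hf'⟩ ⟨hg, hg'⟩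
        refine ⟨by rw [mulVec_add, hf, hg, smul_add], ?_⟩
        simp [Finset.sum_add_distrib, hf', hg']
      smul_mem' := by
        rintro c f ⟨hf, hf'⟩
        refine ⟨by rw [mulVec_smul, hf, smul_comm], ?_⟩
        simp [← Finset.mul_sum, hf'] }
  apply_mem_toSubmodule g f hf := by
    refine ⟨by rw [relMatrix_mulVec_functionRep hN, hf.1, map_smul], ?_⟩
    rw [← hf.2]
    exact Fintype.sum_equiv (MulAction.toPerm g⁻¹) _ _ fun y => rfl

theorem RankThreeRel.not_charLE [Finite G] (h : RankThreeRel N E k mu r)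
    (hN : ∀ (g : G) x y, N (g • x) (g • y) ↔ N x y) (hE : ∀ (g : G) x, g • x ∈ E ↔ x ∈ E)
    {M : Subgroup G} (hM : ∀ x ∈ E, ((MulAction.orbit M x).ncard : ℤ) =
      3 * ((MulAction.orbit M x ∩ {z | N x z}).ncard + r)) {x : X} (hx : x ∈ E) :
    ¬ CharLE (permChar (MulAction.stabilizer G x)) (permChar M) := by
  obtain ⟨u, hu0, hu1, hu2, hu3⟩ := h.exists_eigenvector hx
  refine OrthRankThree.not_charLE (eigenRep hN (r : ℂ)).toRepresentation ?_
    (u := ⟨u, hu1, hu2⟩) ?_ ?_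
  · rintro ⟨f, hf1, hf2⟩ hfM
    have hconst : ∀ x, ∀ y ∈ MulAction.orbit M x, f y = f x := by
      rintro x _ ⟨m, rfl⟩
      have h1 := congrFun (congrArg Subtype.val (hfM (m⁻¹ : M) (m⁻¹ : M).2)) x
      change f (((m⁻¹ : M) : G)⁻¹ • x) = f x at h1
      rw [← h1]
      simp
      rfl
    -- The vanishing argument uses positive definiteness over ℝ, so it is applied to real and
    -- imaginary parts separately.
    have key : ∀ f' : X → ℝ, relMatrix ℝ N *ᵥ f' = (r : ℝ) • f' → ∑ x, f' x = 0 →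
        (∀ x, ∀ y ∈ MulAction.orbit M x, f' y = f' x) → f' = 0 := by
      intro f' h1 h2 h3
      refine h.eq_zero_of_constant h1 h2 fun x hx => ⟨MulAction.orbit M x,
        MulAction.mem_orbit_self x, ?_, h3 x, ?_⟩
      · rintro _ ⟨m, rfl⟩
        exact (hE (m : G) x).2 hx
      · intro y hy
        rw [← MulAction.orbit_eq_iff.2 hy]
        refine hM y ?_
        obtain ⟨m, rfl⟩ := hy
        exact (hE (m : G) x).2 hx
    have hre := key (fun x => (f x).re) (by
      classical
      ext x
      have := congrArg Complex.re (congrFun hf1 x)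
      rw [relMatrix_mulVec] at this ⊢
      simpa using this) (by simpa using congrArg Complex.re hf2)
      (fun x y hy => by rw [hconst x y hy])
    have him := key (fun x => (f x).im) (by
      classical
      ext x
      have := congrArg Complex.im (congrFun hf1 x)
      rw [relMatrix_mulVec] at this ⊢
      simpa using this) (by simpa using congrArg Complex.im hf2)
      (fun x y hy => by rw [hconst x y hy])
    ext x
    exact Complex.ext (congrFun hre x) (congrFun him x)
  · intro p hp
    refine Subtype.ext (hu3 (MulAction.toPerm p⁻¹) ?_ (fun y z => hN _ y z) (hE _))
    exact inv_mem hp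
  · intro h'
    exact hu0 (congrArg Subtype.val h')

end Eigenspace

/-! ### Orthogonality of points as a rank three relation -/

section PointRelation

variable {V : Type*} [AddCommGroup V] [Module (ZMod 3) V]
  {Q : QuadraticForm (ZMod 3) V} {ξ : ℤˣ} {ε : ZMod 3} {G : Subgroup (V ≃ₗ[ZMod 3] V)}

lemma rep_smul (g : G) (x : ℙ (ZMod 3) V) : (g • x).rep = g.1 x.rep ∨ (g • x).rep = -g.1 x.rep := by
  have h : g • x = Projectivization.mk (ZMod 3) (g.1 x.rep) (by simpa using x.rep_nonzero) := by
    conv_lhs => rw [← x.mk_rep]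
    rfl
  rw [h]
  exact rep_mk _ _

lemma norm_rep_smul (hGI : G ≤ isometryGroup Q) (g : G) (x : ℙ (ZMod 3) V) :
    Q (g • x).rep = Q x.rep := by
  rcases rep_smul g x with h | h
  · rw [h, hGI g.2]
  · rw [h, QuadraticMap.map_neg, hGI g.2]

lemma polar_rep_smul (hGI : G ≤ isometryGroup Q) (g : G) (x y : ℙ (ZMod 3) V) :
    QuadraticMap.polar Q (g • x).rep (g • y).rep = 0 ↔
      QuadraticMap.polar Q x.rep y.rep = 0 := by
  rw [← polar_map (hGI g.2) x.rep y.rep]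
  rcases rep_smul g x with h | h <;> rcases rep_smul g y with h' | h' <;> rw [h, h'] <;>
    simp [QuadraticMap.polar_neg_left, QuadraticMap.polar_neg_right]

lemma smul_mem_nonsingPoints (hGI : G ≤ isometryGroup Q)
    (hE : ∀ x, x ∈ nonsingPoints Q ξ ↔ Q x.rep = ε) (g : G) (x : ℙ (ZMod 3) V) :
    g • x ∈ nonsingPoints Q ξ ↔ x ∈ nonsingPoints Q ξ := by
  rw [hE, hE, norm_rep_smul hGI]

/-- Orthogonality of non-singular points is a rank three relation. -/
lemma rankThreeRel [Finite V] {n k l mu : ℕ} (hP : PointParams n ξ k l mu) (hε : ε ≠ 0)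
    (hE : ∀ x, x ∈ nonsingPoints Q ξ ↔ Q x.rep = ε) (hne : (nonsingPoints Q ξ).Nonempty)
    (hH : IsHigmanParams (nonsingPoints Q ξ) (Delta Q ξ) (Gamma Q ξ) k l mu mu) :
    RankThreeRel (fun x y => x ∈ nonsingPoints Q ξ ∧ y ∈ Delta Q ξ x) (nonsingPoints Q ξ) k mu
      (ξ * 3 ^ n) where
  -- Since `Delta` is defined for every point, membership of x has to be part of the relation for
  -- symmetry to hold.
  symm := by
    rintro x y ⟨hx, hy⟩
    refine ⟨hy.1, ?_⟩
    rw [Delta_eq hE] at hy ⊢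
    exact ⟨by rw [QuadraticMap.polar_comm]; exact hy.1, (hE x).1 hx⟩
  left_mem h := h.1
  irrefl x h := notMem_Delta_self hε hE h.1 h.2
  card_nbhd x hx := by
    rw [← hH.card_Delta x hx]
    simp [hx]
  card_common x hx y hy hxy := by
    have h : {z | (x ∈ nonsingPoints Q ξ ∧ z ∈ Delta Q ξ x) ∧
        (y ∈ nonsingPoints Q ξ ∧ z ∈ Delta Q ξ y)} = Delta Q ξ x ∩ Delta Q ξ y := by
      ext z
      simp [hx, hy]
    rw [h]
    by_cases h' : y.submodule ≤ perp Q x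
    · exact hH.card_inter_of_mem_Delta x hx y ⟨hy, h'⟩
    · exact hH.card_inter_of_mem_Gamma x hx y ⟨hy, hxy.symm, h'⟩
  card_eq := by
    obtain ⟨x, hx⟩ := hne
    have h1 : nonsingPoints Q ξ ∩ Delta Q ξ x = Delta Q ξ x :=
      Set.inter_eq_right.2 fun y hy => hy.1
    have h2 : nonsingPoints Q ξ ∩ Gamma Q ξ x = Gamma Q ξ x :=
      Set.inter_eq_right.2 fun y hy => hy.1
    rw [ncard_eq_add_one hε hE subset_rfl hx, h1, h2, hH.card_Delta x hx, hH.card_Gamma x hx]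
    have h3 := hP.two_mul_k
    have h4 := hP.l_eq
    rw [pow_succ] at h3 h4
    push_cast
    rcases Int.units_eq_one_or ξ with rfl | rfl <;>
      simp only [Units.val_one, Units.val_neg] at h3 h4 ⊢ <;> linarith
  sq_eq := by
    have h3 := hP.two_mul_k
    have h4 := hP.two_mul_mu
    rw [pow_succ] at h3
    rcases Int.units_eq_one_or ξ with rfl | rfl <;>
      simp only [Units.val_one, Units.val_neg] at h3 h4 ⊢ <;> linarith
  sub_eq := by
    have h3 := hP.two_mul_k
    have h4 := hP.two_mul_mu
    rw [pow_succ] at h3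
    rcases Int.units_eq_one_or ξ with rfl | rfl <;>
      simp only [Units.val_one, Units.val_neg] at h3 h4 ⊢ <;> linarith
  ne_zero := mul_ne_zero ξ.ne_zero (by positivity)

end PointRelation

end OrthRankThree

end

/-! ### The main theorem -/

theorem proposition5p11
    {K V : Type*} [Field K] [Algebra (ZMod 3) K]
    [AddCommGroup V] [Module (ZMod 3) V] [Module K V] [IsScalarTower (ZMod 3) K V]
    (m α : ℕ) (hm : 2 ≤ m) (hα : α.Prime)
    (hV : Module.finrank (ZMod 3) V = 2 * m + 1)
    (hK : Module.finrank (ZMod 3) K = α)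
    (Q : QuadraticForm (ZMod 3) V) (hQ : Q.polarBilin.Nondegenerate)
    (Qs : QuadraticForm K V) (hQs : ∀ v, Q v = Algebra.trace (ZMod 3) K (Qs v))
    (G : Subgroup (V ≃ₗ[ZMod 3] V))
    (hΩG : OrthRankThree.Omega Q ≤ G) (hGI : G ≤ OrthRankThree.isometryGroup Q)
    (M : Subgroup G) (hM : M = OrthRankThree.fieldExtSubgroup K G)
    (ξ : ℤˣ) :
    ∃ k l lam mu : ℕ,
      OrthRankThree.IsHigmanParams (OrthRankThree.nonsingPoints Q ξ)
        (OrthRankThree.Delta Q ξ) (OrthRankThree.Gamma Q ξ) k l lam mu ∧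
      (α ≠ 3 →
        ∃ x ∈ OrthRankThree.nonsingPoints Q ξ,
          ∀ r : ℝ, (r = OrthRankThree.eigS k lam mu ∨ r = OrthRankThree.eigT k lam mu) →
            ¬ OrthRankThree.OrbitEquation (M := M) (OrthRankThree.Delta Q ξ)
                (OrthRankThree.Gamma Q ξ) k l r x) ∧
      (α = 3 →
        ((fun x => MulAction.orbit M x) '' OrthRankThree.nonsingPoints Q ξ).ncard = 3 ∧
        (∀ x ∈ OrthRankThree.nonsingPoints Q ξ,
          OrthRankThree.OrbitEquation (M := M) (OrthRankThree.Delta Q ξ)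
            (OrthRankThree.Gamma Q ξ) k l
            (if ξ = 1 then OrthRankThree.eigS k lam mu else OrthRankThree.eigT k lam mu) x) ∧
        (∀ x ∈ OrthRankThree.nonsingPoints Q ξ,
          ¬ OrthRankThree.CharLE (OrthRankThree.permChar (MulAction.stabilizer G x))
              (OrthRankThree.permChar M))) := by
  open OrthRankThree in
  subst hM hK
  have : FiniteDimensional (ZMod 3) V := FiniteDimensional.of_finrank_pos (by lia)
  have : Finite V := Module.finite_of_finite (ZMod 3)
  have : FiniteDimensional (ZMod 3) K := FiniteDimensional.of_finrank_pos hα.pos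
  have : Finite K := Module.finite_of_finite (ZMod 3)
  have hfin : Finite (ℙ (ZMod 3) V) := Quotient.finite _
  have := Fintype.ofFinite (ℙ (ZMod 3) V)
  have : Finite (V ≃ₗ[ZMod 3] V) := DFunLike.finite _
  have hQ' : Nondeg Q := hQ.1
  obtain ⟨n, rfl⟩ : ∃ n, m = n + 1 := ⟨m - 1, by lia⟩
  have hn : 1 ≤ n := by lia
  obtain ⟨ε, hε, hT, hE, hperp⟩ := exists_norm hQ' hV ξ
  obtain ⟨k, l, mu, hH, h1, h2, h3⟩ := exists_isHigmanParams hQ' hV hε hT hE hperp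
  have hP : PointParams n ξ k l mu := ⟨h1, h2, h3⟩
  have hne : (nonsingPoints Q ξ).Nonempty := by
    obtain ⟨v, hv⟩ := exists_norm_eq ringChar_zmod_three hQ' (by lia) hε
    have hv0 : v ≠ 0 := by rintro rfl; rw [QuadraticMap.map_zero] at hv; exact hε hv.symm
    refine ⟨Projectivization.mk (ZMod 3) v hv0, (hE _).2 ?_⟩
    rcases rep_mk v hv0 with h | h
    · rw [h, hv]
    · rw [h, QuadraticMap.map_neg, hv]
  have hdim := Module.finrank_mul_finrank (ZMod 3) K V
  refine ⟨k, l, mu, mu, hH, fun hα3 => ?_, fun hα3 => ?_⟩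
  · have hodd : Odd (Module.finrank K V) := by
      have : Odd (Module.finrank (ZMod 3) K * Module.finrank K V) := by
        rw [hdim, hV]; exact ⟨_, rfl⟩
      exact (Nat.odd_mul.1 this).2
    -- The dimension over K is odd because it divides 2m + 1. Dimension 1 is separate, as the
    -- transitivity of Ω on points of given norm requires dimension at least 3.
    rcases (show Module.finrank K V = 1 ∨ 3 ≤ Module.finrank K V by
      obtain ⟨j, hj⟩ := hodd; lia) with hd | hd
    · exact exists_not_orbitEquation_of_one_dim hd (by rw [← hV, ← hdim, hd, mul_one]) hn hQs hQ'
        hGI hε hE hne hP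
    · exact exists_not_orbitEquation_of_three_le hα hα3 hV hn hQs hQ' hΩG hGI hd hε hE hP
  -- For α = 3 the dimension over K is not 1, because 2m + 1 ≥ 5.
  · have hd : 3 ≤ Module.finrank K V := by
      rw [hα3, hV] at hdim
      lia
    have horb := fun x hx => ncard_orbit_cubic (x := x) hα3 hQs hQ' hΩG hGI hd hV hε hT hE hx
    refine ⟨ncard_orbits_cubic hα3 hQs hQ' hΩG hGI hd hε hE, fun x hx => ?_, fun x hx => ?_⟩
    · have hr : (if ξ = 1 then eigS k mu mu else eigT k mu mu) = (ξ : ℝ) * 3 ^ n := by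
        rw [hP.eigS_eq, hP.eigT_eq]
        rcases Int.units_eq_one_or ξ with rfl | rfl
        · simp
        · rw [if_neg (by decide)]; simp
      rw [OrbitEquation, hr, hP.equation_pos_iff hn]
      have h4 := ncard_eq_add_one hε hE (orbit_subset_nonsingPoints hQs hGI hE hx)
        (MulAction.mem_orbit_self (M := fieldExtSubgroup K G) x)
      have h5 := horb x hx
      rw [h4, pow_succ] at h5
      have h6 := congrArg (Int.cast : ℤ → ℝ) h5
      push_cast at h6
      linarith
    · refine (rankThreeRel hP hε hE hne hH).not_charLE (fun g x y => ?_)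
        (smul_mem_nonsingPoints hGI hE) (fun x hx => ?_) hx
      · simp only [Delta_eq hE, Set.mem_ofPred_eq, smul_mem_nonsingPoints hGI hE,
          polar_rep_smul hGI, norm_rep_smul hGI]
      · rw [horb x hx, pow_succ]
        simp only [hx, true_and, Set.ofPred_mem_eq]
        ring
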